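/- **Setting.** Consider a family, indexed by $t\in\mathbb N$, of CSS codes on $n=n_t\to\infty$ qubits with parity check matrices $H_X,H_Z$ over $\mathbb F_2$, $H_XH_Z^T=0$, such that * (LDPC) the row and column weights of $H_X,H_Z$ are bounded by constants; * (constant rate) $k=n-\operatorname{rank}H_X-\operatorname{rank}H_Z\ge r\,n$ for some $r>0$ and all large members of the family; * (linear $(\delta,\gamma)$-confinement) $\gamma>0$, $\delta$ is monotone with $\delta(n)\to\infty$ and $\log n/\delta(n)\to0$, and for all $x,z\in\mathbb F_2^n$: $\|x\|_X\le\delta(n)\Rightarrow|H_Zx|\ge\gamma\|x\|_X$ and $\|z\|_Z\le\delta(n)\Rightarrow|H_Xz|\ge\gamma\|z\|_Z$. Here $|\cdot|$ is the Hamming weight, $\|x\|_X=\min_{s\in\operatorname{Im}H_X^T}|x+s|=\bigl|x|_{\rm red}\bigr|$, where $x|_{\rm red}$ is a (fixed) vector of smallest weight in $x+\operatorname{Im}H_X^T$; similarly $\|z\|_Z$ and $z|_{\rm red}$ with $H_Z^T$. Let $\mathcal H=\sum_i\frac{1-S_{X,i}}2+\sum_i\frac{1-S_{Z,i}}2$,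 where $S_{X,i}$ ($S_{Z,i}$) is the product of Pauli $X$ ($Z$) operators over the $i$-th row of $H_X$ ($H_Z$), and let $\rho_G=e^{-\beta\mathcal H}/\operatorname{tr}e^{-\beta\mathcal H}$. Given a unit vector $|\psi\rangle$ in the code space, put $|x,z\rangle=X^xZ^z|\psi\rangle$, an eigenstate of energy $E(x,z)=|H_Zx|+|H_Xz|$. Call qubits adjacent if they share a check, and let $\mathrm{MaxConn}_{1/2}(A)$ be the largest size of a connected set $B$ of qubits with $|A\cap B|\ge\frac12|B|$ ($0$ if there is none). Define $$\mathcal V(x_0,z_0)=\operatorname{span}\{X^{x_0+x}Z^{z_0+z}|\psi\rangle:\ \mathrm{MaxConn}_{1/2}(x|_{\rm red})\le\tfrac12\delta(n),\ \mathrm{MaxConn}_{1/2}(z|_{\rm red})\le\tfrac12\delta(n)\}.$$ For a subspace $W$, let $\partial W$ be the orthogonal complement of $W$ inside the span of all $O|\phi\rangle$ with $|\phi\rangle\in W$ and $O$ an operator acting on at most $\delta(n)/4$ qubits. For given $c_2>0$, say that $W\ne0$ is a *bottleneck subspace* if $\|P_{\partial W}\rho_G\|_1\le e^{-c_2\delta(n)}\operatorname{tr}(P_W\rho_G)$,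 and that it is *extremal* if it is a bottleneck subspace and not the orthogonal direct sum of two bottleneck subspaces. The extremal Gibbs state on an extremal $W$ is $\rho_W=P_W\rho_GP_W/\operatorname{tr}(P_W\rho_G)$. A pure state is *prepared in depth $D$ with $K$-local gates* if it equals, up to a phase, $U|0\cdots0\rangle$ with $U$ a product of $D$ layers, each a product of unitary gates with disjoint supports of at most $K$ qubits. **Statement.** There are constants $\beta^*,c_1,c_2,C_0>0$, constants $c_3(K)>0$ ($K\in\mathbb N$) and a sequence $\eta_t\to0$, depending only on the code family, $\delta$ and $\gamma$, such that for all sufficiently large $t$, all $\beta>\beta^*$ and every unit vector $|\psi\rangle$ in the code space the following holds. If $(x_0,z_0)$ is drawn with probability proportional to $e^{-\beta E(x_0,z_0)}$, then with probability at least $1-C_0e^{-c_1\delta(n)}$ the subspace $\mathcal V=\mathcal V(x_0,z_0)$ has all of the following properties: 1. $\mathcal V$ is a bottleneck subspace, and it contains an extremal subspace $W\subseteq\mathcal V$. 2. For every extremal $W\subseteq\mathcal V$, the extremal Gibbs state $\rho_W$ is a density matrix supported on $\mathcal V$ and is long-range entangled: for all $K$ and all $D<c_3(K)\log\delta(n)$,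 every finite classical mixture $\sigma=\sum_jp_j|\phi_j\rangle\langle\phi_j|$ of pure states prepared in depth $D$ with $K$-local gates satisfies $\|\rho_W-\sigma\|_1\ge2-\eta_t$. 3. The same lower bound holds for every density matrix supported on $\mathcal V$ in place of $\rho_W$. 4. No unit vector in $\mathcal V$ can be prepared in depth $D<c_3(K)\log\delta(n)$ with $K$-local gates, for any $K$. -/

import Mathlib

open Filter Topology
open scoped ComplexOrder

namespace QSpinGlass

noncomputable section

/-! ### CSS codes -/

/-- A CSS code on `n` qubits: two parity check matrices over `𝔽₂` with `H_X H_Zᵀ = 0`. -/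
structure CSSCode (n : ℕ) where
  /-- number of `X`-checks -/
  mX : ℕ
  /-- number of `Z`-checks -/
  mZ : ℕ
  /-- parity check matrix of the `X`-checks -/
  HX : Matrix (Fin mX) (Fin n) (ZMod 2)
  /-- parity check matrix of the `Z`-checks -/
  HZ : Matrix (Fin mZ) (Fin n) (ZMod 2)
  comm : HX * HZ.transpose = 0

/-- Number of logical qubits `k = n - rank H_X - rank H_Z`. -/
def CSSCode.numLogical {n : ℕ} (C : CSSCode n) : ℕ := n - C.HX.rank - C.HZ.rank

/-- Every row of `H` has weight at most `wCheck`, every column has weight at most `wBit`. -/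
def BoundedDegrees {m n : ℕ} (wCheck wBit : ℕ) (H : Matrix (Fin m) (Fin n) (ZMod 2)) : Prop :=
  (∀ i, hammingNorm (fun j => H i j) ≤ wCheck) ∧ (∀ j, hammingNorm (fun i => H i j) ≤ wBit)

/-- The low-density parity check condition for a family of CSS codes: check- and bit-degrees
are bounded by constants independent of the size. -/
def IsLDPC {n : ℕ → ℕ} (C : ∀ t, CSSCode (n t)) : Prop :=
  ∃ wCheck wBit : ℕ, ∀ t,
    BoundedDegrees wCheck wBit (C t).HX ∧ BoundedDegrees wCheck wBit (C t).HZ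

/-- Constant (asymptotically non-vanishing) encoding rate: `k ≥ r n` for some `r > 0` and all
large members of the family. -/
def HasConstantRate {n : ℕ → ℕ} (C : ∀ t, CSSCode (n t)) : Prop :=
  ∃ r : ℝ, 0 < r ∧ ∀ᶠ t in atTop, r * (n t : ℝ) ≤ ((C t).numLogical : ℝ)

/-- The coset `x + Im Hᵀ`. -/
def stabCoset {m n : ℕ} (H : Matrix (Fin m) (Fin n) (ZMod 2)) (x : Fin n → ZMod 2) :
    Set (Fin n → ZMod 2) :=
  {y | ∃ a : Fin m → ZMod 2, y = x + H.transpose.mulVec a}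

theorem stabCoset_nonempty {m n : ℕ} (H : Matrix (Fin m) (Fin n) (ZMod 2))
    (x : Fin n → ZMod 2) : (stabCoset H x).Nonempty :=
  ⟨x, 0, by simp⟩

/-- The representative `x|_red` of smallest Hamming weight in the class of `x` modulo `Im Hᵀ`
(a fixed choice, depending on the class only, if there are several). -/
def reduced {m n : ℕ} (H : Matrix (Fin m) (Fin n) (ZMod 2)) (x : Fin n → ZMod 2) :
    Fin n → ZMod 2 :=
  Function.argminOn (fun y : Fin n → ZMod 2 => hammingNorm y) (stabCoset H x)
    (stabCoset_nonempty H x)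

/-- The reduced weight `min_{s ∈ Im Hᵀ} |x + s| = |x|_red|`. -/
def reducedWeight {m n : ℕ} (H : Matrix (Fin m) (Fin n) (ZMod 2)) (x : Fin n → ZMod 2) : ℕ :=
  hammingNorm (reduced H x)

/-- Linear `(δ, γ)`-confinement (boundary and coboundary) of a family of CSS codes, where `δ`
is monotone and diverges super-logarithmically, and `γ > 0`. -/
structure HasLinearConfinement {n : ℕ → ℕ} (C : ∀ t, CSSCode (n t)) (δ : ℕ → ℝ) (γ : ℝ) :
    Prop where
  mono : Monotone δ
  diverges : Tendsto δ atTop atTop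
  superlog : Tendsto (fun N : ℕ => Real.log (N : ℝ) / δ N) atTop (𝓝 0)
  gamma_pos : 0 < γ
  boundary : ∀ t, ∀ x : Fin (n t) → ZMod 2,
    (reducedWeight (C t).HX x : ℝ) ≤ δ (n t) →
      γ * (reducedWeight (C t).HX x : ℝ) ≤ (hammingNorm ((C t).HZ.mulVec x) : ℝ)
  coboundary : ∀ t, ∀ z : Fin (n t) → ZMod 2,
    (reducedWeight (C t).HZ z : ℝ) ≤ δ (n t) →
      γ * (reducedWeight (C t).HZ z : ℝ) ≤ (hammingNorm ((C t).HX.mulVec z) : ℝ)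

/-! ### Qubits, Pauli operators, Hamiltonian and Gibbs state -/

/-- The Hilbert space of `n` qubits; the computational basis is indexed by `𝔽₂ⁿ`. -/
abbrev QState (n : ℕ) : Type := EuclideanSpace ℂ (Fin n → ZMod 2)

/-- Operators on `n` qubits, as matrices in the computational basis. -/
abbrev Op (n : ℕ) : Type := Matrix (Fin n → ZMod 2) (Fin n → ZMod 2) ℂ

/-- The action of an operator on a state vector. -/
def act {n : ℕ} (A : Op n) (ψ : QState n) : QState n := Matrix.toEuclideanLin A ψ

/-- `X^x`, that is `|b⟩ ↦ |b + x⟩`. -/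
def pauliX {n : ℕ} (x : Fin n → ZMod 2) : Op n :=
  Matrix.of fun a b => if a = b + x then 1 else 0

/-- `Z^z`, that is `|b⟩ ↦ (-1)^{z·b} |b⟩`. -/
def pauliZ {n : ℕ} (z : Fin n → ZMod 2) : Op n :=
  Matrix.diagonal fun b => if dotProduct z b = 0 then 1 else -1

/-- The code space: common `+1` eigenspace of all checks `S_{X,i} = X^{row i of H_X}` and
`S_{Z,i} = Z^{row i of H_Z}`. -/
def CSSCode.codeSpace {n : ℕ} (C : CSSCode n) : Set (QState n) :=
  {ψ | (∀ i, act (pauliX (C.HX i)) ψ = ψ) ∧ (∀ i, act (pauliZ (C.HZ i)) ψ = ψ)}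

/-- The Hamiltonian `∑ᵢ (1 - S_{X,i})/2 + ∑ᵢ (1 - S_{Z,i})/2`, which counts violated checks. -/
def CSSCode.hamiltonian {n : ℕ} (C : CSSCode n) : Op n :=
  ∑ i, (2⁻¹ : ℂ) • (1 - pauliX (C.HX i)) + ∑ i, (2⁻¹ : ℂ) • (1 - pauliZ (C.HZ i))

/-- The Gibbs state `e^{-β H} / tr e^{-β H}`. -/
def CSSCode.gibbsState {n : ℕ} (C : CSSCode n) (β : ℝ) : Op n :=
  (Matrix.trace (NormedSpace.exp ((-(β : ℂ)) • C.hamiltonian)))⁻¹ •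
    NormedSpace.exp ((-(β : ℂ)) • C.hamiltonian)

/-- Energy of the eigenstate `|x, z⟩ = X^x Z^z |ψ⟩` (`ψ` a ground state):
`|H_Z x| + |H_X z|`. -/
def CSSCode.energy {n : ℕ} (C : CSSCode n) (p : (Fin n → ZMod 2) × (Fin n → ZMod 2)) : ℝ :=
  (hammingNorm (C.HZ.mulVec p.1) : ℝ) + (hammingNorm (C.HX.mulVec p.2) : ℝ)

open Classical in
/-- Probability of a set of labels `(x, z)` when the eigenstate `|x, z⟩` is drawn from the
Gibbs distribution, `p(x, z) ∝ e^{-β E(x, z)}`. -/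
def CSSCode.gibbsProb {n : ℕ} (C : CSSCode n) (β : ℝ)
    (S : Set ((Fin n → ZMod 2) × (Fin n → ZMod 2))) : ℝ :=
  (∑ p ∈ Finset.univ.filter (fun p => p ∈ S), Real.exp (-β * C.energy p)) /
    ∑ p, Real.exp (-β * C.energy p)

/-! ### The subspace around an eigenstate -/

/-- Interaction graph of the Hamiltonian: two qubits are adjacent if they share a check. -/
def CSSCode.interactionGraph {n : ℕ} (C : CSSCode n) : SimpleGraph (Fin n) where
  Adj i j := i ≠ j ∧
    ((∃ c, C.HX c i ≠ 0 ∧ C.HX c j ≠ 0) ∨ (∃ c, C.HZ c i ≠ 0 ∧ C.HZ c j ≠ 0))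
  symm := ⟨fun _ _ h => ⟨h.1.symm,
    h.2.imp (fun ⟨c, h1, h2⟩ => ⟨c, h2, h1⟩) (fun ⟨c, h1, h2⟩ => ⟨c, h2, h1⟩)⟩⟩
  loopless := ⟨fun _ h => h.1 rfl⟩

open Classical in
/-- `MaxConn_α(A)`: the size of the largest connected `α`-subset of `A`, i.e. of the largest
set `B` of vertices that induces a connected subgraph and satisfies `|A ∩ B| ≥ α |B|`. -/
def maxConn {V : Type*} [Fintype V] (G : SimpleGraph V) (α : ℝ) (A : Finset V) : ℕ :=
  (Finset.univ.filter fun B : Finset V =>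
    (G.induce (B : Set V)).Connected ∧ α * (B.card : ℝ) ≤ ((A ∩ B).card : ℝ)).sup Finset.card

/-- The support of a binary vector. -/
def supp {n : ℕ} (x : Fin n → ZMod 2) : Finset (Fin n) := Finset.univ.filter fun i => x i ≠ 0

/-- `𝒱(x₀, z₀)`: the span of the states `X^{x₀+x} Z^{z₀+z} |ψ⟩` over all fluctuations `x`, `z`
with `MaxConn_{1/2}(x|_red) ≤ δ/2` and `MaxConn_{1/2}(z|_red) ≤ δ/2`; here `ψ` is the reference
ground state and `d` is the confinement scale `δ(n)`. -/
def CSSCode.component {n : ℕ} (C : CSSCode n) (d : ℝ) (ψ : QState n)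
    (p : (Fin n → ZMod 2) × (Fin n → ZMod 2)) : Submodule ℂ (QState n) :=
  Submodule.span ℂ {φ | ∃ x z : Fin n → ZMod 2,
    (maxConn C.interactionGraph (1 / 2) (supp (reduced C.HX x)) : ℝ) ≤ d / 2 ∧
    (maxConn C.interactionGraph (1 / 2) (supp (reduced C.HZ z)) : ℝ) ≤ d / 2 ∧
    φ = act (pauliX (p.1 + x) * pauliZ (p.2 + z)) ψ}

/-! ### Bottlenecks and extremal Gibbs states -/

open Classical in
/-- The operator `O` acts only on the qubits in `A`: `O = M ⊗ 1` with `M` acting on `A`. -/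
def ActsOn {n : ℕ} (A : Finset (Fin n)) (O : Op n) : Prop :=
  ∃ M : Matrix (A → ZMod 2) (A → ZMod 2) ℂ, ∀ a b : Fin n → ZMod 2,
    O a b = if ∀ i, i ∉ A → a i = b i then M (fun i => a i) (fun i => b i) else 0

/-- The `r`-Hilbert space neighbourhood of a subspace: the span of all `O ψ` with `ψ` in the
subspace and `O` acting on at most `r` qubits. -/
def hilbertNeighborhood {n : ℕ} (r : ℝ) (W : Submodule ℂ (QState n)) :
    Submodule ℂ (QState n) :=
  Submodule.span ℂ {φ | ∃ (A : Finset (Fin n)) (O : Op n) (ψ : QState n),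
    (A.card : ℝ) ≤ r ∧ ActsOn A O ∧ ψ ∈ W ∧ φ = act O ψ}

/-- The `r`-boundary: the orthogonal complement of `W` within its `r`-neighbourhood. -/
def hilbertBoundary {n : ℕ} (r : ℝ) (W : Submodule ℂ (QState n)) : Submodule ℂ (QState n) :=
  hilbertNeighborhood r W ⊓ Wᗮ

/-- The orthogonal projector onto a subspace, as a matrix. -/
def proj {n : ℕ} (W : Submodule ℂ (QState n)) : Op n :=
  Matrix.toEuclideanLin.symm (W.starProjection : QState n →ₗ[ℂ] QState n)

/-- The trace norm: the sum of the singular values. -/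
def traceNorm {n : ℕ} (A : Op n) : ℝ :=
  ∑ i, Real.sqrt ((Matrix.isHermitian_conjTranspose_mul_self A).eigenvalues i)

/-- `W ≠ 0` satisfies the bottleneck condition for the state `ρ` with boundary width `r` and
bottleneck ratio at most `ε`: `‖P_{∂W} ρ‖₁ / tr(P_W ρ) ≤ ε`. -/
def IsBottleneck {n : ℕ} (ρ : Op n) (r ε : ℝ) (W : Submodule ℂ (QState n)) : Prop :=
  W ≠ ⊥ ∧ traceNorm (proj (hilbertBoundary r W) * ρ) / (Matrix.trace (proj W * ρ)).re ≤ ε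

/-- `W` is extremal: it satisfies the bottleneck condition, and it is not the orthogonal direct
sum of two (nonzero) subspaces which both satisfy it. -/
def IsExtremal {n : ℕ} (ρ : Op n) (r ε : ℝ) (W : Submodule ℂ (QState n)) : Prop :=
  IsBottleneck ρ r ε W ∧
    ¬ ∃ W₁ W₂ : Submodule ℂ (QState n), W₁ ⟂ W₂ ∧ W₁ ⊔ W₂ = W ∧
      IsBottleneck ρ r ε W₁ ∧ IsBottleneck ρ r ε W₂

/-- The component `P_W ρ P_W / tr(P_W ρ)` of the state `ρ` on `W`. -/
def stateComponent {n : ℕ} (ρ : Op n) (W : Submodule ℂ (QState n)) : Op n :=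
  (Matrix.trace (proj W * ρ))⁻¹ • (proj W * ρ * proj W)

/-! ### Circuit complexity -/

/-- One layer of a circuit: a product of unitary gates with pairwise disjoint supports of at
most `K` qubits each. -/
def IsLayer {n : ℕ} (K : ℕ) (U : Op n) : Prop :=
  ∃ (m : ℕ) (A : Fin m → Finset (Fin n)) (g : Fin m → Op n),
    (∀ i j, i ≠ j → Disjoint (A i) (A j)) ∧
    (∀ i, (A i).card ≤ K ∧ g i ∈ Matrix.unitaryGroup (Fin n → ZMod 2) ℂ ∧ ActsOn (A i) (g i)) ∧
    U = (List.ofFn g).prod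

/-- A circuit of depth (at most) `D` of gates acting on at most `K` qubits each; layers may be
empty. -/
def IsCircuit {n : ℕ} (K D : ℕ) (U : Op n) : Prop :=
  ∃ L : List (Op n), L.length = D ∧ (∀ V ∈ L, IsLayer K V) ∧ U = L.prod

/-- The pure state `φ` is prepared, up to a phase, from `|0…0⟩` by a depth-`D` circuit of
`K`-qubit gates. -/
def IsPreparable {n : ℕ} (K D : ℕ) (φ : QState n) : Prop :=
  ∃ (U : Op n) (c : ℂ), IsCircuit K D U ∧ ‖c‖ = 1 ∧
    φ = c • act U (EuclideanSpace.single (0 : Fin n → ZMod 2) (1 : ℂ))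

/-- The density matrix `σ` is a classical mixture of pure states preparable by depth-`D`
circuits of `K`-qubit gates. -/
def IsPreparableMixture {n : ℕ} (K D : ℕ) (σ : Op n) : Prop :=
  ∃ (m : ℕ) (q : Fin m → ℝ) (φ : Fin m → QState n),
    (∀ j, 0 ≤ q j ∧ IsPreparable K D (φ j)) ∧ ∑ j, q j = 1 ∧
    σ = ∑ j, (q j : ℂ) • Matrix.vecMulVec (fun a => φ j a) (fun a => star (φ j a))

/-- `ρ` is within trace-norm distance less than `ε` of a classical mixture of states that are
preparable by depth-`D` circuits of `K`-qubit gates. -/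
def IsApproxPreparable {n : ℕ} (K D : ℕ) (ε : ℝ) (ρ : Op n) : Prop :=
  ∃ σ : Op n, IsPreparableMixture K D σ ∧ traceNorm (ρ - σ) < ε

/-- `ρ` is a density matrix. -/
def IsDensity {n : ℕ} (ρ : Op n) : Prop := ρ.PosSemidef ∧ ρ.trace = 1

/-- `ρ` is supported on the subspace `W`. -/
def SupportedOn {n : ℕ} (ρ : Op n) (W : Submodule ℂ (QState n)) : Prop :=
  proj W * ρ * proj W = ρ

end

end QSpinGlass

/-!
The labels `(x, z)` split into an `X`-sector and a `Z`-sector that can be treated separately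
(`IsSector`), since energies add and the Gibbs distribution factorizes. Two facts about one sector
carry the proof.

*Confinement is additive over clusters.* The syndrome of an error is the disjoint sum of the
syndromes of its clusters in the interaction graph, so linear confinement, assumed up to reduced
weight `δ`, holds for errors of any weight whose clusters are small
(`IsSector.confined_of_smallClusters`). Two errors whose reduced forms have only small half-filled
clusters, and a further light error, therefore combine to a stabilizer as soon as they are undetected
(`IsSector.mem_stab_of_local`). Hence distinct classes in a component give orthogonal eigenstates,
and operators on few qubits satisfy the Knill–Laflamme condition between dressed code states of the
component (`IsConfinedCode.mem_scalarOn`).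

*Peierls argument.* The neighbourhood of a component is spanned by eigenstates with admissible
labels. Such a label outside the component has a large half-filled cluster, and removing the union
`Λ` of all large clusters lowers the energy by a multiple of `|Λ|`, provided that the violated checks
of the centre `(x₀, z₀)` have low density near `Λ` (`IsSector.exists_removal`). Since unions of large
connected sets are counted by site percolation (`sum_rootedSets_le`), at low temperature the boundary
has relative weight exponentially small in `δ`. The density condition on the centre holds with high
probability: a Griffiths inequality shows that switching off the checks near `Λ` changes the
partition function by at most a factor of two per check (`sum_not_typical_le`). The boundary is
spanned by eigenvectors of the Gibbs state, so its trace norm is a sum of Boltzmann weights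
(`IsConfinedCode.isBottleneck`). An extremal subspace exists since splitting lowers the dimension.

*Shallow states.* Let a state prepared by a shallow circuit `U` overlap with a unit vector `M ψ` of
the component, where `M` is a combination of error operators. Undo the circuit. Then `U† M ψ` has
weight at least the overlap `q` on the all-zero string, so after conditioning on logarithmically many qubits
being `0`, every other qubit is excited with small probability (`exists_stationary`). These
probabilities are measured by operators on small light cones, so by the Knill–Laflamme condition they
are the same for `U† M ψ'` with any code state `ψ'`. All of these orthogonal states thus live
largely on strings of small weight, which are too few for a code of constant rate
(`IsConfinedCode.finrank_mul_le`). So shallow pure states, and with them their mixtures, have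
vanishing overlap with the component, and the reflection in the component distinguishes them from any
state supported there (`not_isApproxPreparable`).
-/

namespace QSpinGlass

noncomputable section

/-! ### Binary vectors modulo stabilizers -/

section Vectors

variable {n m m₁ m₂ : ℕ}

theorem add_self_vec (x : Fin n → ZMod 2) : x + x = 0 := by
  funext i; exact CharTwo.add_self_eq_zero (x i)

theorem add_add_cancel_vec (x y : Fin n → ZMod 2) : x + (x + y) = y := by
  rw [← add_assoc, add_self_vec, zero_add]

/-- The restriction of a binary vector to a set of coordinates. -/
def mask (s : Finset (Fin n)) (x : Fin n → ZMod 2) : Fin n → ZMod 2 :=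
  fun i => if i ∈ s then x i else 0

theorem mask_add (s : Finset (Fin n)) (x y : Fin n → ZMod 2) :
    mask s (x + y) = mask s x + mask s y := by
  funext i; by_cases h : i ∈ s <;> simp [mask, h]

theorem mask_add_mask_compl (s : Finset (Fin n)) (x : Fin n → ZMod 2) :
    mask s x + mask sᶜ x = x := by
  funext i; by_cases h : i ∈ s <;> simp [mask, h]

@[simp] theorem mem_supp {x : Fin n → ZMod 2} {i : Fin n} : i ∈ supp x ↔ x i ≠ 0 := by
  simp [supp]

theorem hammingNorm_eq_card_supp (x : Fin n → ZMod 2) : hammingNorm x = (supp x).card := rfl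

theorem supp_mask (s : Finset (Fin n)) (x : Fin n → ZMod 2) : supp (mask s x) = supp x ∩ s := by
  ext i; by_cases h : i ∈ s <;> simp [mask, h]

theorem supp_add_subset (x y : Fin n → ZMod 2) : supp (x + y) ⊆ supp x ∪ supp y := by
  intro i; simp only [mem_supp, Pi.add_apply, Finset.mem_union]
  intro h; by_contra! h'; simp [h'.1, h'.2] at h

theorem hammingNorm_add_le (x y : Fin n → ZMod 2) :
    hammingNorm (x + y) ≤ hammingNorm x + hammingNorm y :=
  (Finset.card_le_card (supp_add_subset x y)).trans (Finset.card_union_le _ _)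

theorem hammingNorm_mask_add_mask_compl (s : Finset (Fin n)) (x : Fin n → ZMod 2) :
    hammingNorm (mask s x) + hammingNorm (mask sᶜ x) = hammingNorm x := by
  simp only [hammingNorm_eq_card_supp, supp_mask]
  rw [← Finset.card_union_of_disjoint]
  · rw [← Finset.inter_union_distrib_left]; simp
  · exact Finset.disjoint_left.2 fun i hi hj => by simp at hi hj; exact hj.2 hi.2

/-- The span of the rows of `H`: the vectors of the stabilizer operators. -/
def stab (H : Matrix (Fin m) (Fin n) (ZMod 2)) : Submodule (ZMod 2) (Fin n → ZMod 2) :=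
  LinearMap.range H.transpose.mulVecLin

theorem mem_stabCoset_iff {H : Matrix (Fin m) (Fin n) (ZMod 2)} {x y : Fin n → ZMod 2} :
    y ∈ stabCoset H x ↔ x + y ∈ stab H := by
  constructor
  · rintro ⟨a, rfl⟩; rw [add_add_cancel_vec]; exact ⟨a, rfl⟩
  · rintro ⟨a, ha⟩
    refine ⟨a, ?_⟩
    rw [Matrix.mulVecLin_apply] at ha
    rw [ha, add_add_cancel_vec]

theorem add_reduced_mem (H : Matrix (Fin m) (Fin n) (ZMod 2)) (x : Fin n → ZMod 2) :
    x + reduced H x ∈ stab H :=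
  mem_stabCoset_iff.1 (Function.argminOn_mem _ _ (stabCoset_nonempty H x))

theorem reducedWeight_le {H : Matrix (Fin m) (Fin n) (ZMod 2)} {x y : Fin n → ZMod 2}
    (h : x + y ∈ stab H) : reducedWeight H x ≤ hammingNorm y :=
  Function.argminOn_le (fun y : Fin n → ZMod 2 => hammingNorm y) _ (mem_stabCoset_iff.2 h)

theorem mem_stab_trans {H : Matrix (Fin m) (Fin n) (ZMod 2)} {x y z : Fin n → ZMod 2}
    (h : x + y ∈ stab H) (h' : y + z ∈ stab H) : x + z ∈ stab H := by
  have := (stab H).add_mem h h'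
  rwa [add_assoc, add_add_cancel_vec] at this

theorem mem_stab_symm {H : Matrix (Fin m) (Fin n) (ZMod 2)} {x y : Fin n → ZMod 2}
    (h : x + y ∈ stab H) : y + x ∈ stab H := by rwa [add_comm]

theorem reduced_congr {H : Matrix (Fin m) (Fin n) (ZMod 2)} {x y : Fin n → ZMod 2}
    (h : x + y ∈ stab H) : reduced H x = reduced H y := by
  have : stabCoset H x = stabCoset H y := by
    ext z; rw [mem_stabCoset_iff, mem_stabCoset_iff]
    exact ⟨mem_stab_trans (mem_stab_symm h), mem_stab_trans h⟩
  unfold reduced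
  congr 1

theorem reducedWeight_congr {H : Matrix (Fin m) (Fin n) (ZMod 2)} {x y : Fin n → ZMod 2}
    (h : x + y ∈ stab H) : reducedWeight H x = reducedWeight H y := by
  unfold reducedWeight; rw [reduced_congr h]

theorem reduced_reduced (H : Matrix (Fin m) (Fin n) (ZMod 2)) (x : Fin n → ZMod 2) :
    reduced H (reduced H x) = reduced H x :=
  (reduced_congr (add_reduced_mem H x)).symm

theorem reducedWeight_le_hammingNorm (H : Matrix (Fin m) (Fin n) (ZMod 2)) (x : Fin n → ZMod 2) :
    reducedWeight H x ≤ hammingNorm x :=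
  reducedWeight_le (by rw [add_self_vec]; exact (stab H).zero_mem)

theorem reducedWeight_add_le (H : Matrix (Fin m) (Fin n) (ZMod 2)) (x y : Fin n → ZMod 2) :
    reducedWeight H (x + y) ≤ reducedWeight H x + reducedWeight H y := by
  refine (reducedWeight_le (y := reduced H x + reduced H y) ?_).trans (hammingNorm_add_le _ _)
  rw [add_add_add_comm]
  exact (stab H).add_mem (add_reduced_mem H x) (add_reduced_mem H y)

theorem reducedWeight_sum_le {ι : Type*} (H : Matrix (Fin m) (Fin n) (ZMod 2)) (s : Finset ι)
    (f : ι → Fin n → ZMod 2) :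
    reducedWeight H (∑ k ∈ s, f k) ≤ ∑ k ∈ s, reducedWeight H (f k) := by
  classical
  induction s using Finset.induction_on with
  | empty => simpa using reducedWeight_le_hammingNorm H 0
  | insert a s ha ih =>
    rw [Finset.sum_insert ha, Finset.sum_insert ha]
    exact (reducedWeight_add_le H _ _).trans (by lia)

theorem mem_stab_of_mul_reducedWeight_nonpos {H : Matrix (Fin m) (Fin n) (ZMod 2)}
    {x : Fin n → ZMod 2} {γ : ℝ} (hγ : 0 < γ) (h : γ * reducedWeight H x ≤ 0) : x ∈ stab H := by
  have h1 : (reducedWeight H x : ℝ) ≤ 0 := nonpos_of_mul_nonpos_right h hγ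
  have h2 : reducedWeight H x = 0 := by exact_mod_cast le_antisymm h1 (Nat.cast_nonneg _)
  have h0 : reduced H x = 0 := hammingNorm_eq_zero.1 h2
  simpa [h0] using add_reduced_mem H x

/-- A vector of least weight in its class modulo stabilizers. -/
def IsLeast (H : Matrix (Fin m) (Fin n) (ZMod 2)) (x : Fin n → ZMod 2) : Prop :=
  reducedWeight H x = hammingNorm x

theorem isLeast_reduced (H : Matrix (Fin m) (Fin n) (ZMod 2)) (x : Fin n → ZMod 2) :
    IsLeast H (reduced H x) := by
  unfold IsLeast reducedWeight; rw [reduced_reduced]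

/-- Restrictions of least-weight vectors have least weight. -/
theorem IsLeast.mask {H : Matrix (Fin m) (Fin n) (ZMod 2)} {x : Fin n → ZMod 2}
    (hx : IsLeast H x) (s : Finset (Fin n)) : IsLeast H (mask s x) := by
  refine le_antisymm (reducedWeight_le_hammingNorm _ _) ?_
  have h1 := reducedWeight_add_le H (QSpinGlass.mask s x) (QSpinGlass.mask sᶜ x)
  rw [mask_add_mask_compl, hx, ← hammingNorm_mask_add_mask_compl s] at h1
  have h2 := reducedWeight_le_hammingNorm H (QSpinGlass.mask sᶜ x)
  lia

end Vectors

/-! ### Clusters -/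

section Clusters

variable {n m m₁ m₂ : ℕ}

/-- The graph on all vertices keeping only the edges of `G` inside `S`; vertices outside `S` become
isolated. -/
def within (G : SimpleGraph (Fin n)) (S : Finset (Fin n)) : SimpleGraph (Fin n) where
  Adj i j := G.Adj i j ∧ i ∈ S ∧ j ∈ S
  symm := ⟨fun _ _ h => ⟨h.1.symm, h.2.2, h.2.1⟩⟩
  loopless := ⟨fun _ h => G.loopless.irrefl _ h.1⟩

/-- The cluster of `S` given by a connected component of `within G S`. It is empty for the component
of a vertex outside `S`, so the clusters partition `S` but may be empty. -/
def cluster (G : SimpleGraph (Fin n)) (S : Finset (Fin n)) (k : (within G S).ConnectedComponent) :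
    Finset (Fin n) := by
  classical exact S.filter fun j => (within G S).connectedComponentMk j = k

theorem mem_cluster {G : SimpleGraph (Fin n)} {S : Finset (Fin n)}
    {k : (within G S).ConnectedComponent} {j : Fin n} :
    j ∈ cluster G S k ↔ j ∈ S ∧ (within G S).connectedComponentMk j = k := by
  classical simp [cluster]

theorem connected_cluster {G : SimpleGraph (Fin n)} {S : Finset (Fin n)} {i : Fin n}
    (hi : i ∈ S) :
    (G.induce (cluster G S ((within G S).connectedComponentMk i) : Set (Fin n))).Connected := by
  set k := (within G S).connectedComponentMk i with hk
  have hset : (cluster G S k : Set (Fin n)) = k.supp := by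
    ext j
    simp only [Finset.mem_coe, mem_cluster, SimpleGraph.ConnectedComponent.mem_supp_iff,
      and_iff_right_iff_imp]
    intro hj
    rw [hk, SimpleGraph.ConnectedComponent.eq, SimpleGraph.reachable_iff_reflTransGen] at hj
    rcases Relation.ReflTransGen.cases_head hj with h | ⟨c, hc, -⟩
    · rwa [h]
    · exact hc.2.1
  rw [hset]
  refine SimpleGraph.Connected.mono ?_ k.connected_toSimpleGraph
  intro a b h
  exact h.1

/-- Every connected subset of `S` has at most `d` elements. -/
def SmallClusters (G : SimpleGraph (Fin n)) (d : ℝ) (S : Finset (Fin n)) : Prop :=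
  ∀ B ⊆ S, (G.induce (B : Set (Fin n))).Connected → (B.card : ℝ) ≤ d

theorem SmallClusters.mono {G : SimpleGraph (Fin n)} {d : ℝ} {S T : Finset (Fin n)}
    (h : SmallClusters G d T) (hST : S ⊆ T) : SmallClusters G d S :=
  fun B hB hc => h B (hB.trans hST) hc

/-- Every connected set of which at least half lies in `A` has at most `d` elements. -/
def SmallHalfClusters (G : SimpleGraph (Fin n)) (d : ℝ) (A : Finset (Fin n)) : Prop :=
  ∀ B : Finset (Fin n), (G.induce (B : Set (Fin n))).Connected →
    (B.card : ℝ) ≤ 2 * ((A ∩ B).card : ℝ) → (B.card : ℝ) ≤ d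

open Classical in
theorem maxConn_le_iff {V : Type*} [Fintype V] {G : SimpleGraph V} {α : ℝ} {A : Finset V} {m : ℕ} :
    maxConn G α A ≤ m ↔ ∀ B : Finset V, (G.induce (B : Set V)).Connected →
      α * (B.card : ℝ) ≤ ((A ∩ B).card : ℝ) → B.card ≤ m := by
  simp only [maxConn, Finset.sup_le_iff, Finset.mem_filter, Finset.mem_univ, true_and, and_imp]

theorem smallHalfClusters_iff {G : SimpleGraph (Fin n)} {d : ℝ} (hd : 0 ≤ d)
    {A : Finset (Fin n)} :
    SmallHalfClusters G d A ↔ (maxConn G (1 / 2) A : ℝ) ≤ d := by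
  rw [← Nat.le_floor_iff hd, maxConn_le_iff]
  refine forall_congr' fun B => imp_congr_right fun _ => imp_congr ?_ (Nat.le_floor_iff hd).symm
  have e : ∀ c : ℕ, (B.card : ℝ) ≤ 2 * (c : ℝ) ↔ 1 / 2 * (B.card : ℝ) ≤ (c : ℝ) := fun c => by
    constructor <;> intro h <;> linarith
  rw [e]
  convert Iff.rfl

theorem smallHalfClusters_of_card_le {G : SimpleGraph (Fin n)} {d : ℝ} {A : Finset (Fin n)}
    (h : 2 * (A.card : ℝ) ≤ d) : SmallHalfClusters G d A := by
  intro B _ hB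
  have : ((A ∩ B).card : ℝ) ≤ A.card := by exact_mod_cast Finset.card_le_card Finset.inter_subset_left
  linarith

/-- Inside a union of two sets, a connected set lies at least half in one of them. -/
theorem SmallHalfClusters.union {G : SimpleGraph (Fin n)} {d : ℝ} {A A' : Finset (Fin n)}
    (h : SmallHalfClusters G d A) (h' : SmallHalfClusters G d A') :
    SmallClusters G d (A ∪ A') := by
  intro B hB hc
  have h1 : B.card ≤ (A ∩ B).card + (A' ∩ B).card := by
    refine le_trans (Finset.card_le_card ?_) (Finset.card_union_le _ _)
    intro i hi
    have := hB hi
    simp only [Finset.mem_union, Finset.mem_inter] at this ⊢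
    tauto
  have h1' : (B.card : ℝ) ≤ (A ∩ B).card + (A' ∩ B).card := by exact_mod_cast h1
  by_cases h2 : (B.card : ℝ) ≤ 2 * ((A ∩ B).card : ℝ)
  · exact h B hc h2
  · exact h' B hc (by linarith)

/-- One sector of a CSS code: errors are binary vectors modulo the row space of `H₁`, their syndrome
under `H₂` is well defined on classes, and coordinates sharing a row of `H₂` are adjacent in `G`.
The `X`-errors have `H₁ = H_X`, `H₂ = H_Z`, and the `Z`-errors the reverse. -/
structure IsSector (H₁ : Matrix (Fin m₁) (Fin n) (ZMod 2)) (H₂ : Matrix (Fin m₂) (Fin n) (ZMod 2))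
    (G : SimpleGraph (Fin n)) : Prop where
  mulVec_stab : ∀ s ∈ stab H₁, H₂.mulVec s = 0
  adj : ∀ c i j, i ≠ j → H₂ c i ≠ 0 → H₂ c j ≠ 0 → G.Adj i j

/-- Linear confinement of one sector at scale `d`: errors of reduced weight at most `d` have syndromes
of proportional weight. -/
def Confined (H₁ : Matrix (Fin m₁) (Fin n) (ZMod 2)) (H₂ : Matrix (Fin m₂) (Fin n) (ZMod 2))
    (d γ : ℝ) : Prop :=
  ∀ x, (reducedWeight H₁ x : ℝ) ≤ d → γ * reducedWeight H₁ x ≤ hammingNorm (H₂.mulVec x)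

variable {H₁ : Matrix (Fin m₁) (Fin n) (ZMod 2)} {H₂ : Matrix (Fin m₂) (Fin n) (ZMod 2)}
  {G : SimpleGraph (Fin n)}

/-- `A ∩ S` is a union of clusters of `S`. -/
def Saturated (G : SimpleGraph (Fin n)) (S A : Finset (Fin n)) : Prop :=
  ∀ i ∈ S, ∀ j ∈ S, G.Adj i j → i ∈ A → j ∈ A

theorem Saturated.compl {S A : Finset (Fin n)} (h : Saturated G S A) : Saturated G S Aᶜ := by
  intro i hi j hj hij hA
  rw [Finset.mem_compl] at hA ⊢
  exact fun h' => hA (h j hj i hi hij.symm h')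

theorem saturated_cluster (S : Finset (Fin n)) (k : (within G S).ConnectedComponent) :
    Saturated G S (cluster G S k) := by
  intro i hi j hj hij hA
  rw [mem_cluster] at hA ⊢
  refine ⟨hj, ?_⟩
  rw [← hA.2]
  refine (SimpleGraph.ConnectedComponent.sound ?_).symm
  exact SimpleGraph.Adj.reachable ⟨hij, hi, hj⟩

theorem mulVec_apply_eq_zero {H : Matrix (Fin m) (Fin n) (ZMod 2)} {y : Fin n → ZMod 2} {c : Fin m}
    (h : ∀ i, H c i ≠ 0 → y i = 0) : H.mulVec y c = 0 := by
  unfold Matrix.mulVec dotProduct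
  refine Finset.sum_eq_zero fun i _ => ?_
  by_cases hi : H c i = 0
  · simp [hi]
  · simp [h i hi]

theorem mulVec_apply_congr {H : Matrix (Fin m) (Fin n) (ZMod 2)} {y y' : Fin n → ZMod 2} {c : Fin m}
    (h : ∀ i, H c i ≠ 0 → y i = y' i) : H.mulVec y c = H.mulVec y' c := by
  unfold Matrix.mulVec dotProduct
  refine Finset.sum_congr rfl fun i _ => ?_
  by_cases hi : H c i = 0
  · simp [hi]
  · simp [h i hi]

/-- A row of `H₂` cannot meet two different clusters. -/
theorem IsSector.mulVec_mask (h : IsSector H₁ H₂ G) {S A : Finset (Fin n)} (hA : Saturated G S A)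
    {y : Fin n → ZMod 2} (hy : supp y ⊆ S) {c : Fin m₂} {i : Fin n} (hi : i ∈ S)
    (hc : H₂ c i ≠ 0) :
    H₂.mulVec (mask A y) c = if i ∈ A then H₂.mulVec y c else 0 := by
  have key : ∀ j, H₂ c j ≠ 0 → y j ≠ 0 → (i ∈ A ↔ j ∈ A) := by
    intro j hj hyj
    have hjS : j ∈ S := hy (mem_supp.2 hyj)
    by_cases hij : i = j
    · rw [hij]
    · have := h.adj c i j hij hc hj
      exact ⟨hA i hi j hjS this, hA j hjS i hi this.symm⟩
  split_ifs with hiA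
  · refine mulVec_apply_congr fun j hj => ?_
    by_cases hyj : y j = 0
    · simp [mask, hyj]
    · simp [mask, (key j hj hyj).1 hiA]
  · refine mulVec_apply_eq_zero fun j hj => ?_
    by_cases hyj : y j = 0
    · simp [mask, hyj]
    · have : j ∉ A := fun h => hiA ((key j hj hyj).2 h)
      simp [mask, this]

theorem IsSector.mulVec_mask_eq (h : IsSector H₁ H₂ G) {S A : Finset (Fin n)}
    (hA : Saturated G S A) {y : Fin n → ZMod 2} (hy : supp y ⊆ S) (c : Fin m₂) :
    H₂.mulVec (mask A y) c = 0 ∨ H₂.mulVec (mask Aᶜ y) c = 0 := by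
  by_cases hc : ∃ i ∈ S, H₂ c i ≠ 0
  · obtain ⟨i, hi, hci⟩ := hc
    rw [h.mulVec_mask hA hy hi hci, h.mulVec_mask hA.compl hy hi hci]
    by_cases hiA : i ∈ A <;> simp [hiA]
  · left
    push Not at hc
    refine mulVec_apply_eq_zero fun j hj => ?_
    have : y j = 0 := by
      by_contra hyj
      exact hj (hc j (hy (mem_supp.2 hyj)))
    simp [mask, this]

theorem sum_mask_cluster (S : Finset (Fin n)) {y : Fin n → ZMod 2} (hy : supp y ⊆ S)
    [Fintype (within G S).ConnectedComponent] :
    ∑ k, mask (cluster G S k) y = y := by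
  classical
  funext j
  rw [Finset.sum_apply]
  by_cases hj : j ∈ S
  · rw [Finset.sum_eq_single ((within G S).connectedComponentMk j)]
    · simp [mask, mem_cluster, hj]
    · intro k _ hk
      simp [mask, mem_cluster, hj, hk.symm]
    · simp
  · have : y j = 0 := by by_contra h; exact hj (hy (mem_supp.2 h))
    simp [mask, this]

/-- The syndrome of a vector is the disjoint sum of the syndromes of its clusters. -/
theorem IsSector.hammingNorm_mulVec_eq_sum (h : IsSector H₁ H₂ G) (S : Finset (Fin n))
    {y : Fin n → ZMod 2} (hy : supp y ⊆ S) [Fintype (within G S).ConnectedComponent] :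
    hammingNorm (H₂.mulVec y) = ∑ k, hammingNorm (H₂.mulVec (mask (cluster G S k) y)) := by
  classical
  have e : ∀ v : Fin m₂ → ZMod 2, hammingNorm v = ∑ c, if v c ≠ 0 then 1 else 0 := by
    intro v; rw [hammingNorm, Finset.card_filter]
  simp only [e]
  rw [Finset.sum_comm]
  refine Finset.sum_congr rfl fun c _ => ?_
  by_cases hc : ∃ i ∈ S, H₂ c i ≠ 0
  · obtain ⟨i, hi, hci⟩ := hc
    rw [Finset.sum_eq_single ((within G S).connectedComponentMk i)]
    · rw [h.mulVec_mask (saturated_cluster S _) hy hi hci]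
      simp [mem_cluster, hi]
    · intro k _ hk
      rw [h.mulVec_mask (saturated_cluster S _) hy hi hci]
      simp [mem_cluster, hk.symm]
    · simp
  · push Not at hc
    have hy0 : ∀ j, H₂ c j ≠ 0 → y j = 0 := by
      intro j hj
      by_contra hyj
      exact hj (hc j (hy (mem_supp.2 hyj)))
    rw [mulVec_apply_eq_zero hy0, eq_comm]
    simp only [ne_eq, not_true_eq_false, if_false]
    refine Finset.sum_eq_zero fun k _ => ?_
    rw [mulVec_apply_eq_zero]
    · simp
    · intro j hj; simp [mask, hy0 j hj]

/-- Confinement extends from small vectors to arbitrarily large vectors with small clusters. -/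
theorem IsSector.confined_of_smallClusters (h : IsSector H₁ H₂ G) {d γ : ℝ}
    (hc : Confined H₁ H₂ d γ) (hd : 0 ≤ d) (hγ : 0 < γ) {S : Finset (Fin n)}
    (hS : SmallClusters G d S) {y : Fin n → ZMod 2} (hy : supp y ⊆ S) :
    γ * reducedWeight H₁ y ≤ hammingNorm (H₂.mulVec y) := by
  classical
  have : Fintype (within G S).ConnectedComponent := Fintype.ofFinite _
  have h1 : (reducedWeight H₁ y : ℝ) ≤ ∑ k, (reducedWeight H₁ (mask (cluster G S k) y) : ℝ) := by
    have := reducedWeight_sum_le H₁ Finset.univ fun k => mask (cluster G S k) y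
    rw [sum_mask_cluster S hy] at this
    exact_mod_cast this
  rw [h.hammingNorm_mulVec_eq_sum S hy]
  push_cast
  refine (mul_le_mul_of_nonneg_left h1 hγ.le).trans ?_
  rw [Finset.mul_sum]
  refine Finset.sum_le_sum fun k _ => hc _ ?_
  have h2 : (reducedWeight H₁ (mask (cluster G S k) y) : ℝ) ≤ (cluster G S k).card := by
    rw [Nat.cast_le]
    refine (reducedWeight_le_hammingNorm _ _).trans ?_
    rw [hammingNorm_eq_card_supp, supp_mask]
    exact Finset.card_le_card Finset.inter_subset_right
  refine h2.trans ?_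
  rcases (cluster G S k).eq_empty_or_nonempty with h0 | ⟨i, hi⟩
  · simp [h0, hd]
  · rw [mem_cluster] at hi
    rw [← hi.2]
    exact hS _ (fun j hj => (mem_cluster.1 hj).1) (connected_cluster hi.1)

/-- Undetected errors with small clusters are stabilizers. -/
theorem IsSector.mem_stab_of_smallClusters (h : IsSector H₁ H₂ G) {d γ : ℝ}
    (hc : Confined H₁ H₂ d γ) (hd : 0 ≤ d) (hγ : 0 < γ) {S : Finset (Fin n)}
    (hS : SmallClusters G d S) {y : Fin n → ZMod 2} (hy : supp y ⊆ S) (h0 : H₂.mulVec y = 0) :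
    y ∈ stab H₁ := by
  have h1 := h.confined_of_smallClusters hc hd hγ hS hy
  rw [h0, hammingNorm_zero, Nat.cast_zero] at h1
  exact mem_stab_of_mul_reducedWeight_nonpos hγ h1

theorem mulVec_eq_of_add_mem (h : IsSector H₁ H₂ G) {x y : Fin n → ZMod 2}
    (hxy : x + y ∈ stab H₁) : H₂.mulVec x = H₂.mulVec y := by
  have := h.mulVec_stab _ hxy
  rw [Matrix.mulVec_add] at this
  have h2 := congrArg (fun z => z + H₂.mulVec y) this
  simp only [add_assoc, add_self_vec, add_zero, zero_add] at h2
  exact h2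

theorem hammingNorm_mulVec_le {H : Matrix (Fin m) (Fin n) (ZMod 2)} {w : ℕ}
    (hw : ∀ j, hammingNorm (fun i => H i j) ≤ w) (a : Fin n → ZMod 2) :
    hammingNorm (H.mulVec a) ≤ w * hammingNorm a := by
  have : supp (H.mulVec a) ⊆ (supp a).biUnion fun j => supp fun i => H i j := by
    intro c hc
    rw [mem_supp] at hc
    by_contra h
    refine hc (mulVec_apply_eq_zero fun i hi => ?_)
    by_contra hai
    exact h (Finset.mem_biUnion.2 ⟨i, mem_supp.2 hai, mem_supp.2 hi⟩)
  rw [hammingNorm_eq_card_supp, hammingNorm_eq_card_supp, mul_comm]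
  exact (Finset.card_le_card this).trans (Finset.card_biUnion_le_card_mul _ _ _ fun j _ => hw j)

/-- Two errors with small half-filled clusters differ, up to a stabilizer, by an error with small
clusters, on which confinement holds. If a light error `a` cancels its syndrome, then that syndrome
is light, so the combination has small reduced weight, and being undetected it is a stabilizer. -/
theorem IsSector.mem_stab_of_local (h : IsSector H₁ H₂ G) {d γ : ℝ}
    (hc : Confined H₁ H₂ d γ) (hd : 0 ≤ d) (hγ : 0 < γ) {w : ℕ}
    (hw : ∀ j, hammingNorm (fun i => H₂ i j) ≤ w) {x x' a : Fin n → ZMod 2}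
    (hx : SmallHalfClusters G d (supp (reduced H₁ x)))
    (hx' : SmallHalfClusters G d (supp (reduced H₁ x')))
    (ha : (w / γ + 1) * (hammingNorm a : ℝ) ≤ d) (h0 : H₂.mulVec (x + x' + a) = 0) :
    x + x' + a ∈ stab H₁ := by
  set y := reduced H₁ x + reduced H₁ x' with hy
  have hyx : (x + x' + a) + (y + a) ∈ stab H₁ := by
    have : (x + x' + a) + (y + a) = (x + reduced H₁ x) + (x' + reduced H₁ x') := by
      rw [hy]
      calc _ = (x + reduced H₁ x) + (x' + reduced H₁ x') + (a + a) := by abel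
        _ = _ := by rw [add_self_vec, add_zero]
    rw [this]
    exact (stab H₁).add_mem (add_reduced_mem _ _) (add_reduced_mem _ _)
  have h1 : H₂.mulVec (y + a) = 0 := by rw [← mulVec_eq_of_add_mem h hyx, h0]
  have h2 : H₂.mulVec y = H₂.mulVec a := by
    rw [Matrix.mulVec_add] at h1
    have h2 := congrArg (fun z => z + H₂.mulVec a) h1
    simpa only [add_assoc, add_self_vec, add_zero, zero_add] using h2
  have h3 := h.confined_of_smallClusters hc hd hγ (hx.union hx') (supp_add_subset _ _)
  rw [← hy, h2] at h3
  have h4 : (hammingNorm (H₂.mulVec a) : ℝ) ≤ w * hammingNorm a := by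
    exact_mod_cast hammingNorm_mulVec_le hw a
  have h5 : (reducedWeight H₁ y : ℝ) ≤ w / γ * hammingNorm a := by
    rw [div_mul_eq_mul_div, le_div_iff₀ hγ]; linarith
  have h6 : (reducedWeight H₁ (y + a) : ℝ) ≤ d := by
    have h7 : (reducedWeight H₁ (y + a) : ℝ) ≤ reducedWeight H₁ y + hammingNorm a := by
      exact_mod_cast (reducedWeight_add_le H₁ y a).trans
        (Nat.add_le_add_left (reducedWeight_le_hammingNorm _ _) _)
    linarith
  have h8 := hc _ h6
  rw [h1, hammingNorm_zero, Nat.cast_zero] at h8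
  have := (stab H₁).add_mem hyx (mem_stab_of_mul_reducedWeight_nonpos hγ h8)
  rwa [add_assoc, add_self_vec, add_zero] at this

end Clusters

/-! ### Counting large clusters -/

section Counting

variable {n : ℕ} {G : SimpleGraph (Fin n)}

/-- Every vertex of `Λ` can be reached inside `Λ` from the set `R` of roots: a subset of `Λ` that
contains the roots and is closed under adjacency within `Λ` is all of `Λ`. -/
def Spans (G : SimpleGraph (Fin n)) (R Λ : Finset (Fin n)) : Prop :=
  R ⊆ Λ ∧ ∀ U ⊆ Λ, R ⊆ U → (∀ i ∈ U, ∀ j ∈ Λ, G.Adj i j → j ∈ U) → U = Λ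

/-- A union of connected sets whose sizes are at least `D` on average. -/
def Rooted (G : SimpleGraph (Fin n)) (D : ℕ) (Λ : Finset (Fin n)) : Prop :=
  ∃ R, Spans G R Λ ∧ D * R.card ≤ Λ.card

open Classical in
/-- The vertices outside `Λ` with a neighbour in `Λ`. -/
def outer (G : SimpleGraph (Fin n)) (Λ : Finset (Fin n)) : Finset (Fin n) :=
  Finset.univ.filter fun j => j ∉ Λ ∧ ∃ i ∈ Λ, G.Adj i j

/-- Every vertex has at most `Δ` neighbours. -/
def DegreeLE (G : SimpleGraph (Fin n)) (Δ : ℕ) : Prop :=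
  ∀ i, ∃ N : Finset (Fin n), N.card ≤ Δ ∧ ∀ j, G.Adj i j → j ∈ N

theorem card_outer_le {Δ : ℕ} (hG : DegreeLE G Δ) (Λ : Finset (Fin n)) :
    (outer G Λ).card ≤ Δ * Λ.card := by
  choose N hN hN' using hG
  have : outer G Λ ⊆ Λ.biUnion N := by
    intro j hj
    simp only [outer, Finset.mem_filter, Finset.mem_univ, true_and] at hj
    obtain ⟨-, i, hi, hij⟩ := hj
    exact Finset.mem_biUnion.2 ⟨i, hi, hN' i j hij⟩
  rw [mul_comm]
  exact (Finset.card_le_card this).trans (Finset.card_biUnion_le_card_mul _ _ _ fun j _ => hN j)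

/-- If the open sites `ω` contain `Λ` and avoid its outer boundary, then `Λ` is the cluster of its
roots in `ω`, so it is determined by the roots and `ω`. -/
theorem Spans.subset_of_mem_Icc {R Λ Λ' ω : Finset (Fin n)} (h : Spans G R Λ) (h' : Spans G R Λ')
    (hω : ω ∈ Finset.Icc Λ (outer G Λ)ᶜ) (hω' : ω ∈ Finset.Icc Λ' (outer G Λ')ᶜ) : Λ ⊆ Λ' := by
  rw [Finset.mem_Icc] at hω hω'
  have := h.2 (Λ ∩ Λ') Finset.inter_subset_left (Finset.subset_inter h.1 h'.1) ?_
  · rw [← this]; exact Finset.inter_subset_right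
  · intro i hi j hj hij
    rw [Finset.mem_inter] at hi ⊢
    refine ⟨hj, ?_⟩
    by_contra hj'
    have h1 : j ∈ (outer G Λ')ᶜ := hω'.2 (hω.1 hj)
    rw [Finset.mem_compl] at h1
    exact h1 (by simp only [outer, Finset.mem_filter, Finset.mem_univ, true_and]; exact ⟨hj', i, hi.2, hij⟩)

open Classical in
/-- The sets spanned by given roots are the possible clusters of the roots in site percolation of
density `1/2`; each has probability at least `(1/2) ^ ((Δ + 1) * |Λ|)`, and the probabilities of
these disjoint events add up to at most one. -/
theorem sum_spans_le {Δ : ℕ} (hG : DegreeLE G Δ) (R : Finset (Fin n)) :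
    ∑ Λ ∈ Finset.univ.filter (Spans G R), (((1 : ℝ) / 2) ^ (Δ + 1)) ^ Λ.card ≤ 1 := by
  have hdisj : ((Finset.univ.filter (Spans G R) : Finset (Finset (Fin n))) :
      Set (Finset (Fin n))).PairwiseDisjoint fun Λ => Finset.Icc Λ (outer G Λ)ᶜ := by
    intro Λ hΛ Λ' hΛ' hne
    simp only [Finset.coe_filter, Finset.mem_univ, true_and, Set.mem_ofPred_eq] at hΛ hΛ'
    refine Finset.disjoint_left.2 fun ω hω hω' => hne ?_
    exact Finset.Subset.antisymm (hΛ.subset_of_mem_Icc hΛ' hω hω') (hΛ'.subset_of_mem_Icc hΛ hω' hω)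
  have h1 := Finset.card_biUnion hdisj
  have h2 : ∑ Λ ∈ Finset.univ.filter (Spans G R), (Finset.Icc Λ (outer G Λ)ᶜ).card ≤ 2 ^ n := by
    rw [← h1]
    refine (Finset.card_le_univ _).trans ?_
    simp
  have h3 : ∀ Λ : Finset (Fin n),
      (2 : ℝ) ^ n * (((1 : ℝ) / 2) ^ (Δ + 1)) ^ Λ.card ≤ (Finset.Icc Λ (outer G Λ)ᶜ).card := by
    intro Λ
    have hsub : Λ ⊆ (outer G Λ)ᶜ := by
      intro i hi
      simp only [outer, Finset.mem_compl, Finset.mem_filter, Finset.mem_univ, true_and]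
      exact fun h => h.1 hi
    rw [Finset.card_Icc_finset hsub, Finset.card_compl, Fintype.card_fin]
    have hle : Λ.card ≤ n - (outer G Λ).card := by
      have := Finset.card_le_card hsub
      rwa [Finset.card_compl, Fintype.card_fin] at this
    have hle2 : (outer G Λ).card ≤ n := by simpa using Finset.card_le_univ (outer G Λ)
    have hle3 := card_outer_le hG Λ
    push_cast
    rw [← pow_mul, one_div, inv_pow, mul_inv_le_iff₀ (by positivity), ← pow_add]
    refine pow_le_pow_right₀ (by norm_num) ?_
    have : (Δ + 1) * Λ.card = Δ * Λ.card + Λ.card := by ring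
    lia
  have h4 : (2 : ℝ) ^ n * ∑ Λ ∈ Finset.univ.filter (Spans G R), (((1 : ℝ) / 2) ^ (Δ + 1)) ^ Λ.card
      ≤ 2 ^ n * 1 := by
    rw [Finset.mul_sum, mul_one]
    refine (Finset.sum_le_sum fun Λ _ => h3 Λ).trans ?_
    exact_mod_cast h2
  exact le_of_mul_le_mul_left h4 (by positivity)

open Classical in
/-- The nonempty rooted sets. -/
def rootedSets (G : SimpleGraph (Fin n)) (D : ℕ) : Finset (Finset (Fin n)) :=
  Finset.univ.filter fun Λ => Λ.Nonempty ∧ Rooted G D Λ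

theorem mem_rootedSets {D : ℕ} {Λ : Finset (Fin n)} :
    Λ ∈ rootedSets G D ↔ Λ.Nonempty ∧ Rooted G D Λ := by
  simp [rootedSets]

/-- The sum over rooted sets is controlled by the sum over their sets of roots: since `Λ` has at most
`|Λ| / D` roots, the factor `θ ^ |Λ|` is at most `(θ ^ D) ^ |R|`. -/
theorem sum_rootedSets_le {Δ D : ℕ} (hG : DegreeLE G Δ) {θ l : ℝ} (h0 : 0 ≤ θ) (h1 : θ ≤ 1)
    (hl : 0 ≤ l) (hlθ : l ≤ θ * (1 / 2) ^ (Δ + 1)) :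
    ∑ Λ ∈ rootedSets G D, l ^ Λ.card ≤ (1 + θ ^ D) ^ n - 1 := by
  classical
  set κ : ℝ := (1 / 2) ^ (Δ + 1) with hκ
  have hκ0 : 0 ≤ κ := by positivity
  have step : ∀ Λ ∈ rootedSets G D, l ^ Λ.card ≤
      ∑ R ∈ Finset.univ.erase ∅, if Spans G R Λ then (θ ^ D) ^ R.card * κ ^ Λ.card else 0 := by
    intro Λ hΛ
    obtain ⟨hne, R, hR, hRD⟩ := mem_rootedSets.1 hΛ
    have hRne : R ≠ ∅ := by
      rintro rfl
      have := hR.2 ∅ (Finset.empty_subset _) (Finset.empty_subset _) (by simp)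
      exact hne.ne_empty this.symm
    have h2 : l ^ Λ.card ≤ (θ ^ D) ^ R.card * κ ^ Λ.card := by
      calc l ^ Λ.card ≤ (θ * κ) ^ Λ.card := pow_le_pow_left₀ hl hlθ _
        _ = θ ^ Λ.card * κ ^ Λ.card := mul_pow _ _ _
        _ ≤ _ := by
          rw [← pow_mul θ]
          exact mul_le_mul_of_nonneg_right (pow_le_pow_of_le_one h0 h1 hRD) (by positivity)
    refine h2.trans ?_
    have h3 := Finset.single_le_sum (s := Finset.univ.erase ∅)
      (f := fun R => if Spans G R Λ then (θ ^ D) ^ R.card * κ ^ Λ.card else 0) (fun R _ => by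
        split_ifs <;> positivity)
      (Finset.mem_erase.2 ⟨hRne, Finset.mem_univ _⟩)
    simpa only [hR, if_true] using h3
  refine (Finset.sum_le_sum step).trans ?_
  rw [Finset.sum_comm]
  have h4 : ∀ R ∈ Finset.univ.erase (∅ : Finset (Fin n)),
      ∑ Λ ∈ rootedSets G D, (if Spans G R Λ then (θ ^ D) ^ R.card * κ ^ Λ.card else 0)
        ≤ (θ ^ D) ^ R.card := by
    intro R _
    calc _ ≤ ∑ Λ, (if Spans G R Λ then (θ ^ D) ^ R.card * κ ^ Λ.card else 0) := by
          refine Finset.sum_le_sum_of_subset_of_nonneg (Finset.subset_univ _) fun Λ _ _ => ?_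
          split_ifs <;> positivity
      _ = (θ ^ D) ^ R.card * ∑ Λ ∈ Finset.univ.filter (Spans G R), κ ^ Λ.card := by
          rw [← Finset.sum_filter, Finset.mul_sum]
      _ ≤ (θ ^ D) ^ R.card * 1 :=
          mul_le_mul_of_nonneg_left (sum_spans_le hG R) (by positivity)
      _ = _ := mul_one _
  refine (Finset.sum_le_sum h4).trans ?_
  have h5 := Fintype.sum_pow_mul_eq_add_pow (Fin n) (θ ^ D) (1 : ℝ)
  simp only [one_pow, mul_one, Fintype.card_fin] at h5
  rw [add_comm 1, ← h5, ← Finset.add_sum_erase _ _ (Finset.mem_univ ∅)]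
  simp

open Classical in
/-- The union of the clusters of `S` with at least `D` elements. -/
def largePart (G : SimpleGraph (Fin n)) (D : ℕ) (S : Finset (Fin n)) : Finset (Fin n) :=
  S.filter fun i => D ≤ (cluster G S ((within G S).connectedComponentMk i)).card

theorem mem_largePart {D : ℕ} {S : Finset (Fin n)} {i : Fin n} :
    i ∈ largePart G D S ↔
      i ∈ S ∧ D ≤ (cluster G S ((within G S).connectedComponentMk i)).card := by
  simp [largePart]

theorem largePart_subset (D : ℕ) (S : Finset (Fin n)) : largePart G D S ⊆ S :=
  fun _ hi => (mem_largePart.1 hi).1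

theorem saturated_largePart (D : ℕ) (S : Finset (Fin n)) : Saturated G S (largePart G D S) := by
  intro i hi j hj hij hA
  rw [mem_largePart] at hA ⊢
  refine ⟨hj, ?_⟩
  have : (within G S).connectedComponentMk j = (within G S).connectedComponentMk i :=
    (SimpleGraph.ConnectedComponent.sound
      (SimpleGraph.Adj.reachable (G := within G S) ⟨hij, hi, hj⟩)).symm
  rw [this]; exact hA.2

theorem subset_cluster {S B : Finset (Fin n)} (hB : B ⊆ S)
    (hc : (G.induce (B : Set (Fin n))).Connected) {i : Fin n} (hi : i ∈ B) :
    B ⊆ cluster G S ((within G S).connectedComponentMk i) := by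
  intro j hj
  rw [mem_cluster]
  refine ⟨hB hj, ?_⟩
  rw [SimpleGraph.ConnectedComponent.eq]
  have h1 : (G.induce (B : Set (Fin n))).Reachable ⟨j, hj⟩ ⟨i, hi⟩ := hc.preconnected _ _
  let f : G.induce (B : Set (Fin n)) →g within G S :=
    { toFun := fun x => x.1
      map_rel' := fun {a b} h => ⟨h, hB a.2, hB b.2⟩ }
  exact h1.map f

theorem subset_largePart {D : ℕ} {S B : Finset (Fin n)} (hB : B ⊆ S)
    (hc : (G.induce (B : Set (Fin n))).Connected) (hD : D ≤ B.card) : B ⊆ largePart G D S := by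
  intro i hi
  rw [mem_largePart]
  exact ⟨hB hi, hD.trans (Finset.card_le_card (subset_cluster hB hc hi))⟩

theorem smallClusters_sdiff_largePart {D : ℕ} {e : ℝ} (hD : ∀ k : ℕ, k < D → (k : ℝ) ≤ e)
    (S : Finset (Fin n)) : SmallClusters G e (S \ largePart G D S) := by
  intro B hB hc
  refine hD _ ?_
  by_contra! h
  have h1 := subset_largePart (hB.trans Finset.sdiff_subset) hc h
  obtain ⟨⟨i, hi⟩⟩ := hc.nonempty
  exact (Finset.mem_sdiff.1 (hB hi)).2 (h1 hi)

/-- One vertex from each large cluster serves as its root. -/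
theorem rooted_largePart (D : ℕ) (S : Finset (Fin n)) : Rooted G D (largePart G D S) := by
  classical
  set Λ := largePart G D S with hΛ
  set f : Fin n → (within G S).ConnectedComponent := (within G S).connectedComponentMk with hf
  have hrep : ∀ k ∈ Λ.image f, ∃ i ∈ Λ, f i = k := fun k hk => by simpa using hk
  choose rep hrepΛ hrepf using hrep
  refine ⟨(Λ.image f).attach.image fun k => rep k.1 k.2, ⟨?_, ?_⟩, ?_⟩
  · intro i hi
    obtain ⟨k, -, rfl⟩ := Finset.mem_image.1 hi
    exact hrepΛ k.1 k.2
  · intro U hU hRU hcl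
    refine Finset.Subset.antisymm hU fun i hi => ?_
    have hk : f i ∈ Λ.image f := Finset.mem_image_of_mem f hi
    have h1 : (within G S).Reachable (rep (f i) hk) i :=
      SimpleGraph.ConnectedComponent.exact (hrepf _ hk)
    rw [SimpleGraph.reachable_iff_reflTransGen] at h1
    have h2 : rep (f i) hk ∈ U :=
      hRU (Finset.mem_image.2 ⟨⟨f i, hk⟩, Finset.mem_attach _ _, rfl⟩)
    -- every step from the root stays in the large part, hence in `U`
    have h3 : ∀ j, Relation.ReflTransGen (within G S).Adj (rep (f i) hk) j → j ∈ U := by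
      intro j hj
      induction hj with
      | refl => exact h2
      | tail _ hab ih =>
        exact hcl _ ih _ (saturated_largePart D S _ hab.2.1 _ hab.2.2 hab.1 (hU ih)) hab.1
    exact h3 i h1
  · have h1 : ((Λ.image f).attach.image fun k => rep k.1 k.2).card ≤ (Λ.image f).card :=
      Finset.card_image_le.trans Finset.card_attach.le
    have h2 : D * (Λ.image f).card ≤ Λ.card := by
      rw [Finset.card_eq_sum_card_image f Λ, mul_comm, ← smul_eq_mul]
      refine Finset.card_nsmul_le_sum _ _ _ fun k hk => ?_
      obtain ⟨i, hi, rfl⟩ := Finset.mem_image.1 hk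
      refine (mem_largePart.1 hi).2.trans (Finset.card_le_card fun j hj => ?_)
      rw [mem_cluster] at hj
      rw [Finset.mem_filter]
      refine ⟨?_, hj.2⟩
      rw [hΛ, mem_largePart, hj.2]
      exact ⟨hj.1, (mem_largePart.1 hi).2⟩
    exact (Nat.mul_le_mul_left D h1).trans h2

end Counting

/-! ### The Peierls argument around a typical configuration -/

section Peierls

variable {n m₁ m₂ : ℕ} {H₁ : Matrix (Fin m₁) (Fin n) (ZMod 2)}
  {H₂ : Matrix (Fin m₂) (Fin n) (ZMod 2)} {G : SimpleGraph (Fin n)}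

open Classical in
/-- The rows of `H` that meet `Λ`. -/
def touching {m : ℕ} (H : Matrix (Fin m) (Fin n) (ZMod 2)) (Λ : Finset (Fin n)) : Finset (Fin m) :=
  Finset.univ.filter fun c => ∃ i ∈ Λ, H c i ≠ 0

/-- The violated checks of the configuration `x₀` have density at most `ε` around every union of large
connected sets. -/
def Typical (H₂ : Matrix (Fin m₂) (Fin n) (ZMod 2)) (G : SimpleGraph (Fin n)) (D : ℕ) (ε : ℝ)
    (x₀ : Fin n → ZMod 2) : Prop :=
  ∀ Λ ∈ rootedSets G D,
    ((supp (H₂.mulVec x₀) ∩ touching H₂ Λ).card : ℝ) ≤ ε * Λ.card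

/-- The class of `y` is that of `x + a` with `x` of least weight, `a` of weight at most `e / 2` and
all clusters of their union small. These include the classes reached from good ones by an operator
on at most `e / 2` qubits, and, unlike those, they are stable under removing large clusters. -/
def Admissible (H₁ : Matrix (Fin m₁) (Fin n) (ZMod 2)) (G : SimpleGraph (Fin n)) (e : ℝ)
    (y : Fin n → ZMod 2) : Prop :=
  ∃ x a, y + (x + a) ∈ stab H₁ ∧ IsLeast H₁ x ∧ 2 * (hammingNorm a : ℝ) ≤ e ∧
    SmallClusters G e (supp x ∪ supp a)

/-- The classes whose reduced representative has only small half-filled clusters. They label the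
eigenstates that span a component. -/
def Good (H₁ : Matrix (Fin m₁) (Fin n) (ZMod 2)) (G : SimpleGraph (Fin n)) (e : ℝ)
    (y : Fin n → ZMod 2) : Prop :=
  SmallHalfClusters G e (supp (reduced H₁ y))

theorem Good.admissible_add {e : ℝ} {y a : Fin n → ZMod 2} (hy : Good H₁ G e y)
    (ha : 2 * (hammingNorm a : ℝ) ≤ e) : Admissible H₁ G e (y + a) := by
  refine ⟨reduced H₁ y, a, ?_, isLeast_reduced H₁ y, ha,
    hy.union (smallHalfClusters_of_card_le ha)⟩
  rw [add_add_add_comm, add_self_vec, add_zero]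
  exact add_reduced_mem H₁ y

theorem Admissible.congr {e : ℝ} {y y' : Fin n → ZMod 2} (hy : Admissible H₁ G e y)
    (h : y + y' ∈ stab H₁) : Admissible H₁ G e y' := by
  obtain ⟨x, a, h1, h2⟩ := hy
  exact ⟨x, a, mem_stab_trans (mem_stab_symm h) h1, h2⟩

theorem Good.congr {e : ℝ} {y y' : Fin n → ZMod 2} (hy : Good H₁ G e y)
    (h : y + y' ∈ stab H₁) : Good H₁ G e y' := by
  unfold Good at *; rwa [← reduced_congr h]

/-- If `t` and `u` have disjoint supports, then adding `t` to `s + u` raises the weight by `|t|`, less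
two for every entry of `s` that `t` cancels. -/
theorem energy_flip {m : ℕ} {s t u : Fin m → ZMod 2} (h : ∀ c, t c = 0 ∨ u c = 0) :
    hammingNorm (s + (t + u)) + 2 * (supp s ∩ supp t).card =
      hammingNorm (s + u) + hammingNorm t := by
  have e : ∀ v : Fin m → ZMod 2, hammingNorm v = ∑ c, if v c ≠ 0 then 1 else 0 := by
    intro v; rw [hammingNorm, Finset.card_filter]
  have e2 : (supp s ∩ supp t).card = ∑ c, if s c ≠ 0 ∧ t c ≠ 0 then 1 else 0 := by
    rw [← Finset.card_filter]; congr 1; ext c; simp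
  rw [e, e, e, e2, Finset.mul_sum, ← Finset.sum_add_distrib, ← Finset.sum_add_distrib]
  refine Finset.sum_congr rfl fun c _ => ?_
  simp only [Pi.add_apply]
  have key : ∀ a b c : ZMod 2, b = 0 ∨ c = 0 →
      ((if a + (b + c) ≠ 0 then 1 else 0) + 2 * (if a ≠ 0 ∧ b ≠ 0 then 1 else 0) : ℕ) =
      (if a + c ≠ 0 then 1 else 0) + if b ≠ 0 then 1 else 0 := by decide
  exact key _ _ _ (h c)

/-- Around a typical configuration, an admissible class that is not good contains a union `Λ` of
large clusters whose removal lowers the energy by an amount proportional to its size.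

The reduced representative `x` and the admissible one `v = x' + a` differ by a stabilizer `u`. Take
`Λ` to be the large clusters of the union of all supports with a half-filled set `B` that is too
large. The small clusters of `u` are undetected, hence stabilizers, so `x` and `v` agree on `Λ` up to
a stabilizer. As `x` has least weight and confinement applies to `v`, the syndrome of `v` on `Λ` has
weight proportional to that of `x` on `Λ`, which is at least `|Λ| / 6`. -/
theorem IsSector.exists_removal (h : IsSector H₁ H₂ G) {e γ : ℝ} {D : ℕ}
    (hc : Confined H₁ H₂ e γ) (he : 0 ≤ e) (hγ : 0 < γ) (hD : ∀ k : ℕ, k < D ↔ (k : ℝ) ≤ e)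
    {x₀ y : Fin n → ZMod 2} (hx₀ : Typical H₂ G D (γ / 24) x₀) (hy : Admissible H₁ G e y)
    (hng : ¬ Good H₁ G e y) :
    ∃ Λ ∈ rootedSets G D, ∃ b y₁, supp b ⊆ Λ ∧ y + (y₁ + b) ∈ stab H₁ ∧ Admissible H₁ G e y₁ ∧
      (hammingNorm (H₂.mulVec (x₀ + y₁)) : ℝ) + γ / 12 * Λ.card ≤
        hammingNorm (H₂.mulVec (x₀ + y)) := by
  obtain ⟨x', a, hyx, hx', ha, hS'⟩ := hy
  set x := reduced H₁ y with hx
  unfold Good SmallHalfClusters at hng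
  push Not at hng
  obtain ⟨B, hB, hBx, hBe⟩ := hng
  rw [← hx] at hBx
  have hDB : D ≤ B.card := by
    by_contra! hlt
    exact absurd ((hD _).1 hlt) (not_le.2 hBe)
  set S := supp x ∪ supp x' ∪ supp a ∪ B with hS
  set Λ := largePart G D S with hΛ
  have hBΛ : B ⊆ Λ := subset_largePart Finset.subset_union_right hB hDB
  have hsat : Saturated G S Λ := saturated_largePart D S
  have hxS : supp x ⊆ S := fun i hi => by simp only [hS, Finset.mem_union]; tauto
  have hx'S : supp x' ⊆ S := fun i hi => by simp only [hS, Finset.mem_union]; tauto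
  have haS : supp a ⊆ S := fun i hi => by simp only [hS, Finset.mem_union]; tauto
  set v := x' + a with hv
  have hvS : supp v ⊆ S := (supp_add_subset _ _).trans (Finset.union_subset hx'S haS)
  -- the restriction of the stabilizer `u` to the small clusters is a stabilizer
  set u := x + v with hu
  have hust : u ∈ stab H₁ := mem_stab_trans (mem_stab_symm (add_reduced_mem H₁ y)) hyx
  have huS : supp u ⊆ S := (supp_add_subset _ _).trans (Finset.union_subset hxS hvS)
  have hsmall : mask Λᶜ u ∈ stab H₁ := by
    refine h.mem_stab_of_smallClusters hc he hγ
      (smallClusters_sdiff_largePart (fun k hk => (hD k).1 hk) S) (S := S \ Λ) ?_ ?_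
    · rw [supp_mask, Finset.sdiff_eq_inter_compl]
      exact Finset.inter_subset_inter_right huS
    · funext c
      have h0 : H₂.mulVec u c = 0 := by rw [h.mulVec_stab u hust]; rfl
      rcases h.mulVec_mask_eq hsat huS c with h1 | h1
      · rw [← mask_add_mask_compl Λ u, Matrix.mulVec_add, Pi.add_apply, h1, zero_add] at h0
        exact h0
      · exact h1
  have hlarge : mask Λ x + mask Λ v ∈ stab H₁ := by
    rw [← mask_add, ← hu]
    have := (stab H₁).add_mem hust hsmall
    nth_rewrite 1 [← mask_add_mask_compl Λ u] at this
    rwa [add_assoc, add_self_vec, add_zero] at this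
  -- energy of the large part
  have hconf : γ * reducedWeight H₁ (mask Λ v) ≤ hammingNorm (H₂.mulVec (mask Λ v)) := by
    refine h.confined_of_smallClusters hc he hγ hS' ?_
    rw [supp_mask]
    exact Finset.inter_subset_left.trans (supp_add_subset _ _)
  have hrwx : reducedWeight H₁ (mask Λ v) = hammingNorm (mask Λ x) := by
    rw [← reducedWeight_congr hlarge]; exact (isLeast_reduced H₁ y).mask Λ
  have hrwx' : hammingNorm (mask Λ x') ≤ reducedWeight H₁ (mask Λ v) + hammingNorm (mask Λ a) := by
    have h1 : mask Λ x' = mask Λ v + mask Λ a := by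
      rw [hv, mask_add, add_assoc, add_self_vec, add_zero]
    have h2 := reducedWeight_add_le H₁ (mask Λ v) (mask Λ a)
    rw [← h1, hx'.mask Λ] at h2
    exact h2.trans (Nat.add_le_add_left (reducedWeight_le_hammingNorm _ _) _)
  have haΛ : hammingNorm (mask Λ a) ≤ hammingNorm a := by
    rw [← hammingNorm_mask_add_mask_compl Λ a]; lia
  have hBx' : (supp x ∩ B).card ≤ hammingNorm (mask Λ x) := by
    rw [hammingNorm_eq_card_supp, supp_mask]
    exact Finset.card_le_card (Finset.inter_subset_inter_left hBΛ)
  have hcard : Λ.card ≤ hammingNorm (mask Λ x) + hammingNorm (mask Λ x') + hammingNorm (mask Λ a)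
      + B.card := by
    have h1 : Λ ⊆ supp (mask Λ x) ∪ supp (mask Λ x') ∪ supp (mask Λ a) ∪ B := by
      intro i hi
      have := largePart_subset D S hi
      simp only [hS, Finset.mem_union] at this
      simp only [supp_mask, Finset.mem_union, Finset.mem_inter]
      tauto
    refine (Finset.card_le_card h1).trans ((Finset.card_union_le _ _).trans ?_)
    refine Nat.add_le_add_right ((Finset.card_union_le _ _).trans ?_) _
    exact Nat.add_le_add_right (Finset.card_union_le _ _) _
  have hΛmem : Λ ∈ rootedSets G D := by
    refine mem_rootedSets.2 ⟨?_, rooted_largePart D S⟩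
    obtain ⟨⟨i, hi⟩⟩ := hB.nonempty
    exact ⟨i, hBΛ hi⟩
  refine ⟨Λ, hΛmem, mask Λ v, mask Λᶜ v, ?_, ?_, ?_, ?_⟩
  · rw [supp_mask]; exact Finset.inter_subset_right
  · rw [add_comm (mask Λᶜ v), mask_add_mask_compl]; exact hyx
  · refine ⟨mask Λᶜ x', mask Λᶜ a, ?_, hx'.mask _, ?_, hS'.mono ?_⟩
    · rw [hv, mask_add, add_self_vec]; exact (stab H₁).zero_mem
    · have : (hammingNorm (mask Λᶜ a) : ℝ) ≤ hammingNorm a := by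
        rw [Nat.cast_le, ← hammingNorm_mask_add_mask_compl Λ a]; lia
      linarith
    · rw [supp_mask, supp_mask]
      exact Finset.union_subset_union Finset.inter_subset_left Finset.inter_subset_left
  · have hE : H₂.mulVec (x₀ + y) = H₂.mulVec x₀ + (H₂.mulVec (mask Λ v) + H₂.mulVec (mask Λᶜ v)) := by
      rw [← Matrix.mulVec_add, mask_add_mask_compl, ← Matrix.mulVec_add]
      refine mulVec_eq_of_add_mem h ?_
      rw [add_add_add_comm, add_self_vec, zero_add]; exact hyx
    have hflip := energy_flip (s := H₂.mulVec x₀) (h.mulVec_mask_eq hsat hvS)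
    rw [← hE, ← Matrix.mulVec_add] at hflip
    have htyp := hx₀ Λ hΛmem
    have hsub : (supp (H₂.mulVec x₀) ∩ supp (H₂.mulVec (mask Λ v))).card ≤
        (supp (H₂.mulVec x₀) ∩ touching H₂ Λ).card := by
      refine Finset.card_le_card (Finset.inter_subset_inter_left fun c hcv => ?_)
      rw [mem_supp] at hcv
      by_contra hct
      refine hcv (mulVec_apply_eq_zero fun i hi => ?_)
      have : i ∉ Λ := fun hiΛ => hct (by
        simp only [touching, Finset.mem_filter, Finset.mem_univ, true_and]; exact ⟨i, hiΛ, hi⟩)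
      simp [mask, this]
    rw [hrwx] at hconf hrwx'
    have hflip' : (hammingNorm (H₂.mulVec (x₀ + y)) : ℝ) +
        2 * ((supp (H₂.mulVec x₀) ∩ supp (H₂.mulVec (mask Λ v))).card : ℝ) =
        hammingNorm (H₂.mulVec (x₀ + mask Λᶜ v)) + hammingNorm (H₂.mulVec (mask Λ v)) := by
      exact_mod_cast hflip
    have hsub' : ((supp (H₂.mulVec x₀) ∩ supp (H₂.mulVec (mask Λ v))).card : ℝ) ≤
        (supp (H₂.mulVec x₀) ∩ touching H₂ Λ).card := by exact_mod_cast hsub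
    have hcard' : (Λ.card : ℝ) ≤ hammingNorm (mask Λ x) + hammingNorm (mask Λ x') +
        hammingNorm (mask Λ a) + B.card := by exact_mod_cast hcard
    have hrw2 : (hammingNorm (mask Λ x') : ℝ) ≤ hammingNorm (mask Λ x) + hammingNorm (mask Λ a) := by
      exact_mod_cast hrwx'
    have haΛ' : (hammingNorm (mask Λ a) : ℝ) ≤ hammingNorm a := by exact_mod_cast haΛ
    have hBx'' : ((supp x ∩ B).card : ℝ) ≤ hammingNorm (mask Λ x) := by exact_mod_cast hBx'
    -- with `X = |x|` on `Λ`: `|x'| ≤ X + |a|`, `|a| ≤ e / 2 < |B| / 2 ≤ X` and `|B| ≤ 2 X`, so the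
    -- four parts of `Λ` have at most `X`, `2 X`, `X` and `2 X` elements
    have hΛ6 : (Λ.card : ℝ) ≤ 6 * hammingNorm (mask Λ x) := by linarith
    -- the gain `γ / 6` per site exceeds twice the density `γ / 24` of cancellations by `γ / 12`
    have h6 : γ * (Λ.card : ℝ) ≤ 6 * hammingNorm (H₂.mulVec (mask Λ v)) := by
      have := mul_le_mul_of_nonneg_left hΛ6 hγ.le
      linarith
    linarith

end Peierls

/-! ### Boltzmann sums -/

section Boltzmann

variable {n m m₁ m₂ : ℕ} {H₁ : Matrix (Fin m₁) (Fin n) (ZMod 2)}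
  {H₂ : Matrix (Fin m₂) (Fin n) (ZMod 2)} {G : SimpleGraph (Fin n)}

/-- The Boltzmann weight of the error `x` in the sector whose syndromes are computed by `H`. -/
def boltz (H : Matrix (Fin m) (Fin n) (ZMod 2)) (β : ℝ) (x : Fin n → ZMod 2) : ℝ :=
  Real.exp (-β * hammingNorm (H.mulVec x))

theorem boltz_pos (H : Matrix (Fin m) (Fin n) (ZMod 2)) (β : ℝ) (x : Fin n → ZMod 2) :
    0 < boltz H β x := Real.exp_pos _

open Classical in
/-- The reduced representatives of the admissible classes. -/
def admissibleReps (H₁ : Matrix (Fin m₁) (Fin n) (ZMod 2)) (G : SimpleGraph (Fin n)) (e : ℝ) :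
    Finset (Fin n → ZMod 2) :=
  Finset.univ.filter fun x => reduced H₁ x = x ∧ Admissible H₁ G e x

open Classical in
/-- The reduced representatives of the good classes. -/
def goodReps (H₁ : Matrix (Fin m₁) (Fin n) (ZMod 2)) (G : SimpleGraph (Fin n)) (e : ℝ) :
    Finset (Fin n → ZMod 2) :=
  Finset.univ.filter fun x => reduced H₁ x = x ∧ Good H₁ G e x

theorem mem_admissibleReps {e : ℝ} {x : Fin n → ZMod 2} :
    x ∈ admissibleReps H₁ G e ↔ reduced H₁ x = x ∧ Admissible H₁ G e x := by
  simp [admissibleReps]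

theorem mem_goodReps {e : ℝ} {x : Fin n → ZMod 2} :
    x ∈ goodReps H₁ G e ↔ reduced H₁ x = x ∧ Good H₁ G e x := by
  simp [goodReps]

theorem Admissible.reduced_mem {e : ℝ} {y : Fin n → ZMod 2} (hy : Admissible H₁ G e y) :
    reduced H₁ y ∈ admissibleReps H₁ G e :=
  mem_admissibleReps.2 ⟨reduced_reduced _ _, hy.congr (add_reduced_mem H₁ y)⟩

theorem Good.reduced_mem {e : ℝ} {y : Fin n → ZMod 2} (hy : Good H₁ G e y) :
    reduced H₁ y ∈ goodReps H₁ G e :=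
  mem_goodReps.2 ⟨reduced_reduced _ _, hy.congr (add_reduced_mem H₁ y)⟩

theorem goodReps_subset {e : ℝ} (he : 0 ≤ e) : goodReps H₁ G e ⊆ admissibleReps H₁ G e := by
  intro x hx
  rw [mem_goodReps] at hx
  have := hx.2.admissible_add (a := 0) (by simpa using he)
  rw [add_zero] at this
  exact mem_admissibleReps.2 ⟨hx.1, this⟩

theorem eq_indicator_supp (b : Fin n → ZMod 2) : b = fun i => if i ∈ supp b then 1 else 0 := by
  funext i
  have key : ∀ c : ZMod 2, c = if c ≠ 0 then 1 else 0 := by decide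
  simpa using key (b i)

/-- The Peierls estimate: a class that is admissible but not good is determined by its union `Λ` of
large clusters, the error on `Λ`, and the admissible class left when that error is removed. Summing
over the `2 ^ |Λ|` errors on each `Λ` bounds the total weight of such classes. -/
theorem sum_admissible_sdiff_le (h : IsSector H₁ H₂ G) {e γ β : ℝ} {D : ℕ}
    (hc : Confined H₁ H₂ e γ) (he : 0 ≤ e) (hγ : 0 < γ) (hD : ∀ k : ℕ, k < D ↔ (k : ℝ) ≤ e)
    (hβ : 0 ≤ β) {x₀ : Fin n → ZMod 2} (hx₀ : Typical H₂ G D (γ / 24) x₀) :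
    ∑ x ∈ admissibleReps H₁ G e \ goodReps H₁ G e, boltz H₂ β (x₀ + x) ≤
      (∑ Λ ∈ rootedSets G D, (2 * Real.exp (-β * (γ / 12))) ^ Λ.card) *
        ∑ x ∈ admissibleReps H₁ G e, boltz H₂ β (x₀ + x) := by
  classical
  set A := admissibleReps H₁ G e with hA
  have key : ∀ x ∈ A \ goodReps H₁ G e, ∃ p : (_ : Finset (Fin n)) × (Finset (Fin n) × (Fin n → ZMod 2)),
      p ∈ (rootedSets G D).sigma (fun Λ => Λ.powerset ×ˢ A) ∧
      x = reduced H₁ (p.2.2 + fun i => if i ∈ p.2.1 then 1 else 0) ∧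
      boltz H₂ β (x₀ + x) ≤ Real.exp (-β * (γ / 12)) ^ p.1.card * boltz H₂ β (x₀ + p.2.2) := by
    intro x hx
    rw [Finset.mem_sdiff, hA, mem_admissibleReps, mem_goodReps] at hx
    obtain ⟨⟨hxr, hxa⟩, hxg⟩ := hx
    obtain ⟨Λ, hΛ, b, y, hb, hxy, hy, hE⟩ := h.exists_removal hc he hγ hD hx₀ hxa
      (fun hg => hxg ⟨hxr, hg⟩)
    refine ⟨⟨Λ, supp b, reduced H₁ y⟩, ?_, ?_, ?_⟩
    · simp only [Finset.mem_sigma, Finset.mem_product, Finset.mem_powerset]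
      exact ⟨hΛ, hb, hy.reduced_mem⟩
    · dsimp only
      rw [← eq_indicator_supp b]
      nth_rewrite 1 [← hxr]
      refine reduced_congr (mem_stab_trans hxy ?_)
      rw [add_add_add_comm, add_self_vec, add_zero]
      exact add_reduced_mem H₁ y
    · dsimp only
      have h1 : H₂.mulVec (x₀ + reduced H₁ y) = H₂.mulVec (x₀ + y) := by
        refine mulVec_eq_of_add_mem h ?_
        rw [add_add_add_comm, add_self_vec, zero_add]
        exact mem_stab_symm (add_reduced_mem H₁ y)
      unfold boltz
      rw [h1, ← Real.exp_nat_mul, ← Real.exp_add, Real.exp_le_exp]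
      have := mul_le_mul_of_nonneg_left hE hβ
      linarith
  choose! φ hφ hφx hφE using key
  set g : (_ : Finset (Fin n)) × (Finset (Fin n) × (Fin n → ZMod 2)) → ℝ :=
    fun p => Real.exp (-β * (γ / 12)) ^ p.1.card * boltz H₂ β (x₀ + p.2.2) with hg
  have hinj : Set.InjOn φ (A \ goodReps H₁ G e : Finset (Fin n → ZMod 2)) := by
    intro x hx y hy hxy
    rw [hφx x hx, hφx y hy, hxy]
  calc ∑ x ∈ A \ goodReps H₁ G e, boltz H₂ β (x₀ + x)
      ≤ ∑ x ∈ A \ goodReps H₁ G e, g (φ x) := Finset.sum_le_sum hφE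
    _ = ∑ p ∈ (A \ goodReps H₁ G e).image φ, g p := (Finset.sum_image hinj).symm
    _ ≤ ∑ p ∈ (rootedSets G D).sigma (fun Λ => Λ.powerset ×ˢ A), g p := by
        refine Finset.sum_le_sum_of_subset_of_nonneg ?_ fun p _ _ => ?_
        · intro p hp
          obtain ⟨x, hx, rfl⟩ := Finset.mem_image.1 hp
          exact hφ x hx
        · exact mul_nonneg (by positivity) (boltz_pos _ _ _).le
    _ = _ := by
        rw [Finset.sum_sigma, Finset.sum_mul]
        refine Finset.sum_congr rfl fun Λ _ => ?_
        rw [Finset.sum_product, hg]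
        simp only [Finset.sum_const, Finset.card_powerset, ← Finset.mul_sum, nsmul_eq_mul]
        push_cast
        rw [mul_pow]; ring

/-- The sign `(-1)^c` as a real number. -/
def rsgn (c : ZMod 2) : ℝ := if c = 0 then 1 else -1

theorem rsgn_add (a b : ZMod 2) : rsgn (a + b) = rsgn a * rsgn b := by
  have key : ∀ a b : ZMod 2, (if a + b = 0 then (1 : ℤ) else -1) =
    (if a = 0 then 1 else -1) * if b = 0 then 1 else -1 := by decide
  unfold rsgn; exact_mod_cast key a b

/-- A nontrivial character sums to zero. -/
theorem sum_rsgn_nonneg (a : Fin n → ZMod 2) :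
    0 ≤ ∑ x : Fin n → ZMod 2, rsgn (dotProduct a x) := by
  classical
  by_cases ha : a = 0
  · subst ha
    simp [rsgn]
  · obtain ⟨i, hi⟩ := Function.ne_iff.1 ha
    have hi1 : a i = 1 := by
      have key : ∀ c : ZMod 2, c ≠ 0 → c = 1 := by decide
      exact key _ hi
    have h1 := Equiv.sum_comp (Equiv.addRight (Pi.single i (1 : ZMod 2)))
      fun x : Fin n → ZMod 2 => rsgn (dotProduct a x)
    have h2 : ∀ x : Fin n → ZMod 2,
        rsgn (dotProduct a (Equiv.addRight (Pi.single i (1 : ZMod 2)) x)) =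
          - rsgn (dotProduct a x) := by
      intro x
      rw [Equiv.coe_addRight, dotProduct_add, rsgn_add, dotProduct_single, mul_one, hi1]
      simp [rsgn]
    simp only [h2, Finset.sum_neg_distrib] at h1
    linarith

/-- The first Griffiths inequality for products of ferromagnetic factors, by expanding the product
into characters with nonnegative coefficients. -/
theorem griffiths {p q : Fin m → ℝ} (hp : ∀ j, 0 ≤ p j) (hq : ∀ j, 0 ≤ q j)
    (H : Matrix (Fin m) (Fin n) (ZMod 2)) (J : Finset (Fin m)) (a : Fin n → ZMod 2) :
    0 ≤ ∑ x : Fin n → ZMod 2,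
      rsgn (dotProduct a x) * ∏ j ∈ J, (p j + q j * rsgn (H.mulVec x j)) := by
  classical
  induction J using Finset.induction_on generalizing a with
  | empty => simpa using sum_rsgn_nonneg a
  | insert j J hj ih =>
    have e : ∀ x : Fin n → ZMod 2,
        rsgn (dotProduct a x) * ∏ j ∈ insert j J, (p j + q j * rsgn (H.mulVec x j)) =
        p j * (rsgn (dotProduct a x) * ∏ j ∈ J, (p j + q j * rsgn (H.mulVec x j))) +
        q j * (rsgn (dotProduct (a + H j) x) * ∏ j ∈ J, (p j + q j * rsgn (H.mulVec x j))) := by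
      intro x
      rw [Finset.prod_insert hj, add_dotProduct, rsgn_add]
      have : H.mulVec x j = dotProduct (H j) x := rfl
      rw [this]; ring
    simp only [e, Finset.sum_add_distrib, ← Finset.mul_sum]
    exact add_nonneg (mul_nonneg (hp j) (ih a)) (mul_nonneg (hq j) (ih _))

/-- Switching off the interaction of the checks in `T` raises the partition function by at most a
factor of two per check: by Griffiths' inequality a check is satisfied with probability at least
one half when its own interaction is absent. -/
theorem sum_exp_sdiff_le (H : Matrix (Fin m) (Fin n) (ZMod 2)) {β : ℝ} (hβ : 0 ≤ β)
    (T : Finset (Fin m)) :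
    ∑ x : Fin n → ZMod 2, Real.exp (-β * ((supp (H.mulVec x) \ T).card : ℝ)) ≤
      2 ^ T.card * ∑ x : Fin n → ZMod 2, boltz H β x := by
  classical
  set t : ℝ := Real.exp (-β) with ht
  have ht0 : 0 ≤ t := (Real.exp_pos _).le
  have ht1 : t ≤ 1 := by rw [ht, Real.exp_le_one_iff]; linarith
  set f : (Fin n → ZMod 2) → Fin m → ℝ := fun x j => if H.mulVec x j ≠ 0 then t else 1 with hf
  have hf0 : ∀ x j, 0 ≤ f x j := by
    intro x j; simp only [hf]; split_ifs <;> [exact ht0; exact zero_le_one]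
  have e : ∀ (T : Finset (Fin m)) x, Real.exp (-β * ((supp (H.mulVec x) \ T).card : ℝ)) =
      ∏ j ∈ Finset.univ \ T, f x j := by
    intro T x
    have : supp (H.mulVec x) \ T = (Finset.univ \ T).filter fun j => H.mulVec x j ≠ 0 := by
      ext j; simp [and_comm]
    rw [hf, this, ← Finset.prod_filter, Finset.prod_const, ht, ← Real.exp_nat_mul]
    congr 1; ring
  have e0 : ∀ x, boltz H β x = ∏ j ∈ Finset.univ \ ∅, f x j := by
    intro x; rw [← e ∅ x, Finset.sdiff_empty]; rfl
  simp only [e, e0]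
  induction T using Finset.induction_on with
  | empty => simp
  | insert i T hi ih =>
    rw [Finset.card_insert_of_notMem hi, pow_succ', mul_assoc]
    refine le_trans ?_ (mul_le_mul_of_nonneg_left ih zero_le_two)
    have hins : Finset.univ \ T = insert i (Finset.univ \ insert i T) := by
      ext j; by_cases hj : j = i <;> simp [hj, hi]
    have hni : i ∉ Finset.univ \ insert i T := by simp
    have hG := griffiths (p := fun _ => (1 + t) / 2) (q := fun _ => (1 - t) / 2)
      (fun _ => by linarith) (fun _ => by linarith) H (Finset.univ \ insert i T) (H i)
    have hfe : ∀ x j, (1 + t) / 2 + (1 - t) / 2 * rsgn (H.mulVec x j) = f x j := by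
      intro x j
      simp only [hf, rsgn]
      by_cases h0 : H.mulVec x j = 0 <;> simp [h0] <;> ring
    simp only [hfe] at hG
    rw [Finset.mul_sum, ← sub_nonneg, ← Finset.sum_sub_distrib]
    refine hG.trans (Finset.sum_le_sum fun x _ => ?_)
    rw [hins, Finset.prod_insert hni]
    have hP : 0 ≤ ∏ j ∈ Finset.univ \ insert i T, f x j := Finset.prod_nonneg fun j _ => hf0 x j
    -- the factor `f x i` is `1` where the check holds and `t ≥ 0` where it fails
    have hs : rsgn (dotProduct (H i) x) ≤ 2 * f x i - 1 := by
      have : dotProduct (H i) x = H.mulVec x i := rfl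
      rw [this]
      simp only [hf, rsgn]
      by_cases h0 : H.mulVec x i = 0
      · simp [h0]; norm_num
      · simp [h0, ht0]
    have := mul_le_mul_of_nonneg_right hs hP
    linarith

open Classical in
/-- A Gibbs sample violates typicality at `Λ` with probability at most
`(2 ^ w * exp (-β * ε)) ^ |Λ|`: its violated checks near `Λ` cost energy at least `ε * |Λ|`, and at
most `w * |Λ|` checks meet `Λ`. -/
theorem sum_not_typical_le {w D : ℕ} (hw : ∀ j, hammingNorm (fun i => H₂ i j) ≤ w) {β ε : ℝ}
    (hβ : 0 ≤ β) :
    ∑ x ∈ Finset.univ.filter (fun x => ¬ Typical H₂ G D ε x), boltz H₂ β x ≤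
      (∑ Λ ∈ rootedSets G D, (2 ^ w * Real.exp (-β * ε)) ^ Λ.card) *
        ∑ x : Fin n → ZMod 2, boltz H₂ β x := by
  set f : Finset (Fin n) → (Fin n → ZMod 2) → ℝ := fun Λ x =>
    Real.exp (-β * ε) ^ Λ.card *
      Real.exp (-β * ((supp (H₂.mulVec x) \ touching H₂ Λ).card : ℝ)) with hf
  have hf0 : ∀ Λ x, 0 ≤ f Λ x := fun Λ x => by positivity
  have h1 : ∀ x ∈ Finset.univ.filter (fun x => ¬ Typical H₂ G D ε x),
      boltz H₂ β x ≤ ∑ Λ ∈ rootedSets G D, f Λ x := by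
    intro x hx
    have hx' := (Finset.mem_filter.1 hx).2
    unfold Typical at hx'
    push Not at hx'
    obtain ⟨Λ, hΛ, hlt⟩ := hx'
    refine le_trans ?_ (Finset.single_le_sum (fun Λ _ => hf0 Λ x) hΛ)
    rw [hf]
    dsimp only
    unfold boltz
    rw [← Real.exp_nat_mul, ← Real.exp_add, Real.exp_le_exp, hammingNorm_eq_card_supp,
      ← Finset.card_inter_add_card_sdiff (supp (H₂.mulVec x)) (touching H₂ Λ)]
    push_cast
    have := mul_le_mul_of_nonneg_left hlt.le hβ
    linarith
  have h2 : ∀ Λ ∈ rootedSets G D, ∑ x, f Λ x ≤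
      (2 ^ w * Real.exp (-β * ε)) ^ Λ.card * ∑ x : Fin n → ZMod 2, boltz H₂ β x := by
    intro Λ _
    have hT : (touching H₂ Λ).card ≤ w * Λ.card := by
      have : touching H₂ Λ ⊆ Λ.biUnion fun j => supp fun i => H₂ i j := by
        intro c hc
        simp only [touching, Finset.mem_filter, Finset.mem_univ, true_and] at hc
        obtain ⟨i, hi, hci⟩ := hc
        exact Finset.mem_biUnion.2 ⟨i, hi, mem_supp.2 hci⟩
      rw [mul_comm]
      exact (Finset.card_le_card this).trans (Finset.card_biUnion_le_card_mul _ _ _ fun j _ => hw j)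
    have hZ : 0 ≤ ∑ x : Fin n → ZMod 2, boltz H₂ β x :=
      Finset.sum_nonneg fun x _ => (boltz_pos _ _ _).le
    rw [hf, ← Finset.mul_sum, mul_pow, mul_comm ((2 ^ w) ^ _), mul_assoc, ← pow_mul]
    refine mul_le_mul_of_nonneg_left ((sum_exp_sdiff_le H₂ hβ _).trans ?_) (by positivity)
    exact mul_le_mul_of_nonneg_right (pow_le_pow_right₀ (by norm_num) hT) hZ
  calc _ ≤ ∑ x ∈ Finset.univ.filter (fun x => ¬ Typical H₂ G D ε x),
        ∑ Λ ∈ rootedSets G D, f Λ x := Finset.sum_le_sum h1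
    _ ≤ ∑ x, ∑ Λ ∈ rootedSets G D, f Λ x :=
        Finset.sum_le_sum_of_subset_of_nonneg (Finset.subset_univ _) fun x _ _ =>
          Finset.sum_nonneg fun Λ _ => hf0 Λ x
    _ = ∑ Λ ∈ rootedSets G D, ∑ x, f Λ x := Finset.sum_comm
    _ ≤ _ := by rw [Finset.sum_mul]; exact Finset.sum_le_sum h2

end Boltzmann

/-! ### Operators, projectors and traces -/

section Operators

variable {n : ℕ}

theorem act_apply (A : Op n) (ψ : QState n) : act A ψ = WithLp.toLp 2 (A.mulVec ψ.ofLp) := rfl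

theorem act_add_op (A B : Op n) (ψ : QState n) : act (A + B) ψ = act A ψ + act B ψ := by
  simp [act]

theorem act_sub_op (A B : Op n) (ψ : QState n) : act (A - B) ψ = act A ψ - act B ψ := by
  simp [act]

theorem act_smul_op (c : ℂ) (A : Op n) (ψ : QState n) : act (c • A) ψ = c • act A ψ := by
  simp [act]

theorem act_sum_op {ι : Type*} (s : Finset ι) (A : ι → Op n) (ψ : QState n) :
    act (∑ i ∈ s, A i) ψ = ∑ i ∈ s, act (A i) ψ := by
  simp [act]

theorem act_add (A : Op n) (ψ φ : QState n) : act A (ψ + φ) = act A ψ + act A φ := map_add _ _ _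

theorem act_sub (A : Op n) (ψ φ : QState n) : act A (ψ - φ) = act A ψ - act A φ := map_sub _ _ _

theorem act_smul (c : ℂ) (A : Op n) (ψ : QState n) : act A (c • ψ) = c • act A ψ := map_smul _ _ _

theorem act_mul (A B : Op n) (ψ : QState n) : act (A * B) ψ = act A (act B ψ) := by
  rw [act_apply, act_apply, act_apply, Matrix.mulVec_mulVec]

@[simp] theorem act_one (ψ : QState n) : act (1 : Op n) ψ = ψ := by
  rw [act_apply, Matrix.one_mulVec]

theorem act_ext {A B : Op n} (h : ∀ ψ, act A ψ = act B ψ) : A = B :=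
  Matrix.toEuclideanLin.injective (LinearMap.ext h)

theorem inner_act_right (A : Op n) (ψ φ : QState n) :
    inner ℂ ψ (act A φ) = inner ℂ (act A.conjTranspose ψ) φ := by
  unfold act
  rw [Matrix.toEuclideanLin_conjTranspose_eq_adjoint, LinearMap.adjoint_inner_left]

theorem inner_act_left (A : Op n) (ψ φ : QState n) :
    inner ℂ (act A ψ) φ = inner ℂ ψ (act A.conjTranspose φ) := by
  rw [inner_act_right, Matrix.conjTranspose_conjTranspose]

theorem inner_self_eq_ofReal (ψ : QState n) : inner ℂ ψ ψ = ((‖ψ‖ ^ 2 : ℝ) : ℂ) := by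
  rw [inner_self_eq_norm_sq_to_K]; push_cast; rfl

theorem act_proj (W : Submodule ℂ (QState n)) (ψ : QState n) :
    act (proj W) ψ = W.starProjection ψ := by
  simp [act, proj]

theorem proj_isHermitian (W : Submodule ℂ (QState n)) : (proj W).conjTranspose = proj W := by
  refine act_ext fun ψ => ext_inner_left ℂ fun φ => ?_
  rw [inner_act_right, Matrix.conjTranspose_conjTranspose, act_proj, act_proj]
  exact Submodule.inner_starProjection_left_eq_right W φ ψ

theorem proj_mul_proj_of_le {W V : Submodule ℂ (QState n)} (h : W ≤ V) :
    proj V * proj W = proj W := by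
  refine act_ext fun ψ => ?_
  rw [act_mul, act_proj, act_proj]
  exact Submodule.starProjection_eq_self_iff.2 (h (Submodule.starProjection_apply_mem _ _))

theorem proj_mul_self (W : Submodule ℂ (QState n)) : proj W * proj W = proj W :=
  proj_mul_proj_of_le le_rfl

theorem proj_mul_proj_of_le' {W V : Submodule ℂ (QState n)} (h : W ≤ V) :
    proj W * proj V = proj W := by
  have := congrArg Matrix.conjTranspose (proj_mul_proj_of_le h)
  rwa [Matrix.conjTranspose_mul, proj_isHermitian, proj_isHermitian] at this

theorem trace_eq_linearMap_trace (A : Op n) :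
    A.trace = LinearMap.trace ℂ (QState n) (Matrix.toEuclideanLin A) := by
  rw [Matrix.toEuclideanLin, Matrix.toLpLin_eq_toLin, Matrix.trace_toLin_eq]

theorem trace_eq_sum_inner {ι : Type*} [Fintype ι] (b : OrthonormalBasis ι ℂ (QState n)) (A : Op n) :
    A.trace = ∑ i, inner ℂ (b i) (act A (b i)) := by
  rw [trace_eq_linearMap_trace, LinearMap.trace_eq_sum_inner _ b]
  rfl

/-- `2 P_W - 1` is the reflection in `W`, hence an isometry. -/
theorem norm_two_proj_sub (W : Submodule ℂ (QState n)) (ψ : QState n) :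
    ‖act ((2 : ℂ) • proj W - 1) ψ‖ = ‖ψ‖ := by
  rw [act_sub_op, act_smul_op, act_proj, act_one, ← W.reflection.norm_map ψ,
    Submodule.reflection_apply, two_smul, two_smul]

/-- The trace norm dominates the pairing with every contraction, as one sees in an eigenbasis of
`Aᴴ * A`. -/
theorem re_trace_mul_le_traceNorm (A B : Op n) (hB : ∀ ψ, ‖act B ψ‖ ≤ ‖ψ‖) :
    (B * A).trace.re ≤ traceNorm A := by
  set h := Matrix.isHermitian_conjTranspose_mul_self A
  rw [trace_eq_sum_inner h.eigenvectorBasis, Complex.re_sum, traceNorm]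
  refine Finset.sum_le_sum fun i _ => ?_
  set v := h.eigenvectorBasis i with hv
  have hv1 : ‖v‖ = 1 := h.eigenvectorBasis.orthonormal.1 i
  have hAv : act (A.conjTranspose * A) v = (h.eigenvalues i : ℂ) • v := by
    rw [act_apply, h.mulVec_eigenvectorBasis i]; rfl
  have hnorm : ‖act A v‖ ^ 2 = h.eigenvalues i := by
    have h1 : inner ℂ (act A v) (act A v) = (h.eigenvalues i : ℂ) := by
      rw [inner_act_left, ← act_mul, hAv, inner_smul_right, inner_self_eq_ofReal, hv1]
      simp
    rw [inner_self_eq_ofReal] at h1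
    exact_mod_cast h1
  calc (inner ℂ v (act (B * A) v)).re ≤ ‖inner ℂ v (act (B * A) v)‖ := Complex.re_le_norm _
    _ ≤ ‖v‖ * ‖act (B * A) v‖ := norm_inner_le_norm _ _
    _ ≤ 1 * ‖act A v‖ := by
        rw [hv1, act_mul]; exact mul_le_mul_of_nonneg_left (hB _) zero_le_one
    _ = √(h.eigenvalues i) := by
        rw [one_mul, ← hnorm, Real.sqrt_sq (norm_nonneg _)]

theorem inner_act_nonneg {A : Op n} (hA : A.PosSemidef) (v : QState n) :
    0 ≤ inner ℂ v (act A v) := by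
  have := hA.dotProduct_mulVec_nonneg v.ofLp
  rw [EuclideanSpace.inner_eq_star_dotProduct, dotProduct_comm]
  exact this

/-- The trace norm of a positive operator is its trace. -/
theorem traceNorm_of_posSemidef {A : Op n} (hA : A.PosSemidef) : traceNorm A = A.trace.re := by
  set h := Matrix.isHermitian_conjTranspose_mul_self A
  rw [trace_eq_sum_inner h.eigenvectorBasis, Complex.re_sum, traceNorm]
  refine Finset.sum_congr rfl fun i _ => ?_
  set v := h.eigenvectorBasis i with hv
  have hv1 : ‖v‖ = 1 := h.eigenvectorBasis.orthonormal.1 i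
  have hAv : act (A.conjTranspose * A) v = (h.eigenvalues i : ℂ) • v := by
    rw [act_apply, h.mulVec_eigenvectorBasis i]; rfl
  have hmu : 0 ≤ h.eigenvalues i := Matrix.eigenvalues_conjTranspose_mul_self_nonneg A i
  set s := √(h.eigenvalues i) with hs
  have hss : (s : ℂ) * s = h.eigenvalues i := by
    exact_mod_cast Real.mul_self_sqrt hmu
  have hs0 : 0 ≤ s := Real.sqrt_nonneg _
  have hAv : act A (act A v) = (h.eigenvalues i : ℂ) • v := by
    rw [← hAv, act_mul, hA.isHermitian.eq]
  -- `u = A v - s v` is annihilated by `A + s`, hence vanishes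
  have hu : act A v = (s : ℂ) • v := by
    set u := act A v - (s : ℂ) • v with hu
    have h1 : act A u = -(s : ℂ) • u := by
      rw [hu, act_sub, act_smul, hAv, ← hss]
      module
    have h2 := inner_act_nonneg hA u
    rw [h1, inner_smul_right, inner_self_eq_ofReal] at h2
    have h3 : (0 : ℝ) ≤ -s * ‖u‖ ^ 2 := by
      have h4 : (0 : ℂ) ≤ ((-s * ‖u‖ ^ 2 : ℝ) : ℂ) := by
        rw [Complex.ofReal_mul, Complex.ofReal_neg]; exact h2
      exact_mod_cast h4
    rcases hs0.eq_or_lt with h0 | hpos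
    · have h5 : ‖act A v‖ ^ 2 = 0 := by
        have h6 : inner ℂ (act A v) (act A v) = 0 := by
          rw [inner_act_left, hA.isHermitian.eq, hAv, ← hss, ← h0]; simp
        rw [inner_self_eq_ofReal] at h6
        exact_mod_cast h6
      rw [← h0, norm_eq_zero.1 (pow_eq_zero_iff two_ne_zero |>.1 h5)]
      simp
    · have h5 : ‖u‖ ^ 2 ≤ 0 := by nlinarith
      have h6 : u = 0 := norm_eq_zero.1 (pow_eq_zero_iff two_ne_zero |>.1
        (le_antisymm h5 (sq_nonneg _)))
      exact sub_eq_zero.1 h6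
  rw [hu, inner_smul_right, inner_self_eq_ofReal, hv1]
  simp

theorem trace_proj_mul_eq (W : Submodule ℂ (QState n)) (A : Op n) :
    (proj W * A).trace = (proj W * A * proj W).trace := by
  conv_lhs => rw [← proj_mul_self W]
  rw [Matrix.mul_assoc, Matrix.trace_mul_comm]

theorem posSemidef_proj_mul_mul_proj (W : Submodule ℂ (QState n)) {A : Op n} (hA : A.PosSemidef) :
    (proj W * A * proj W).PosSemidef := by
  have := hA.conjTranspose_mul_mul_same (proj W)
  rwa [proj_isHermitian] at this

theorem trace_proj_mul_nonneg (W : Submodule ℂ (QState n)) {A : Op n} (hA : A.PosSemidef) :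
    0 ≤ (proj W * A).trace := by
  rw [trace_proj_mul_eq]; exact (posSemidef_proj_mul_mul_proj W hA).trace_nonneg

theorem trace_proj_mul_pos {W : Submodule ℂ (QState n)} (hW : W ≠ ⊥) {A : Op n} (hA : A.PosDef) :
    0 < (proj W * A).trace := by
  refine lt_of_le_of_ne (trace_proj_mul_nonneg W hA.posSemidef) fun h0 => ?_
  rw [trace_proj_mul_eq] at h0
  have h1 := (posSemidef_proj_mul_mul_proj W hA.posSemidef).trace_eq_zero_iff.1 h0.symm
  obtain ⟨v, hv, hv0⟩ := W.ne_bot_iff.1 hW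
  have hPv : act (proj W) v = v := by
    rw [act_proj]; exact Submodule.starProjection_eq_self_iff.2 hv
  have h2 : inner ℂ v (act (proj W * A * proj W) v) = 0 := by rw [h1]; simp [act]
  rw [act_mul, act_mul, hPv, inner_act_right, proj_isHermitian, hPv] at h2
  have hne : v.ofLp ≠ 0 := fun h => hv0 (by ext i; simp [h])
  have h3 := hA.dotProduct_mulVec_pos hne
  rw [EuclideanSpace.inner_eq_star_dotProduct, dotProduct_comm, act_apply] at h2
  exact h3.ne' h2

theorem trace_proj_mono {W V : Submodule ℂ (QState n)} (h : W ≤ V) {A : Op n} (hA : A.PosSemidef) :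
    (proj W * A).trace.re ≤ (proj V * A).trace.re := by
  set Q := proj V - proj W with hQ
  have hQh : Q.conjTranspose = Q := by
    rw [hQ, Matrix.conjTranspose_sub, proj_isHermitian, proj_isHermitian]
  have hQQ : Q * Q = Q := by
    rw [hQ, sub_mul, mul_sub, mul_sub, proj_mul_self, proj_mul_self, proj_mul_proj_of_le h,
      proj_mul_proj_of_le' h]
    abel
  have h1 : 0 ≤ (Q * A).trace := by
    have h2 := (hA.conjTranspose_mul_mul_same Q).trace_nonneg
    rwa [hQh, Matrix.trace_mul_comm, ← Matrix.mul_assoc, hQQ] at h2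
  rw [hQ, sub_mul, Matrix.trace_sub, Complex.le_def] at h1
  have := h1.1
  simp at this
  linarith

theorem trace_proj_mul_eq_restrict (W : Submodule ℂ (QState n)) (A : Op n) :
    (proj W * A).trace = LinearMap.trace ℂ W
      (W.orthogonalProjectionOnto.toLinearMap ∘ₗ (Matrix.toEuclideanLin A ∘ₗ W.subtype)) := by
  rw [trace_eq_linearMap_trace, ← LinearMap.comp_assoc, LinearMap.trace_comp_comm',
    ← LinearMap.comp_assoc]
  congr 1
  refine LinearMap.ext fun ψ => ?_
  change act (proj W * A) ψ = _
  rw [act_mul, act_proj]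
  rfl

/-- The trace of an operator over the span of independent eigenvectors. -/
theorem trace_proj_span_eq {ι : Type*} [Fintype ι] {A : Op n} {v : ι → QState n} {c : ι → ℂ}
    (hv : ∀ i, act A (v i) = c i • v i) (hli : LinearIndependent ℂ v) :
    (proj (Submodule.span ℂ (Set.range v)) * A).trace = ∑ i, c i := by
  classical
  set W := Submodule.span ℂ (Set.range v) with hW
  set b := Module.Basis.span hli with hb
  have hbv : ∀ i, (b i : QState n) = v i := fun i => congrArg Subtype.val (Module.Basis.span_apply hli i)
  rw [trace_proj_mul_eq_restrict, LinearMap.trace_eq_matrix_trace ℂ b, Matrix.trace]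
  refine Finset.sum_congr rfl fun i _ => ?_
  rw [Matrix.diag_apply, LinearMap.toMatrix_apply]
  have : (W.orthogonalProjectionOnto.toLinearMap ∘ₗ (Matrix.toEuclideanLin A ∘ₗ W.subtype)) (b i) =
      c i • b i := by
    have h1 : act A (b i : QState n) = ((c i • b i : W) : QState n) := by
      rw [hbv, hv, Submodule.coe_smul, hbv]
    change W.orthogonalProjectionOnto (act A (b i : QState n)) = _
    rw [h1, Submodule.orthogonalProjectionOnto_mem_subspace_eq_self]
  rw [this, map_smul, Module.Basis.repr_self]
  simp

/-- A bound by eigenvalues of a spanning family of eigenvectors, which need not be independent. -/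
theorem trace_proj_le_sum {ι : Type*} [Fintype ι] {A : Op n} (hA : A.PosSemidef)
    {v : ι → QState n} {c : ι → ℝ} (hc : ∀ i, 0 ≤ c i)
    (hv : ∀ i, act A (v i) = (c i : ℂ) • v i) {W : Submodule ℂ (QState n)}
    (hW : W ≤ Submodule.span ℂ (Set.range v)) :
    (proj W * A).trace.re ≤ ∑ i, c i := by
  classical
  obtain ⟨κ, a, ha, hspan, hli⟩ := exists_linearIndependent' ℂ v
  have : Finite κ := Finite.of_injective a ha
  have : Fintype κ := Fintype.ofFinite κ
  refine (trace_proj_mono (hW.trans hspan.ge) hA).trans ?_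
  rw [trace_proj_span_eq (v := v ∘ a) (c := fun k => (c (a k) : ℂ)) (fun k => hv (a k)) hli,
    Complex.re_sum]
  simp only [Complex.ofReal_re]
  rw [← Finset.sum_image (f := c) (s := Finset.univ) (g := a) (fun x _ y _ h => ha h)]
  exact Finset.sum_le_sum_of_subset_of_nonneg (Finset.subset_univ _) fun i _ _ => hc i

/-- A Hermitian operator also preserves the orthogonal complement of an invariant subspace. -/
theorem proj_commute_of_invariant {W : Submodule ℂ (QState n)} {A : Op n} (hA : A.IsHermitian)
    (hW : ∀ ψ ∈ W, act A ψ ∈ W) : proj W * A = proj W * A * proj W := by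
  refine act_ext fun ψ => ?_
  rw [act_mul, act_mul, act_mul, ← sub_eq_zero, ← act_sub, ← act_sub, act_proj, act_proj,
    Submodule.starProjection_apply_eq_zero_iff, Submodule.mem_orthogonal]
  intro φ hφ
  rw [inner_act_right, hA.eq]
  exact (Submodule.mem_orthogonal _ _).1 (Submodule.sub_starProjection_mem_orthogonal ψ) _ (hW φ hφ)

theorem posSemidef_proj_mul_of_invariant {W : Submodule ℂ (QState n)} {A : Op n}
    (hA : A.PosSemidef) (hW : ∀ ψ ∈ W, act A ψ ∈ W) : (proj W * A).PosSemidef := by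
  rw [proj_commute_of_invariant hA.isHermitian hW]; exact posSemidef_proj_mul_mul_proj W hA

theorem trace_mul_vecMulVec (A : Op n) (φ : QState n) :
    (A * Matrix.vecMulVec (fun a => φ a) (fun a => star (φ a))).trace = inner ℂ φ (act A φ) := by
  rw [Matrix.mul_vecMulVec, Matrix.trace_vecMulVec, EuclideanSpace.inner_eq_star_dotProduct]
  rfl

theorem inner_act_proj_self (W : Submodule ℂ (QState n)) (φ : QState n) :
    inner ℂ φ (act (proj W) φ) = ((‖W.starProjection φ‖ ^ 2 : ℝ) : ℂ) := by
  rw [← proj_mul_self, act_mul, inner_act_right, proj_isHermitian, act_proj,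
    inner_self_eq_ofReal]

theorem act_exp_of_eigenvector {A : Op n} {ψ : QState n} {c : ℂ} (h : act A ψ = c • ψ) :
    act (NormedSpace.exp A) ψ = Complex.exp c • ψ := by
  let _ : NormedRing (Op n) := Matrix.linftyOpNormedRing
  let _ : NormedAlgebra ℂ (Op n) := Matrix.linftyOpNormedAlgebra
  have h1 : HasSum (fun k : ℕ => ((k.factorial : ℂ)⁻¹) • A ^ k) (NormedSpace.exp A) :=
    NormedSpace.exp_series_hasSum_exp' A
  let L : Op n →ₗ[ℂ] QState n :=
    { toFun := fun B => act B ψ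
      map_add' := fun B B' => act_add_op B B' ψ
      map_smul' := fun c B => act_smul_op c B ψ }
  have hL : Continuous L := L.continuous_of_finiteDimensional
  have h2 : HasSum (fun k : ℕ => L (((k.factorial : ℂ)⁻¹) • A ^ k)) (L (NormedSpace.exp A)) :=
    h1.map L hL
  have hpow : ∀ k : ℕ, act (A ^ k) ψ = c ^ k • ψ := by
    intro k
    induction k with
    | zero => simp
    | succ k ih => rw [pow_succ', act_mul, ih, act_smul, h, smul_smul, pow_succ]
  have h3 : HasSum (fun k : ℕ => L (((k.factorial : ℂ)⁻¹) • A ^ k)) (Complex.exp c • ψ) := by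
    have h4 : HasSum (fun k : ℕ => ((k.factorial : ℂ)⁻¹) • c ^ k) (Complex.exp c) := by
      rw [Complex.exp_eq_exp_ℂ]; exact NormedSpace.exp_series_hasSum_exp' c
    convert h4.smul_const ψ using 2 with k
    change act _ ψ = _
    rw [act_smul_op, hpow, smul_smul, smul_eq_mul]
  exact h2.unique h3

end Operators

/-! ### Pauli operators and locality -/

section Pauli

variable {n : ℕ}

/-- The complex sign `(-1)^c`. -/
def csgn (c : ZMod 2) : ℂ := if c = 0 then 1 else -1

@[simp] theorem csgn_zero : csgn 0 = 1 := by simp [csgn]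

theorem csgn_add (a b : ZMod 2) : csgn (a + b) = csgn a * csgn b := by
  have key : ∀ a b : ZMod 2, (if a + b = 0 then (1 : ℤ) else -1) =
    (if a = 0 then 1 else -1) * if b = 0 then 1 else -1 := by decide
  unfold csgn; exact_mod_cast key a b

theorem csgn_mul_self (a : ZMod 2) : csgn a * csgn a = 1 := by
  rw [← csgn_add, CharTwo.add_self_eq_zero, csgn_zero]

theorem csgn_eq_neg_one {a : ZMod 2} (h : a ≠ 0) : csgn a = -1 := by simp [csgn, h]

theorem act_pauliX_apply (x : Fin n → ZMod 2) (ψ : QState n) (b : Fin n → ZMod 2) :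
    act (pauliX x) ψ b = ψ (b + x) := by
  rw [act_apply]
  change ∑ c, pauliX x b c * ψ c = _
  rw [Finset.sum_eq_single (b + x)]
  · simp [pauliX, add_assoc, add_self_vec]
  · intro c _ hc
    have : b ≠ c + x := by
      rintro rfl; exact hc (by rw [add_assoc, add_self_vec, add_zero])
    simp [pauliX, this]
  · simp

theorem act_pauliZ_apply (z : Fin n → ZMod 2) (ψ : QState n) (b : Fin n → ZMod 2) :
    act (pauliZ z) ψ b = csgn (dotProduct z b) * ψ b := by
  rw [act_apply]
  change (Matrix.diagonal _).mulVec _ b = _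
  rw [Matrix.mulVec_diagonal]
  rfl

/-- The Pauli operator `X^x Z^z`. -/
def pauli (x z : Fin n → ZMod 2) : Op n := pauliX x * pauliZ z

theorem act_pauli_apply (x z : Fin n → ZMod 2) (ψ : QState n) (b : Fin n → ZMod 2) :
    act (pauli x z) ψ b = csgn (dotProduct z (b + x)) * ψ (b + x) := by
  rw [pauli, act_mul, act_pauliX_apply, act_pauliZ_apply]

theorem pauliX_eq_pauli (x : Fin n → ZMod 2) : pauliX x = pauli x 0 := by
  refine act_ext fun ψ => ?_
  ext b
  rw [act_pauliX_apply, act_pauli_apply]; simp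

theorem pauliZ_eq_pauli (z : Fin n → ZMod 2) : pauliZ z = pauli 0 z := by
  refine act_ext fun ψ => ?_
  ext b
  rw [act_pauliZ_apply, act_pauli_apply]; simp

theorem pauli_zero : pauli (0 : Fin n → ZMod 2) 0 = 1 := by
  refine act_ext fun ψ => ?_
  ext b
  rw [act_pauli_apply]; simp

theorem pauli_mul (x z x' z' : Fin n → ZMod 2) :
    pauli x z * pauli x' z' = csgn (dotProduct z x') • pauli (x + x') (z + z') := by
  refine act_ext fun ψ => ?_
  ext b
  rw [act_mul, act_smul_op, act_pauli_apply, act_pauli_apply, PiLp.smul_apply, act_pauli_apply,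
    smul_eq_mul, ← mul_assoc, ← mul_assoc, ← csgn_add, ← csgn_add, add_assoc b x x']
  congr 2
  simp only [add_dotProduct, dotProduct_add]
  generalize dotProduct z b = p
  generalize dotProduct z x = q
  generalize dotProduct z x' = r
  have h : r + r = 0 := CharTwo.add_self_eq_zero r
  linear_combination -h

theorem pauli_conjTranspose (x z : Fin n → ZMod 2) :
    (pauli x z).conjTranspose = csgn (dotProduct z x) • pauli x z := by
  have hX : (pauliX x).conjTranspose = pauliX x := by
    ext a b
    simp only [pauliX, Matrix.conjTranspose_apply, Matrix.of_apply]
    have : b = a + x ↔ a = b + x := by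
      constructor <;> rintro rfl <;> rw [add_assoc, add_self_vec, add_zero]
    simp only [this]
    split_ifs <;> simp
  have hZ : (pauliZ z).conjTranspose = pauliZ z := by
    unfold pauliZ
    rw [Matrix.diagonal_conjTranspose]
    congr 1
    funext b
    simp only [Pi.star_apply]
    split_ifs <;> simp
  rw [pauli, Matrix.conjTranspose_mul, hX, hZ, ← pauli, pauliX_eq_pauli, pauliZ_eq_pauli,
    pauli_mul, zero_add, add_zero]

/-- The operators acting on the qubits in `A`, as combinations of Pauli operators supported there.
Compared with `ActsOn`, this form is visibly closed under products and adjoints. -/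
def pauliSpan (A : Finset (Fin n)) : Submodule ℂ (Op n) :=
  Submodule.span ℂ {P | ∃ a b, supp a ⊆ A ∧ supp b ⊆ A ∧ P = pauli a b}

theorem pauli_mem_pauliSpan {A : Finset (Fin n)} {a b : Fin n → ZMod 2} (ha : supp a ⊆ A)
    (hb : supp b ⊆ A) : pauli a b ∈ pauliSpan A :=
  Submodule.subset_span ⟨a, b, ha, hb, rfl⟩

theorem pauliSpan_mono {A B : Finset (Fin n)} (h : A ⊆ B) : pauliSpan A ≤ pauliSpan B := by
  refine Submodule.span_mono ?_
  rintro P ⟨a, b, ha, hb, rfl⟩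
  exact ⟨a, b, ha.trans h, hb.trans h, rfl⟩

theorem supp_zero : supp (0 : Fin n → ZMod 2) = ∅ := by simp [supp]

theorem one_mem_pauliSpan (A : Finset (Fin n)) : (1 : Op n) ∈ pauliSpan A := by
  rw [← pauli_zero]; exact pauli_mem_pauliSpan (by simp [supp_zero]) (by simp [supp_zero])

theorem mul_mem_pauliSpan {A : Finset (Fin n)} {P Q : Op n} (hP : P ∈ pauliSpan A)
    (hQ : Q ∈ pauliSpan A) : P * Q ∈ pauliSpan A := by
  induction hP using Submodule.span_induction with
  | mem P hP =>
    obtain ⟨a, b, ha, hb, rfl⟩ := hP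
    induction hQ using Submodule.span_induction with
    | mem Q hQ =>
      obtain ⟨a', b', ha', hb', rfl⟩ := hQ
      rw [pauli_mul]
      exact Submodule.smul_mem _ _ (pauli_mem_pauliSpan
        ((supp_add_subset _ _).trans (Finset.union_subset ha ha'))
        ((supp_add_subset _ _).trans (Finset.union_subset hb hb')))
    | zero => rw [mul_zero]; exact Submodule.zero_mem _
    | add Q Q' _ _ h h' => rw [mul_add]; exact Submodule.add_mem _ h h'
    | smul c Q _ h => rw [mul_smul_comm]; exact Submodule.smul_mem _ _ h
  | zero => rw [zero_mul]; exact Submodule.zero_mem _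
  | add P P' _ _ h h' => rw [add_mul]; exact Submodule.add_mem _ h h'
  | smul c P _ h => rw [smul_mul_assoc]; exact Submodule.smul_mem _ _ h

theorem conjTranspose_mem_pauliSpan {A : Finset (Fin n)} {P : Op n} (hP : P ∈ pauliSpan A) :
    P.conjTranspose ∈ pauliSpan A := by
  induction hP using Submodule.span_induction with
  | mem P hP =>
    obtain ⟨a, b, ha, hb, rfl⟩ := hP
    rw [pauli_conjTranspose]
    exact Submodule.smul_mem _ _ (pauli_mem_pauliSpan ha hb)
  | zero => rw [Matrix.conjTranspose_zero]; exact Submodule.zero_mem _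
  | add P P' _ _ h h' => rw [Matrix.conjTranspose_add]; exact Submodule.add_mem _ h h'
  | smul c P _ h => rw [Matrix.conjTranspose_smul]; exact Submodule.smul_mem _ _ h

theorem dotProduct_eq_zero_of_disjoint {A B : Finset (Fin n)} (h : Disjoint A B)
    {a b : Fin n → ZMod 2} (ha : supp a ⊆ A) (hb : supp b ⊆ B) : dotProduct a b = 0 := by
  refine Finset.sum_eq_zero fun i _ => ?_
  by_contra hi
  exact Finset.disjoint_left.1 h (ha (mem_supp.2 (left_ne_zero_of_mul hi)))
    (hb (mem_supp.2 (right_ne_zero_of_mul hi)))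

theorem commute_of_disjoint {A B : Finset (Fin n)} (h : Disjoint A B) {P Q : Op n}
    (hP : P ∈ pauliSpan A) (hQ : Q ∈ pauliSpan B) : P * Q = Q * P := by
  induction hP using Submodule.span_induction with
  | mem P hP =>
    obtain ⟨a, b, ha, hb, rfl⟩ := hP
    induction hQ using Submodule.span_induction with
    | mem Q hQ =>
      obtain ⟨a', b', ha', hb', rfl⟩ := hQ
      rw [pauli_mul, pauli_mul, dotProduct_eq_zero_of_disjoint h hb ha',
        dotProduct_eq_zero_of_disjoint h.symm hb' ha, add_comm a, add_comm b]
    | zero => simp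
    | add Q Q' _ _ h h' => rw [mul_add, add_mul, h, h']
    | smul c Q _ h => rw [mul_smul_comm, smul_mul_assoc, h]
  | zero => simp
  | add P P' _ _ h h' => rw [mul_add, add_mul, h, h']
  | smul c P _ h => rw [mul_smul_comm, smul_mul_assoc, h]

open Classical in
/-- The projector onto the computational basis states that agree with `c` on `S`. -/
def cylinder (S : Finset (Fin n)) (c : Fin n → ZMod 2) : Op n :=
  Matrix.diagonal fun b => if ∀ i ∈ S, b i = c i then 1 else 0

theorem supp_single_subset {S : Finset (Fin n)} {i : Fin n} (hi : i ∈ S) :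
    supp (Pi.single i (1 : ZMod 2)) ⊆ S := by
  intro j hj
  rw [mem_supp] at hj
  by_cases h : j = i
  · rwa [h]
  · simp [h] at hj

/-- A cylinder projector is the product of the projectors `(1 ± Z_i) / 2`. -/
theorem cylinder_mem_pauliSpan (S : Finset (Fin n)) (c : Fin n → ZMod 2) :
    cylinder S c ∈ pauliSpan S := by
  classical
  induction S using Finset.induction_on with
  | empty =>
    have : cylinder ∅ c = (1 : Op n) := by simp [cylinder]
    rw [this]; exact one_mem_pauliSpan _
  | insert i S hi ih =>
    have : cylinder (insert i S) c = cylinder S c *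
        ((1 / 2 : ℂ) • 1 + ((1 / 2 : ℂ) * csgn (c i)) • pauliZ (Pi.single i 1)) := by
      unfold cylinder pauliZ
      rw [← Matrix.diagonal_one, ← Matrix.diagonal_smul, ← Matrix.diagonal_smul,
        Matrix.diagonal_add, Matrix.diagonal_mul_diagonal]
      congr 1
      funext b
      simp only [Finset.forall_mem_insert, Pi.smul_apply, smul_eq_mul, single_dotProduct, one_mul]
      have key : ∀ p q : ZMod 2, (if p = q then (1 : ℂ) else 0) =
          1 / 2 * 1 + 1 / 2 * csgn q * if p = 0 then 1 else -1 := by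
        have h2 : ∀ p q : ZMod 2, (if p = q then (2 : ℤ) else 0) =
          1 + (if q = 0 then 1 else -1) * if p = 0 then 1 else -1 := by decide
        intro p q
        have h3 : ((if p = q then (2 : ℤ) else 0 : ℤ) : ℂ) = _ := congrArg _ (h2 p q)
        push_cast at h3
        unfold csgn
        split_ifs at h3 ⊢ <;> linear_combination h3 / 2
      rw [← key (b i) (c i)]
      by_cases h1 : b i = c i <;> by_cases h2 : ∀ j ∈ S, b j = c j <;> simp [h1, h2]
    rw [this]
    refine mul_mem_pauliSpan (pauliSpan_mono (Finset.subset_insert i S) ih) ?_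
    refine Submodule.add_mem _ (Submodule.smul_mem _ _ (one_mem_pauliSpan _))
      (Submodule.smul_mem _ _ ?_)
    rw [pauliZ_eq_pauli]
    exact pauli_mem_pauliSpan (by simp [supp_zero]) (supp_single_subset (Finset.mem_insert_self i S))

theorem ActsOn.mem_pauliSpan {A : Finset (Fin n)} {O : Op n} (h : ActsOn A O) :
    O ∈ pauliSpan A := by
  classical
  obtain ⟨M, hM⟩ := h
  set ext : (A → ZMod 2) → Fin n → ZMod 2 := fun c i => if hi : i ∈ A then c ⟨i, hi⟩ else 0 with hext
  have hsupp : ∀ c, supp (ext c) ⊆ A := by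
    intro c i hi
    by_contra h
    rw [mem_supp] at hi
    exact hi (by simp [hext, h])
  -- the matrix unit `|c⟩⟨c'|` on `A` is a bit flip after the projector onto `c'`
  have hO : O = ∑ c, ∑ c', M c c' • (pauliX (ext c + ext c') * cylinder A (ext c')) := by
    ext a b
    rw [hM]
    simp only [Matrix.sum_apply, Matrix.smul_apply, smul_eq_mul]
    have hE : ∀ c c', (pauliX (ext c + ext c') * cylinder A (ext c')) a b =
        if (fun i : A => a i) = c then (if (fun i : A => b i) = c' then
          (if ∀ i, i ∉ A → a i = b i then 1 else 0) else 0) else 0 := by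
      intro c c'
      unfold cylinder
      rw [Matrix.mul_diagonal]
      simp only [pauliX, Matrix.of_apply]
      by_cases hb : (fun i : A => b i) = c'
      · have hb' : ∀ i ∈ A, b i = ext c' i := by
          intro i hi; simp [hext, hi, ← hb]
        have hiff : a = b + (ext c + ext c') ↔
            (fun i : A => a i) = c ∧ ∀ i, i ∉ A → a i = b i := by
          constructor
          · rintro rfl
            refine ⟨?_, ?_⟩
            · funext i
              have h1 := hb' i i.2
              have h2 : ext c i = c i := by simp [hext]
              simp only [Pi.add_apply]
              rw [← h1, h2, add_comm (c i), ← add_assoc, CharTwo.add_self_eq_zero, zero_add]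
            · intro i hi; simp [hext, hi]
          · rintro ⟨h1, h2⟩
            funext i
            simp only [Pi.add_apply]
            by_cases hi : i ∈ A
            · have h3 : ext c i = a i := by simp [hext, hi, ← h1]
              rw [← hb' i hi, h3, add_comm (a i), ← add_assoc, CharTwo.add_self_eq_zero, zero_add]
            · rw [h2 i hi]; simp [hext, hi]
        rw [if_pos hb', mul_one]
        simp only [hb, if_true]
        by_cases h1 : (fun i : A => a i) = c <;> by_cases h2 : ∀ i, i ∉ A → a i = b i <;>
          simp [hiff, h1, h2]
      · have hb' : ¬ ∀ i ∈ A, b i = ext c' i := by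
          intro h1
          refine hb ?_
          funext i
          rw [h1 i i.2]; simp [hext]
        rw [if_neg hb', mul_zero]
        simp [hb]
    simp only [hE, mul_ite, mul_one, mul_zero]
    rw [Finset.sum_eq_single (fun i : A => a i)]
    · simp
    · intro c _ hc
      simp [hc.symm]
    · simp
  rw [hO]
  refine Submodule.sum_mem _ fun c _ => Submodule.sum_mem _ fun c' _ => Submodule.smul_mem _ _ ?_
  refine mul_mem_pauliSpan ?_ (cylinder_mem_pauliSpan _ _)
  rw [pauliX_eq_pauli]
  exact pauli_mem_pauliSpan ((supp_add_subset _ _).trans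
    (Finset.union_subset (hsupp c) (hsupp c'))) (by simp [supp_zero])

theorem actsOn_pauli {A : Finset (Fin n)} {a b : Fin n → ZMod 2} (ha : supp a ⊆ A)
    (hb : supp b ⊆ A) : ActsOn A (pauli a b) := by
  classical
  refine ⟨fun c c' => if c = c' + (fun i : A => a i) then
    csgn (∑ i : A, b i * c' i) else 0, fun r s => ?_⟩
  have h1 : dotProduct b s = ∑ i : A, b i * s i := by
    rw [Finset.sum_coe_sort A fun i => b i * s i]
    refine (Finset.sum_subset (Finset.subset_univ A) fun i _ hi => ?_).symm
    have : b i = 0 := by by_contra h; exact hi (hb (mem_supp.2 h))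
    rw [this, zero_mul]
  have ha0 : ∀ i, i ∉ A → a i = 0 := fun i hi => by
    by_contra h; exact hi (ha (mem_supp.2 h))
  have h2 : r = s + a ↔ (∀ i, i ∉ A → r i = s i) ∧
      (fun i : A => r i) = (fun i : A => s i) + fun i : A => a i := by
    constructor
    · rintro rfl
      exact ⟨fun i hi => by simp [ha0 i hi], rfl⟩
    · rintro ⟨h3, h4⟩
      funext i
      by_cases hi : i ∈ A
      · exact congrFun h4 ⟨i, hi⟩
      · rw [h3 i hi]; simp [ha0 i hi]
  unfold pauli pauliZ
  rw [Matrix.mul_diagonal]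
  simp only [pauliX, Matrix.of_apply]
  rw [← h1]
  by_cases h3 : ∀ i, i ∉ A → r i = s i
  · rw [if_pos h3]
    by_cases h4 : (fun i : A => r i) = (fun i : A => s i) + fun i : A => a i
    · rw [if_pos (h2.2 ⟨h3, h4⟩), if_pos h4, one_mul]; rfl
    · rw [if_neg fun h => h4 (h2.1 h).2, if_neg h4, zero_mul]
  · rw [if_neg h3, if_neg fun h => h3 (h2.1 h).1, zero_mul]

/-! ### Light cones -/

/-- Conjugation by one layer enlarges supports by at most a constant factor: a gate contributes
only if it meets the support `A`, and it then uses up a point of `A` of its own. The set `T` collects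
these points. -/
theorem conj_list_mem_pauliSpan {K : ℕ} {A : Finset (Fin n)} {O : Op n} (hO : O ∈ pauliSpan A)
    (L : List (Finset (Fin n) × Op n)) (hdisj : L.Pairwise fun p q => Disjoint p.1 q.1)
    (hL : ∀ p ∈ L, p.1.card ≤ K ∧ p.2 ∈ Matrix.unitaryGroup (Fin n → ZMod 2) ℂ ∧
      p.2 ∈ pauliSpan p.1) :
    ∃ A' T : Finset (Fin n), T ⊆ A ∧ (∀ i ∈ T, ∃ p ∈ L, i ∈ p.1) ∧ A ⊆ A' ∧
      (∀ i ∈ A', i ∈ A ∨ ∃ p ∈ L, i ∈ p.1) ∧ A'.card ≤ (A \ T).card + K * T.card ∧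
      (L.map Prod.snd).prod * O * (L.map Prod.snd).prod.conjTranspose ∈ pauliSpan A' := by
  induction L with
  | nil => exact ⟨A, ∅, by simp, by simp, by simp, by simp, by simp, by simpa using hO⟩
  | cons p L ih =>
    rw [List.pairwise_cons] at hdisj
    obtain ⟨A', T, hTA, hTL, hAA', hA'L, hcard, hmem⟩ := ih hdisj.2 fun q hq =>
      hL q (List.mem_cons_of_mem _ hq)
    obtain ⟨hpK, hpU, hpm⟩ := hL p List.mem_cons_self
    set X := (L.map Prod.snd).prod * O * (L.map Prod.snd).prod.conjTranspose with hX
    have hprod : ((p :: L).map Prod.snd).prod * O * ((p :: L).map Prod.snd).prod.conjTranspose =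
        p.2 * X * p.2.conjTranspose := by
      rw [List.map_cons, List.prod_cons, Matrix.conjTranspose_mul, hX]
      simp only [Matrix.mul_assoc]
    rw [hprod]
    by_cases hpA : Disjoint p.1 A
    · have hpA' : Disjoint p.1 A' := by
        refine Finset.disjoint_left.2 fun i hi hiA' => ?_
        rcases hA'L i hiA' with h | ⟨q, hq, hiq⟩
        · exact Finset.disjoint_left.1 hpA hi h
        · exact Finset.disjoint_left.1 (hdisj.1 q hq) hi hiq
      refine ⟨A', T, hTA, fun i hi => ?_, hAA', fun i hi => ?_, hcard, ?_⟩
      · obtain ⟨q, hq, hiq⟩ := hTL i hi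
        exact ⟨q, List.mem_cons_of_mem _ hq, hiq⟩
      · rcases hA'L i hi with h | ⟨q, hq, hiq⟩
        · exact Or.inl h
        · exact Or.inr ⟨q, List.mem_cons_of_mem _ hq, hiq⟩
      · have hu : p.2 * p.2.conjTranspose = 1 := Matrix.mem_unitaryGroup_iff.1 hpU
        rw [commute_of_disjoint hpA' hpm hmem, Matrix.mul_assoc, hu, mul_one]
        exact hmem
    · obtain ⟨i, hip, hiA⟩ := Finset.not_disjoint_iff.1 hpA
      have hiT : i ∉ T := by
        intro hi
        obtain ⟨q, hq, hiq⟩ := hTL i hi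
        exact Finset.disjoint_left.1 (hdisj.1 q hq) hip hiq
      refine ⟨A' ∪ p.1, insert i T, ?_, ?_, hAA'.trans Finset.subset_union_left, ?_, ?_, ?_⟩
      · exact Finset.insert_subset hiA hTA
      · intro j hj
        rcases Finset.mem_insert.1 hj with rfl | hj
        · exact ⟨p, List.mem_cons_self, hip⟩
        · obtain ⟨q, hq, hiq⟩ := hTL j hj
          exact ⟨q, List.mem_cons_of_mem _ hq, hiq⟩
      · intro j hj
        rcases Finset.mem_union.1 hj with hj | hj
        · rcases hA'L j hj with h | ⟨q, hq, hiq⟩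
          · exact Or.inl h
          · exact Or.inr ⟨q, List.mem_cons_of_mem _ hq, hiq⟩
        · exact Or.inr ⟨p, List.mem_cons_self, hj⟩
      · have h1 : A' ∪ p.1 ⊆ A' ∪ p.1.erase i := by
          intro j hj
          by_cases hji : j = i
          · exact Finset.mem_union_left _ (hji ▸ hAA' hiA)
          · rcases Finset.mem_union.1 hj with hj | hj
            · exact Finset.mem_union_left _ hj
            · exact Finset.mem_union_right _ (Finset.mem_erase.2 ⟨hji, hj⟩)
        have h2 := (Finset.card_le_card h1).trans (Finset.card_union_le _ _)
        rw [Finset.card_erase_of_mem hip] at h2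
        have h3 : (insert i T).card = T.card + 1 := Finset.card_insert_of_notMem hiT
        have h4 : (A \ insert i T).card + 1 = (A \ T).card := by
          rw [Finset.sdiff_insert, Finset.card_erase_of_mem (Finset.mem_sdiff.2 ⟨hiA, hiT⟩)]
          have : 0 < (A \ T).card := Finset.card_pos.2 ⟨i, Finset.mem_sdiff.2 ⟨hiA, hiT⟩⟩
          lia
        have h5 : 0 < p.1.card := Finset.card_pos.2 ⟨i, hip⟩
        rw [h3, Nat.mul_add]
        lia
      · have hp' := pauliSpan_mono (Finset.subset_union_right (s₁ := A')) hpm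
        exact mul_mem_pauliSpan (mul_mem_pauliSpan hp'
          (pauliSpan_mono Finset.subset_union_left hmem)) (conjTranspose_mem_pauliSpan hp')

theorem IsLayer.conj_mem_pauliSpan {K : ℕ} {U : Op n} (hU : IsLayer K U) {A : Finset (Fin n)}
    {O : Op n} (hO : O ∈ pauliSpan A) :
    ∃ A' : Finset (Fin n), A'.card ≤ (K + 1) * A.card ∧ U * O * U.conjTranspose ∈ pauliSpan A' := by
  obtain ⟨m, B, g, hB, hg, rfl⟩ := hU
  have hmap : (List.ofFn fun i => (B i, g i)).map Prod.snd = List.ofFn g := by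
    rw [List.map_ofFn]; rfl
  obtain ⟨A', T, hTA, -, -, -, hcard, hmem⟩ := conj_list_mem_pauliSpan (K := K) hO
    (List.ofFn fun i => (B i, g i))
    (by rw [List.pairwise_ofFn]; exact fun i j hij => hB i j hij.ne)
    (by
      intro p hp
      obtain ⟨i, rfl⟩ := (List.mem_ofFn' _ _).1 hp
      exact ⟨(hg i).1, (hg i).2.1, (hg i).2.2.mem_pauliSpan⟩)
  rw [hmap] at hmem
  refine ⟨A', hcard.trans ?_, hmem⟩
  have h1 : (A \ T).card ≤ A.card := Finset.card_le_card Finset.sdiff_subset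
  have h2 := Nat.mul_le_mul_left K (Finset.card_le_card hTA)
  rw [Nat.add_mul]
  lia

theorem IsLayer.mem_unitaryGroup {K : ℕ} {U : Op n} (hU : IsLayer K U) :
    U ∈ Matrix.unitaryGroup (Fin n → ZMod 2) ℂ := by
  obtain ⟨m, B, g, hB, hg, rfl⟩ := hU
  refine list_prod_mem fun x hx => ?_
  obtain ⟨i, rfl⟩ := (List.mem_ofFn' _ _).1 hx
  exact (hg i).2.1

theorem IsCircuit.mem_unitaryGroup {K D : ℕ} {U : Op n} (hU : IsCircuit K D U) :
    U ∈ Matrix.unitaryGroup (Fin n → ZMod 2) ℂ := by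
  obtain ⟨L, -, hL, rfl⟩ := hU
  exact list_prod_mem fun V hV => (hL V hV).mem_unitaryGroup

/-- Light cones: a depth-`D` circuit enlarges supports at most by the factor `(K + 1) ^ D`. -/
theorem IsCircuit.conj_mem_pauliSpan {K D : ℕ} {U : Op n} (hU : IsCircuit K D U)
    {A : Finset (Fin n)} {O : Op n} (hO : O ∈ pauliSpan A) :
    ∃ A' : Finset (Fin n), A'.card ≤ (K + 1) ^ D * A.card ∧
      U * O * U.conjTranspose ∈ pauliSpan A' := by
  obtain ⟨L, rfl, hL, rfl⟩ := hU
  induction L with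
  | nil => exact ⟨A, by simp, by simpa using hO⟩
  | cons V L ih =>
    obtain ⟨A', hA', hmem⟩ := ih fun V hV => hL V (List.mem_cons_of_mem _ hV)
    obtain ⟨A'', hA'', hmem'⟩ := (hL V List.mem_cons_self).conj_mem_pauliSpan hmem
    refine ⟨A'', hA''.trans ?_, ?_⟩
    · rw [List.length_cons, pow_succ', Nat.mul_assoc]
      exact Nat.mul_le_mul_left _ hA'
    · rw [List.prod_cons, Matrix.conjTranspose_mul]
      simpa only [Matrix.mul_assoc] using hmem'

end Pauli

/-! ### The code space -/

section Code

variable {n : ℕ}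

theorem IsSector.of_code_X (C : CSSCode n) : IsSector C.HX C.HZ C.interactionGraph where
  mulVec_stab := by
    rintro _ ⟨a, rfl⟩
    have h := congrArg Matrix.transpose C.comm
    rw [Matrix.transpose_mul, Matrix.transpose_transpose, Matrix.transpose_zero] at h
    rw [Matrix.mulVecLin_apply, Matrix.mulVec_mulVec, h, Matrix.zero_mulVec]
  adj c _ _ hij hi hj := ⟨hij, Or.inr ⟨c, hi, hj⟩⟩

theorem IsSector.of_code_Z (C : CSSCode n) : IsSector C.HZ C.HX C.interactionGraph where
  mulVec_stab := by
    rintro _ ⟨a, rfl⟩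
    rw [Matrix.mulVecLin_apply, Matrix.mulVec_mulVec, C.comm, Matrix.zero_mulVec]
  adj c _ _ hij hi hj := ⟨hij, Or.inl ⟨c, hi, hj⟩⟩

theorem degreeLE_interactionGraph (C : CSSCode n) {wc wb : ℕ} (hX : BoundedDegrees wc wb C.HX)
    (hZ : BoundedDegrees wc wb C.HZ) : DegreeLE C.interactionGraph (2 * (wb * wc)) := by
  intro i
  refine ⟨((supp fun c => C.HX c i).biUnion fun c => supp (C.HX c)) ∪
    (supp fun c => C.HZ c i).biUnion fun c => supp (C.HZ c), ?_, ?_⟩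
  · refine (Finset.card_union_le _ _).trans ?_
    have h1 := Finset.card_biUnion_le_card_mul (supp fun c => C.HX c i)
      (fun c => supp (C.HX c)) wc fun c _ => hX.1 c
    have h2 := Finset.card_biUnion_le_card_mul (supp fun c => C.HZ c i)
      (fun c => supp (C.HZ c)) wc fun c _ => hZ.1 c
    have h3 := Nat.mul_le_mul_right wc (hX.2 i)
    have h4 := Nat.mul_le_mul_right wc (hZ.2 i)
    rw [hammingNorm_eq_card_supp] at h3 h4
    lia
  · rintro j ⟨-, ⟨c, h1, h2⟩ | ⟨c, h1, h2⟩⟩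
    · exact Finset.mem_union_left _ (Finset.mem_biUnion.2 ⟨c, mem_supp.2 h1, mem_supp.2 h2⟩)
    · exact Finset.mem_union_right _ (Finset.mem_biUnion.2 ⟨c, mem_supp.2 h1, mem_supp.2 h2⟩)

theorem stab_induction {m : ℕ} {H : Matrix (Fin m) (Fin n) (ZMod 2)} {P : (Fin n → ZMod 2) → Prop}
    (h0 : P 0) (hadd : ∀ x y, P x → P y → P (x + y)) (hrow : ∀ i, P (H i))
    {s : Fin n → ZMod 2} (hs : s ∈ stab H) : P s := by
  obtain ⟨a, rfl⟩ := hs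
  rw [Matrix.mulVecLin_apply, Matrix.mulVec_transpose, Matrix.vecMul_eq_sum]
  refine Finset.sum_induction _ P hadd h0 fun i _ => ?_
  have key : ∀ c : ZMod 2, c = 0 ∨ c = 1 := by decide
  rcases key (a i) with h | h
  · rw [h, zero_smul]; exact h0
  · rw [h, one_smul]; exact hrow i

theorem act_pauliX_of_mem_stab {C : CSSCode n} {ψ : QState n} (hψ : ψ ∈ C.codeSpace)
    {s : Fin n → ZMod 2} (hs : s ∈ stab C.HX) : act (pauli s 0) ψ = ψ := by
  refine stab_induction (P := fun s => act (pauli s 0) ψ = ψ) ?_ ?_ ?_ hs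
  · rw [pauli_zero, act_one]
  · intro x y hx hy
    have : pauli (x + y) (0 : Fin n → ZMod 2) = pauli x 0 * pauli y 0 := by
      rw [pauli_mul]; simp
    rw [this, act_mul, hy, hx]
  · intro i; rw [← pauliX_eq_pauli]; exact hψ.1 i

theorem act_pauliZ_of_mem_stab {C : CSSCode n} {ψ : QState n} (hψ : ψ ∈ C.codeSpace)
    {s : Fin n → ZMod 2} (hs : s ∈ stab C.HZ) : act (pauli 0 s) ψ = ψ := by
  refine stab_induction (P := fun s => act (pauli 0 s) ψ = ψ) ?_ ?_ ?_ hs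
  · rw [pauli_zero, act_one]
  · intro x y hx hy
    have : pauli (0 : Fin n → ZMod 2) (x + y) = pauli 0 x * pauli 0 y := by
      rw [pauli_mul]; simp
    rw [this, act_mul, hy, hx]
  · intro i; rw [← pauliZ_eq_pauli]; exact hψ.2 i

theorem pauli_eq_mul (x z : Fin n → ZMod 2) : pauli x z = pauli x 0 * pauli 0 z := by
  rw [pauli_mul]; simp

theorem act_pauli_of_mem_stab {C : CSSCode n} {ψ : QState n} (hψ : ψ ∈ C.codeSpace)
    {s t : Fin n → ZMod 2} (hs : s ∈ stab C.HX) (ht : t ∈ stab C.HZ) : act (pauli s t) ψ = ψ := by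
  rw [pauli_eq_mul, act_mul, act_pauliZ_of_mem_stab hψ ht, act_pauliX_of_mem_stab hψ hs]

/-- Errors differing by stabilizers act on the code space in the same way up to a sign. -/
theorem act_pauli_congr {C : CSSCode n} {ψ : QState n} (hψ : ψ ∈ C.codeSpace)
    {x x' z z' : Fin n → ZMod 2} (hx : x + x' ∈ stab C.HX) (hz : z + z' ∈ stab C.HZ) :
    act (pauli x z) ψ = csgn (dotProduct z' (x' + x)) • act (pauli x' z') ψ := by
  have h1 : pauli x' z' * pauli (x' + x) (z' + z) =
      csgn (dotProduct z' (x' + x)) • pauli x z := by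
    rw [pauli_mul, add_add_cancel_vec, add_add_cancel_vec]
  have h2 : act (pauli x' z') ψ = csgn (dotProduct z' (x' + x)) • act (pauli x z) ψ := by
    conv_lhs => rw [← act_pauli_of_mem_stab hψ (mem_stab_symm hx) (mem_stab_symm hz)]
    rw [← act_mul, h1, act_smul_op]
  rw [h2, smul_smul, csgn_mul_self, one_smul]

theorem pauli_comm (a b x z : Fin n → ZMod 2) :
    pauli a b * pauli x z = csgn (dotProduct b x + dotProduct z a) • (pauli x z * pauli a b) := by
  rw [pauli_mul, pauli_mul, smul_smul, csgn_add, mul_assoc, csgn_mul_self, mul_one, add_comm a,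
    add_comm b]

/-- Errors anticommute with exactly the checks in their syndrome. -/
theorem act_checkX {C : CSSCode n} {ψ : QState n} (hψ : ψ ∈ C.codeSpace) (x z : Fin n → ZMod 2)
    (i : Fin C.mX) : act (pauliX (C.HX i)) (act (pauli x z) ψ) =
      csgn (C.HX.mulVec z i) • act (pauli x z) ψ := by
  rw [pauliX_eq_pauli, ← act_mul, pauli_comm, act_smul_op, act_mul, ← pauliX_eq_pauli, hψ.1 i,
    zero_dotProduct, zero_add, dotProduct_comm]
  rfl

theorem act_checkZ {C : CSSCode n} {ψ : QState n} (hψ : ψ ∈ C.codeSpace) (x z : Fin n → ZMod 2)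
    (i : Fin C.mZ) : act (pauliZ (C.HZ i)) (act (pauli x z) ψ) =
      csgn (C.HZ.mulVec x i) • act (pauli x z) ψ := by
  rw [pauliZ_eq_pauli, ← act_mul, pauli_comm, act_smul_op, act_mul, ← pauliZ_eq_pauli, hψ.2 i,
    dotProduct_zero, add_zero]
  rfl

theorem sum_half_one_sub_csgn {m : ℕ} (v : Fin m → ZMod 2) :
    ∑ i, (2⁻¹ : ℂ) * (1 - csgn (v i)) = hammingNorm v := by
  rw [hammingNorm, Finset.card_filter]
  push_cast
  refine Finset.sum_congr rfl fun i _ => ?_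
  unfold csgn
  by_cases h : v i = 0 <;> simp [h]; norm_num

theorem act_hamiltonian {C : CSSCode n} {ψ : QState n} (hψ : ψ ∈ C.codeSpace)
    (x z : Fin n → ZMod 2) :
    act C.hamiltonian (act (pauli x z) ψ) = (C.energy (x, z) : ℂ) • act (pauli x z) ψ := by
  rw [CSSCode.hamiltonian, act_add_op, act_sum_op, act_sum_op]
  simp only [act_smul_op, act_sub_op, act_one, act_checkX hψ, act_checkZ hψ]
  have h : ∀ {m : ℕ} (v : Fin m → ZMod 2) (φ : QState n),
      ∑ i, (2⁻¹ : ℂ) • (φ - csgn (v i) • φ) = (hammingNorm v : ℂ) • φ := by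
    intro m v φ
    rw [← sum_half_one_sub_csgn, Finset.sum_smul]
    refine Finset.sum_congr rfl fun i _ => ?_
    module
  rw [h, h, ← add_smul, CSSCode.energy]
  push_cast
  rw [add_comm]

/-- A detected error maps the code space to an orthogonal space: a violated check acts by `1` on the
left and by `-1` on the right. -/
theorem inner_act_pauli_eq_zero {C : CSSCode n} {ψ₁ ψ₂ : QState n} (h₁ : ψ₁ ∈ C.codeSpace)
    (h₂ : ψ₂ ∈ C.codeSpace) {u v : Fin n → ZMod 2} (h : C.HZ.mulVec u ≠ 0 ∨ C.HX.mulVec v ≠ 0) :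
    inner ℂ ψ₁ (act (pauli u v) ψ₂) = 0 := by
  have key : ∀ c : ℂ, c = -c → c = 0 := fun c hc => by linear_combination hc / 2
  rcases h with h | h
  · obtain ⟨i, hi⟩ := Function.ne_iff.1 h
    refine key _ ?_
    have hS : (pauliZ (C.HZ i)).conjTranspose = pauliZ (C.HZ i) := by
      rw [pauliZ_eq_pauli, pauli_conjTranspose]; simp
    conv_lhs => rw [← h₁.2 i, inner_act_left, hS, act_checkZ h₂, csgn_eq_neg_one hi]
    rw [neg_one_smul, inner_neg_right]
  · obtain ⟨i, hi⟩ := Function.ne_iff.1 h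
    refine key _ ?_
    have hS : (pauliX (C.HX i)).conjTranspose = pauliX (C.HX i) := by
      rw [pauliX_eq_pauli, pauli_conjTranspose]; simp
    conv_lhs => rw [← h₁.1 i, inner_act_left, hS, act_checkX h₂, csgn_eq_neg_one hi]
    rw [neg_one_smul, inner_neg_right]

/-- Operators whose compression to the code space is a multiple of the identity
(the Knill–Laflamme condition). -/
def scalarOn (C : CSSCode n) : Submodule ℂ (Op n) where
  carrier := {A | ∃ c : ℂ, ∀ ψ₁ ∈ C.codeSpace, ∀ ψ₂ ∈ C.codeSpace,
    inner ℂ ψ₁ (act A ψ₂) = c * inner ℂ ψ₁ ψ₂}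
  add_mem' := by
    rintro A B ⟨c, hc⟩ ⟨d, hd⟩
    refine ⟨c + d, fun ψ₁ h₁ ψ₂ h₂ => ?_⟩
    rw [act_add_op, inner_add_right, hc ψ₁ h₁ ψ₂ h₂, hd ψ₁ h₁ ψ₂ h₂, add_mul]
  zero_mem' := ⟨0, fun ψ₁ _ ψ₂ _ => by simp [act]⟩
  smul_mem' := by
    rintro a A ⟨c, hc⟩
    refine ⟨a * c, fun ψ₁ h₁ ψ₂ h₂ => ?_⟩
    rw [act_smul_op, inner_smul_right, hc ψ₁ h₁ ψ₂ h₂, mul_assoc]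

theorem pauli_mem_scalarOn (C : CSSCode n) {u v : Fin n → ZMod 2}
    (hu : C.HZ.mulVec u = 0 → u ∈ stab C.HX) (hv : C.HX.mulVec v = 0 → v ∈ stab C.HZ) :
    pauli u v ∈ scalarOn C := by
  by_cases h : C.HZ.mulVec u = 0 ∧ C.HX.mulVec v = 0
  · refine ⟨1, fun ψ₁ _ ψ₂ h₂ => ?_⟩
    rw [act_pauli_of_mem_stab h₂ (hu h.1) (hv h.2), one_mul]
  · refine ⟨0, fun ψ₁ h₁ ψ₂ h₂ => ?_⟩
    rw [zero_mul]
    exact inner_act_pauli_eq_zero h₁ h₂ (by tauto)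

/-- The error operators `X^{x₀+x} Z^{z₀+z}`, with `p = (x₀, z₀)`, that generate a component from the
code space. -/
def goodOps (C : CSSCode n) (e : ℝ) (p : (Fin n → ZMod 2) × (Fin n → ZMod 2)) : Set (Op n) :=
  {P | ∃ x z, Good C.HX C.interactionGraph e x ∧ Good C.HZ C.interactionGraph e z ∧
    P = pauli (p.1 + x) (p.2 + z)}

/-- Applying operators to a fixed state. -/
def applyTo (ψ : QState n) : Op n →ₗ[ℂ] QState n where
  toFun A := act A ψ
  map_add' A B := act_add_op A B ψ
  map_smul' c A := act_smul_op c A ψ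

@[simp] theorem applyTo_apply (ψ : QState n) (A : Op n) : applyTo ψ A = act A ψ := rfl

theorem component_eq_span (C : CSSCode n) {d : ℝ} (hd : 0 ≤ d) (ψ : QState n)
    (p : (Fin n → ZMod 2) × (Fin n → ZMod 2)) :
    C.component d ψ p = Submodule.span ℂ (applyTo ψ '' goodOps C (d / 2) p) := by
  have hd2 : 0 ≤ d / 2 := by positivity
  unfold CSSCode.component
  congr 1
  ext φ
  constructor
  · rintro ⟨x, z, hx, hz, rfl⟩
    exact ⟨_, ⟨x, z, (smallHalfClusters_iff hd2).2 hx, (smallHalfClusters_iff hd2).2 hz, rfl⟩, rfl⟩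
  · rintro ⟨_, ⟨x, z, hx, hz, rfl⟩, rfl⟩
    exact ⟨x, z, (smallHalfClusters_iff hd2).1 hx, (smallHalfClusters_iff hd2).1 hz, rfl⟩

/-- The standing assumptions on one code: confinement in both sectors at scale `e` and
bit degrees at most `w`. -/
structure IsConfinedCode (C : CSSCode n) (e γ : ℝ) (w : ℕ) : Prop where
  e_nonneg : 0 ≤ e
  gamma_pos : 0 < γ
  confX : Confined C.HX C.HZ e γ
  confZ : Confined C.HZ C.HX e γ
  degX : ∀ j, hammingNorm (fun i => C.HX i j) ≤ w
  degZ : ∀ j, hammingNorm (fun i => C.HZ i j) ≤ w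

/-- Local indistinguishability: local operators compressed by error operators of a component
satisfy the Knill–Laflamme condition on the code space. -/
theorem IsConfinedCode.mem_scalarOn {C : CSSCode n} {e γ : ℝ} {w : ℕ}
    (h : IsConfinedCode C e γ w) {p : (Fin n → ZMod 2) × (Fin n → ZMod 2)}
    {M M' O : Op n} (hM : M ∈ Submodule.span ℂ (goodOps C e p))
    (hM' : M' ∈ Submodule.span ℂ (goodOps C e p)) {A : Finset (Fin n)} (hO : O ∈ pauliSpan A)
    (hA : (w / γ + 1) * (A.card : ℝ) ≤ e) :
    M'.conjTranspose * O * M ∈ scalarOn C := by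
  have hA' : ∀ a : Fin n → ZMod 2, supp a ⊆ A → (w / γ + 1) * (hammingNorm a : ℝ) ≤ e := by
    intro a ha
    refine le_trans (mul_le_mul_of_nonneg_left ?_ ?_) hA
    · rw [Nat.cast_le]; exact Finset.card_le_card ha
    · have := h.gamma_pos; positivity
  induction hM' using Submodule.span_induction with
  | mem M' hM' =>
    obtain ⟨x', z', hx', hz', rfl⟩ := hM'
    induction hM using Submodule.span_induction with
    | mem M hM =>
      obtain ⟨x, z, hx, hz, rfl⟩ := hM
      induction hO using Submodule.span_induction with
      | mem O hO =>
        obtain ⟨a, b, ha, hb, rfl⟩ := hO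
        rw [pauli_conjTranspose, smul_mul_assoc, pauli_mul, smul_mul_assoc, smul_mul_assoc,
          pauli_mul]
        refine Submodule.smul_mem _ _ (Submodule.smul_mem _ _ (Submodule.smul_mem _ _ ?_))
        have e1 : ∀ q x' a x : Fin n → ZMod 2, q + x' + a + (q + x) = x' + x + a := by
          intro q x' a x
          calc _ = (q + q) + (x' + x + a) := by abel
            _ = _ := by rw [add_self_vec, zero_add]
        rw [e1, e1]
        exact pauli_mem_scalarOn C
          ((IsSector.of_code_X C).mem_stab_of_local h.confX h.e_nonneg h.gamma_pos h.degZ hx' hx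
            (hA' a ha))
          ((IsSector.of_code_Z C).mem_stab_of_local h.confZ h.e_nonneg h.gamma_pos h.degX hz' hz
            (hA' b hb))
      | zero => rw [mul_zero, zero_mul]; exact Submodule.zero_mem _
      | add O O' _ _ h h' => rw [mul_add, add_mul]; exact Submodule.add_mem _ h h'
      | smul c O _ h => rw [mul_smul_comm, smul_mul_assoc]; exact Submodule.smul_mem _ _ h
    | zero => rw [mul_zero]; exact Submodule.zero_mem _
    | add Q Q' _ _ h h' => rw [mul_add]; exact Submodule.add_mem _ h h'
    | smul c Q _ h => rw [mul_smul_comm]; exact Submodule.smul_mem _ _ h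
  | zero => rw [Matrix.conjTranspose_zero, zero_mul, zero_mul]; exact Submodule.zero_mem _
  | add P P' _ _ h h' =>
    rw [Matrix.conjTranspose_add, add_mul, add_mul]; exact Submodule.add_mem _ h h'
  | smul c P _ h =>
    rw [Matrix.conjTranspose_smul, smul_mul_assoc, smul_mul_assoc]
    exact Submodule.smul_mem _ _ h

/-- The code space as a subspace. -/
def codeSubmodule (C : CSSCode n) : Submodule ℂ (QState n) where
  carrier := C.codeSpace
  add_mem' := by
    rintro ψ φ hψ hφ
    exact ⟨fun i => by rw [act_add, hψ.1, hφ.1], fun i => by rw [act_add, hψ.2, hφ.2]⟩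
  zero_mem' := ⟨fun i => by simp [act], fun i => by simp [act]⟩
  smul_mem' := by
    rintro c ψ hψ
    exact ⟨fun i => by rw [act_smul, hψ.1], fun i => by rw [act_smul, hψ.2]⟩

open Classical in
/-- The unnormalized state `∑_{s ∈ Im H_Xᵀ} |v + s⟩`, a code state if `H_Z v = 0`. -/
def cosetState (C : CSSCode n) (v : Fin n → ZMod 2) : QState n :=
  WithLp.toLp 2 fun b => if b + v ∈ stab C.HX then 1 else 0

theorem row_mem_stab {m : ℕ} (H : Matrix (Fin m) (Fin n) (ZMod 2)) (i : Fin m) : H i ∈ stab H := by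
  refine ⟨Pi.single i 1, ?_⟩
  rw [Matrix.mulVecLin_apply, Matrix.mulVec_single_one]
  rfl

theorem cosetState_mem (C : CSSCode n) {v : Fin n → ZMod 2} (hv : C.HZ.mulVec v = 0) :
    cosetState C v ∈ codeSubmodule C := by
  refine ⟨fun i => ?_, fun i => ?_⟩
  · ext b
    rw [act_pauliX_apply]
    have : b + C.HX i + v ∈ stab C.HX ↔ b + v ∈ stab C.HX := by
      rw [add_right_comm]
      exact (stab C.HX).add_mem_iff_left (row_mem_stab C.HX i)
    simp only [cosetState]
    split_ifs with h1 h2 h2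
    · rfl
    · exact absurd (this.1 h1) h2
    · exact absurd (this.2 h2) h1
    · rfl
  · ext b
    rw [act_pauliZ_apply]
    by_cases hb : b + v ∈ stab C.HX
    · have h1 := mulVec_eq_of_add_mem (IsSector.of_code_X C) hb
      have h2 : dotProduct (C.HZ i) b = 0 := by
        have := congrFun (h1.trans hv) i
        exact this
      rw [h2]; simp
    · simp [cosetState, hb]

/-- A CSS code has at least `2 ^ k` independent code states: those attached to the classes of
`ker H_Z` modulo `Im H_Xᵀ`. -/
theorem two_pow_numLogical_le (C : CSSCode n) :
    2 ^ C.numLogical ≤ Module.finrank ℂ (codeSubmodule C) := by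
  classical
  set Kz := LinearMap.ker C.HZ.mulVecLin with hKz
  set I := (stab C.HX).comap Kz.subtype with hI
  have hle : stab C.HX ≤ Kz := by
    intro s hs
    rw [hKz, LinearMap.mem_ker, Matrix.mulVecLin_apply]
    exact (IsSector.of_code_X C).mulVec_stab s hs
  have h1 : Module.finrank (ZMod 2) I = C.HX.rank := by
    rw [hI, (Submodule.comapSubtypeEquivOfLe hle).finrank_eq, ← Matrix.rank_transpose]
    rfl
  have h2 : C.HZ.rank + Module.finrank (ZMod 2) Kz = n := by
    have := LinearMap.finrank_range_add_finrank_ker C.HZ.mulVecLin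
    rw [Module.finrank_fin_fun] at this
    exact this
  have h3 := Submodule.finrank_quotient_add_finrank I
  have h4 : Module.finrank (ZMod 2) (Kz ⧸ I) = C.numLogical := by
    unfold CSSCode.numLogical; lia
  have : Fintype (Kz ⧸ I) := Fintype.ofFinite _
  have h5 : Fintype.card (Kz ⧸ I) = 2 ^ C.numLogical := by
    rw [Module.card_eq_pow_finrank (K := ZMod 2), h4, ZMod.card]
  rw [← h5]
  set f : Kz ⧸ I → codeSubmodule C := fun q =>
    ⟨cosetState C (Quotient.out q : Kz), cosetState_mem C (Quotient.out q).2⟩ with hf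
  refine LinearIndependent.fintype_card_le_finrank (b := f) ?_
  rw [Fintype.linearIndependent_iff]
  intro g hg q
  have hval : ∑ q', g q' • cosetState C (Quotient.out q' : Kz) = 0 := by
    have := congrArg Subtype.val hg
    simpa [hf] using this
  have hq := congrArg (fun φ : QState n => φ ((Quotient.out q : Kz) : Fin n → ZMod 2)) hval
  have hdelta : ∀ q' : Kz ⧸ I, cosetState C (Quotient.out q' : Kz) ((Quotient.out q : Kz) : Fin n → ZMod 2) =
      if q' = q then 1 else 0 := by
    intro q'
    have : ((Quotient.out q : Kz) : Fin n → ZMod 2) + (Quotient.out q' : Kz) ∈ stab C.HX ↔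
        q' = q := by
      constructor
      · intro h
        have h6 : (Quotient.out q' : Kz) - (Quotient.out q : Kz) ∈ I := by
          change ((Quotient.out q' : Kz) : Fin n → ZMod 2) - (Quotient.out q : Kz) ∈ stab C.HX
          have : ((Quotient.out q' : Kz) : Fin n → ZMod 2) - (Quotient.out q : Kz) =
              ((Quotient.out q : Kz) : Fin n → ZMod 2) + (Quotient.out q' : Kz) := by
            rw [sub_eq_add_neg, add_comm]
            congr 1
            funext i
            exact CharTwo.neg_eq _
          rw [this]; exact h
        have h7 := (Submodule.Quotient.eq I).2 h6
        have h8 : ∀ r : Kz ⧸ I, Submodule.Quotient.mk (p := I) (Quotient.out r) = r :=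
          fun r => Quotient.out_eq r
        rwa [h8, h8] at h7
      · rintro rfl
        rw [add_self_vec]; exact (stab C.HX).zero_mem
    simp [cosetState, this]
  simp only [WithLp.ofLp_sum, Finset.sum_apply, WithLp.ofLp_smul, Pi.smul_apply, smul_eq_mul,
    hdelta, mul_ite, mul_one, mul_zero, Finset.sum_ite_eq', Finset.mem_univ, if_true] at hq
  simpa using hq

end Code

/-! ### Shallow states have small overlap with a component -/

section Overlap

variable {n : ℕ}

/-- A set function that starts at most at `1` and never drops below `p` is nearly stationary under
adding points at some set of bounded size: otherwise adding well-chosen points one by one would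
shrink it by a factor `1 - ε` each time. -/
theorem exists_stationary {f : Finset (Fin n) → ℝ} {p ε : ℝ} {s : ℕ} (h0 : f ∅ ≤ 1)
    (hp : ∀ S, p ≤ f S) (hε : ε ≤ 1) (hs : (1 - ε) ^ (s + 1) < p) :
    ∃ S : Finset (Fin n), S.card ≤ s ∧ ∀ i, f S - f (insert i S) ≤ ε * f S := by
  by_contra! hcon
  have key : ∀ k ≤ s + 1, ∃ S : Finset (Fin n), S.card ≤ k ∧ f S ≤ (1 - ε) ^ k := by
    intro k
    induction k with
    | zero => exact fun _ => ⟨∅, by simp, by simpa using h0⟩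
    | succ k ih =>
      intro hk
      obtain ⟨S, hS, hfS⟩ := ih (by lia)
      obtain ⟨i, hi⟩ := hcon S (by lia)
      refine ⟨insert i S, (Finset.card_insert_le _ _).trans (by lia), ?_⟩
      have := mul_le_mul_of_nonneg_left hfS (sub_nonneg.2 hε)
      rw [pow_succ']
      linarith
  obtain ⟨S, -, hS⟩ := key (s + 1) le_rfl
  linarith [hp S]

open Classical in
/-- The probability that a measurement in the computational basis finds `0` everywhere on `S`. -/
def zeroProb (ξ : QState n) (S : Finset (Fin n)) : ℝ :=
  ∑ b : Fin n → ZMod 2, if ∀ i ∈ S, b i = 0 then ‖ξ b‖ ^ 2 else 0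

theorem inner_cylinder (ξ : QState n) (S : Finset (Fin n)) :
    inner ℂ ξ (act (cylinder S 0) ξ) = (zeroProb ξ S : ℂ) := by
  classical
  rw [EuclideanSpace.inner_eq_star_dotProduct, act_apply, cylinder, zeroProb]
  unfold dotProduct
  push_cast
  refine Finset.sum_congr rfl fun b _ => ?_
  rw [Matrix.mulVec_diagonal]
  simp only [Pi.zero_apply, Pi.star_apply, RCLike.star_def]
  split_ifs
  · rw [one_mul, Complex.mul_conj, Complex.normSq_eq_norm_sq]
  · simp

theorem sum_zeroProb_sub (ξ : QState n) (S : Finset (Fin n)) :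
    ∑ i, (zeroProb ξ S - zeroProb ξ (insert i S)) =
      ∑ b : Fin n → ZMod 2, (if ∀ i ∈ S, b i = 0 then ‖ξ b‖ ^ 2 else 0) * hammingNorm b := by
  classical
  unfold zeroProb
  simp only [← Finset.sum_sub_distrib]
  rw [Finset.sum_comm]
  refine Finset.sum_congr rfl fun b _ => ?_
  rw [hammingNorm, Finset.card_filter]
  push_cast
  rw [Finset.mul_sum]
  refine Finset.sum_congr rfl fun i _ => ?_
  simp only [Finset.forall_mem_insert]
  by_cases h1 : ∀ j ∈ S, b j = 0 <;> by_cases h2 : b i = 0 <;> simp [h1, h2]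

open Classical in
/-- The bit strings of weight at most `t`. -/
def lightStrings (n : ℕ) (t : ℝ) : Finset (Fin n → ZMod 2) :=
  Finset.univ.filter fun b => (hammingNorm b : ℝ) ≤ t

/-- Markov's inequality: if, conditioned on finding `0` on `S`, each qubit is excited with probability
at most `ε`, then half of the conditional weight is on strings of weight at most `2 ε n`. -/
theorem half_zeroProb_le {ξ : QState n} {S : Finset (Fin n)} {ε : ℝ} (hε : 0 < ε) (hn : 0 < n)
    (h : ∀ i, zeroProb ξ S - zeroProb ξ (insert i S) ≤ ε * zeroProb ξ S) :
    zeroProb ξ S / 2 ≤ ∑ b ∈ lightStrings n (2 * ε * n), ‖ξ b‖ ^ 2 := by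
  classical
  have h1 : ∑ b : Fin n → ZMod 2, (if ∀ i ∈ S, b i = 0 then ‖ξ b‖ ^ 2 else 0) * hammingNorm b ≤
      n * (ε * zeroProb ξ S) := by
    rw [← sum_zeroProb_sub]
    refine (Finset.sum_le_sum fun i _ => h i).trans ?_
    simp
  have h2 : zeroProb ξ S * (2 * ε * n) ≤
      (∑ b ∈ lightStrings n (2 * ε * n), ‖ξ b‖ ^ 2) * (2 * ε * n) +
      ∑ b : Fin n → ZMod 2, (if ∀ i ∈ S, b i = 0 then ‖ξ b‖ ^ 2 else 0) * hammingNorm b := by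
    rw [lightStrings, Finset.sum_filter, zeroProb, Finset.sum_mul, Finset.sum_mul,
      ← Finset.sum_add_distrib]
    refine Finset.sum_le_sum fun b _ => ?_
    have hx : 0 ≤ ‖ξ b‖ ^ 2 := sq_nonneg _
    by_cases h3 : ∀ i ∈ S, b i = 0
    · rw [if_pos h3]
      split_ifs with h4
      · have := mul_nonneg hx (Nat.cast_nonneg (α := ℝ) (hammingNorm b))
        linarith
      · push Not at h4
        have := mul_le_mul_of_nonneg_left h4.le hx
        linarith
    · rw [if_neg h3, zero_mul, zero_mul, add_zero]
      split_ifs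
      · positivity
      · simp
  have hpos : 0 < 2 * ε * n := by positivity
  refine le_of_mul_le_mul_right ?_ hpos
  linarith

/-- A state of a component that overlaps with a shallow state forces the code space to be small:
after conditioning on few qubits of the shallow state being unexcited, all code states dressed in
the same way are nearly unexcited, so they fit into the span of few basis states. -/
theorem IsConfinedCode.finrank_mul_le {C : CSSCode n} {e γ : ℝ} {w : ℕ}
    (h : IsConfinedCode C e γ w) (hn : 0 < n) {p : (Fin n → ZMod 2) × (Fin n → ZMod 2)}
    {M : Op n} (hM : M ∈ Submodule.span ℂ (goodOps C e p)) {ψ : QState n} (hψ : ψ ∈ C.codeSpace)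
    (hψ1 : ‖ψ‖ = 1) (hφ1 : ‖act M ψ‖ = 1) {K D : ℕ} {U : Op n} (hU : IsCircuit K D U) {q ε : ℝ}
    (hq : q ≤ ‖inner ℂ (act U (EuclideanSpace.single (0 : Fin n → ZMod 2) (1 : ℂ))) (act M ψ)‖ ^ 2)
    (hε0 : 0 < ε) (hε1 : ε ≤ 1) {s : ℕ} (hs : (1 - ε) ^ (s + 1) < q)
    (he : (w / γ + 1) * ((K + 1) ^ D * (s + 1)) ≤ e) :
    Module.finrank ℂ (codeSubmodule C) * (q / 2) ≤ (lightStrings n (2 * ε * n)).card := by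
  classical
  set ξ : QState n → QState n := fun ψ' => act U.conjTranspose (act M ψ') with hξ
  have hUU : U * U.conjTranspose = 1 := Matrix.mem_unitaryGroup_iff.1 hU.mem_unitaryGroup
  have hγ := h.gamma_pos
  have hinner : ∀ (O : Op n) (ψ₁ ψ₂ : QState n), inner ℂ (ξ ψ₁) (act O (ξ ψ₂)) =
      inner ℂ ψ₁ (act (M.conjTranspose * (U * O * U.conjTranspose) * M) ψ₂) := by
    intro O ψ₁ ψ₂
    simp only [hξ]
    rw [inner_act_left, Matrix.conjTranspose_conjTranspose, inner_act_left]
    simp only [act_mul]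
  have horth : ∀ ψ₁ ∈ C.codeSpace, ∀ ψ₂ ∈ C.codeSpace,
      inner ℂ (ξ ψ₁) (ξ ψ₂) = inner ℂ ψ₁ ψ₂ := by
    obtain ⟨c, hc⟩ := h.mem_scalarOn hM hM (one_mem_pauliSpan ∅) (by simpa using h.e_nonneg)
    have e1 : ∀ ψ₁ ψ₂, inner ℂ (ξ ψ₁) (ξ ψ₂) =
        inner ℂ ψ₁ (act (M.conjTranspose * 1 * M) ψ₂) := by
      intro ψ₁ ψ₂
      have := hinner 1 ψ₁ ψ₂
      rwa [act_one, mul_one, hUU] at this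
    have hc1 : c = 1 := by
      have h1 := hc ψ hψ ψ hψ
      rw [mul_one, act_mul, ← inner_act_left, inner_self_eq_ofReal, inner_self_eq_ofReal, hφ1, hψ1]
        at h1
      simpa using h1.symm
    intro ψ₁ h₁ ψ₂ h₂
    rw [e1, hc ψ₁ h₁ ψ₂ h₂, hc1, one_mul]
  have hnorm : ∀ ψ' ∈ C.codeSpace, ‖ξ ψ'‖ = ‖ψ'‖ := by
    intro ψ' h'
    have := horth ψ' h' ψ' h'
    rw [inner_self_eq_ofReal, inner_self_eq_ofReal] at this
    have h2 : ‖ξ ψ'‖ ^ 2 = ‖ψ'‖ ^ 2 := by exact_mod_cast this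
    exact (sq_eq_sq₀ (norm_nonneg _) (norm_nonneg _)).1 h2
  -- `U` turns a measurement on few qubits into an operator on a light cone of bounded size, which
  -- does not distinguish the code states dressed by `M`
  have hind : ∀ S : Finset (Fin n), S.card ≤ s + 1 → ∀ ψ' ∈ C.codeSpace, ‖ψ'‖ = 1 →
      zeroProb (ξ ψ') S = zeroProb (ξ ψ) S := by
    intro S hS ψ' h' h1'
    obtain ⟨A, hA, hmem⟩ := hU.conj_mem_pauliSpan (cylinder_mem_pauliSpan S 0)
    have hAe : (w / γ + 1) * (A.card : ℝ) ≤ e := by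
      refine le_trans (mul_le_mul_of_nonneg_left ?_ (by positivity)) he
      have : A.card ≤ (K + 1) ^ D * (s + 1) := hA.trans (Nat.mul_le_mul_left _ hS)
      exact_mod_cast this
    obtain ⟨c, hc⟩ := h.mem_scalarOn hM hM hmem hAe
    have h1 := inner_cylinder (ξ ψ') S
    have h2 := inner_cylinder (ξ ψ) S
    rw [hinner, hc ψ' h' ψ' h', inner_self_eq_ofReal, h1'] at h1
    rw [hinner, hc ψ hψ ψ hψ, inner_self_eq_ofReal, hψ1] at h2
    exact_mod_cast h1.symm.trans h2
  have hzero : ∀ S, q ≤ zeroProb (ξ ψ) S := by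
    intro S
    have h1 : inner ℂ (act U (EuclideanSpace.single (0 : Fin n → ZMod 2) (1 : ℂ))) (act M ψ) =
        ξ ψ 0 := by
      rw [inner_act_left, EuclideanSpace.inner_single_left]
      simp [hξ]
    rw [h1] at hq
    refine hq.trans ?_
    have := Finset.single_le_sum (s := Finset.univ)
      (f := fun b : Fin n → ZMod 2 => if ∀ i ∈ S, b i = 0 then ‖ξ ψ b‖ ^ 2 else 0)
      (fun b _ => by split_ifs <;> positivity) (Finset.mem_univ 0)
    have h0 : ∀ i ∈ S, (0 : Fin n → ZMod 2) i = 0 := fun _ _ => rfl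
    rw [if_pos h0] at this
    refine this.trans (le_of_eq ?_)
    unfold zeroProb
    congr!
  have hone : zeroProb (ξ ψ) ∅ ≤ 1 := by
    have h1 : zeroProb (ξ ψ) ∅ = ‖ξ ψ‖ ^ 2 := by
      rw [EuclideanSpace.norm_sq_eq]; simp [zeroProb]
    rw [h1, hnorm ψ hψ, hψ1]; norm_num
  obtain ⟨S, hScard, hS⟩ := exists_stationary hone hzero hε1 hs
  -- all dressed code states are nearly unexcited given `S`; count them by comparing with the light
  -- basis states, on each of which an orthonormal family has total weight at most one
  set b := stdOrthonormalBasis ℂ (codeSubmodule C) with hb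
  have hbmem : ∀ j, (b j : QState n) ∈ C.codeSpace := fun j => (b j).2
  have hb1 : ∀ j, ‖(b j : QState n)‖ = 1 := fun j => b.orthonormal.1 j
  have hξorth : Orthonormal ℂ fun j => ξ (b j) := by
    constructor
    · intro j; rw [hnorm _ (hbmem j), hb1]
    · intro i j hij
      rw [horth _ (hbmem i) _ (hbmem j)]
      exact b.orthonormal.2 hij
  have hhalf : ∀ j, q / 2 ≤ ∑ c ∈ lightStrings n (2 * ε * n), ‖ξ (b j) c‖ ^ 2 := by
    intro j
    have e1 : zeroProb (ξ (b j)) S = zeroProb (ξ ψ) S :=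
      hind S (by lia) _ (hbmem j) (hb1 j)
    have h2 := half_zeroProb_le (ξ := ξ (b j)) (S := S) hε0 hn (fun i => by
      rw [e1, hind (insert i S) ((Finset.card_insert_le _ _).trans (by lia)) _ (hbmem j) (hb1 j)]
      exact hS i)
    rw [e1] at h2
    linarith [hzero S]
  calc (Module.finrank ℂ (codeSubmodule C) : ℝ) * (q / 2)
      = ∑ _j : Fin (Module.finrank ℂ (codeSubmodule C)), q / 2 := by simp
    _ ≤ ∑ j, ∑ c ∈ lightStrings n (2 * ε * n), ‖ξ (b j) c‖ ^ 2 := Finset.sum_le_sum fun j _ => hhalf j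
    _ = ∑ c ∈ lightStrings n (2 * ε * n), ∑ j, ‖ξ (b j) c‖ ^ 2 := Finset.sum_comm
    _ ≤ ∑ c ∈ lightStrings n (2 * ε * n), (1 : ℝ) := by
        refine Finset.sum_le_sum fun c _ => ?_
        have h1 := hξorth.sum_inner_products_le (EuclideanSpace.single c (1 : ℂ)) (s := Finset.univ)
        have h2 : ∀ j, ‖inner ℂ (ξ (b j)) (EuclideanSpace.single c (1 : ℂ))‖ = ‖ξ (b j) c‖ := by
          intro j
          rw [EuclideanSpace.inner_single_right]; simp
        simpa [h2] using h1
    _ = _ := by simp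

/-- The Chernoff bound on the number of light strings. -/
theorem card_lightStrings_le (n : ℕ) (t : ℝ) {a : ℝ} (ha : 0 ≤ a) :
    ((lightStrings n t).card : ℝ) ≤ Real.exp (a * t + n * Real.exp (-a)) := by
  classical
  have h1 : ∑ b : Fin n → ZMod 2, Real.exp (-a * hammingNorm b) = (1 + Real.exp (-a)) ^ n := by
    have h2 : ∀ b : Fin n → ZMod 2, Real.exp (-a * hammingNorm b) =
        ∏ i, if b i = 0 then 1 else Real.exp (-a) := by
      intro b
      rw [hammingNorm, mul_comm, Real.exp_nat_mul, ← Finset.prod_const, Finset.prod_filter]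
      refine Finset.prod_congr rfl fun i _ => ?_
      by_cases hi : b i = 0 <;> simp [hi]
    simp only [h2]
    have h3 := Finset.prod_univ_sum (fun _ : Fin n => (Finset.univ : Finset (ZMod 2)))
      (fun _ c => if c = 0 then 1 else Real.exp (-a))
    rw [Fintype.piFinset_univ] at h3
    rw [← h3, Finset.prod_const, Finset.card_univ, Fintype.card_fin]
    congr 1
    have : (Finset.univ : Finset (ZMod 2)) = {0, 1} := by decide
    rw [this, Finset.sum_pair (by decide)]
    simp
  have h4 : ((lightStrings n t).card : ℝ) * Real.exp (-(a * t)) ≤ (1 + Real.exp (-a)) ^ n := by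
    rw [← h1, ← nsmul_eq_mul, ← Finset.sum_const]
    refine (Finset.sum_le_sum (g := fun b => Real.exp (-a * hammingNorm b)) fun b hb => ?_).trans
      (Finset.sum_le_sum_of_subset_of_nonneg (Finset.subset_univ _) fun b _ _ =>
        (Real.exp_pos _).le)
    rw [Real.exp_le_exp]
    have := mul_le_mul_of_nonneg_left ((Finset.mem_filter.1 hb).2) ha
    linarith
  have h5 : (1 + Real.exp (-a)) ^ n ≤ Real.exp (n * Real.exp (-a)) := by
    rw [Real.exp_nat_mul]
    refine pow_le_pow_left₀ (by positivity) ?_ _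
    rw [add_comm]; exact Real.add_one_le_exp _
  have h6 := h4.trans h5
  rw [Real.exp_neg, ← div_eq_mul_inv, div_le_iff₀ (Real.exp_pos _), ← Real.exp_add] at h6
  rwa [add_comm (a * t)]

end Overlap

/-! ### The Gibbs state -/

section Gibbs

variable {n : ℕ}

theorem pauliX_isHermitian (x : Fin n → ZMod 2) : (pauliX x).IsHermitian := by
  rw [pauliX_eq_pauli, Matrix.IsHermitian, pauli_conjTranspose]; simp

theorem pauliZ_isHermitian (z : Fin n → ZMod 2) : (pauliZ z).IsHermitian := by
  rw [pauliZ_eq_pauli, Matrix.IsHermitian, pauli_conjTranspose]; simp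

theorem hamiltonian_isHermitian (C : CSSCode n) : C.hamiltonian.IsHermitian := by
  have h2 : IsSelfAdjoint (2⁻¹ : ℂ) := by
    rw [IsSelfAdjoint, RCLike.star_def, map_inv₀, Complex.conj_ofNat]
  refine Matrix.IsHermitian.add ?_ ?_
  · exact isSelfAdjoint_sum _ fun i _ =>
      (Matrix.isHermitian_one.sub (pauliX_isHermitian _)).smul h2
  · exact isSelfAdjoint_sum _ fun i _ =>
      (Matrix.isHermitian_one.sub (pauliZ_isHermitian _)).smul h2

/-- `exp A` is the square of the Hermitian and invertible operator `exp (A / 2)`. -/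
theorem posDef_exp {A : Op n} (hA : A.IsHermitian) : (NormedSpace.exp A).PosDef := by
  have h2 : IsSelfAdjoint (2⁻¹ : ℂ) := by
    rw [IsSelfAdjoint, RCLike.star_def, map_inv₀, Complex.conj_ofNat]
  set B := (2⁻¹ : ℂ) • A with hB
  have hBh : (NormedSpace.exp B).IsHermitian := (hA.smul h2).exp
  have hsum : A = B + B := by rw [hB, ← add_smul]; norm_num
  have h1 := (Matrix.PosDef.one (n := Fin n → ZMod 2) (R := ℂ)).conjTranspose_mul_mul_same
    (B := NormedSpace.exp B) (Matrix.mulVec_injective_of_isUnit (Matrix.isUnit_exp B))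
  rwa [hBh.eq, mul_one, ← Matrix.exp_add_of_commute _ _ (Commute.refl B), ← hsum] at h1

/-- The partition function. -/
def partition (C : CSSCode n) (β : ℝ) : ℝ :=
  (Matrix.trace (NormedSpace.exp ((-(β : ℂ)) • C.hamiltonian))).re

theorem posDef_exp_hamiltonian (C : CSSCode n) (β : ℝ) :
    (NormedSpace.exp ((-(β : ℂ)) • C.hamiltonian)).PosDef := by
  refine posDef_exp ((hamiltonian_isHermitian C).smul ?_)
  rw [IsSelfAdjoint, star_neg, RCLike.star_def, Complex.conj_ofReal]

theorem trace_exp_eq (C : CSSCode n) (β : ℝ) :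
    Matrix.trace (NormedSpace.exp ((-(β : ℂ)) • C.hamiltonian)) = (partition C β : ℂ) := by
  have h := (posDef_exp_hamiltonian C β).posSemidef.trace_nonneg
  rw [Complex.le_def] at h
  exact Complex.ext rfl h.2.symm

theorem partition_pos (C : CSSCode n) (β : ℝ) : 0 < partition C β := by
  have h := (posDef_exp_hamiltonian C β).trace_pos
  rw [trace_exp_eq] at h
  exact_mod_cast h

theorem gibbsState_eq (C : CSSCode n) (β : ℝ) : C.gibbsState β =
    (((partition C β)⁻¹ : ℝ) : ℂ) • NormedSpace.exp ((-(β : ℂ)) • C.hamiltonian) := by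
  rw [CSSCode.gibbsState, trace_exp_eq, Complex.ofReal_inv]

theorem posDef_gibbsState (C : CSSCode n) (β : ℝ) : (C.gibbsState β).PosDef := by
  rw [gibbsState_eq]
  refine (posDef_exp_hamiltonian C β).smul ?_
  exact_mod_cast inv_pos.2 (partition_pos C β)

/-- The eigenvalue of the Gibbs state on the eigenstate with error label `l = (x, z)`. -/
def gibbsWeight (C : CSSCode n) (β : ℝ) (l : (Fin n → ZMod 2) × (Fin n → ZMod 2)) : ℝ :=
  (partition C β)⁻¹ * (boltz C.HZ β l.1 * boltz C.HX β l.2)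

theorem gibbsWeight_pos (C : CSSCode n) (β : ℝ) (l : (Fin n → ZMod 2) × (Fin n → ZMod 2)) :
    0 < gibbsWeight C β l :=
  mul_pos (inv_pos.2 (partition_pos C β)) (mul_pos (boltz_pos _ _ _) (boltz_pos _ _ _))

theorem act_gibbsState {C : CSSCode n} {ψ : QState n} (hψ : ψ ∈ C.codeSpace) (β : ℝ)
    (l : (Fin n → ZMod 2) × (Fin n → ZMod 2)) :
    act (C.gibbsState β) (act (pauli l.1 l.2) ψ) =
      (gibbsWeight C β l : ℂ) • act (pauli l.1 l.2) ψ := by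
  have h : act ((-(β : ℂ)) • C.hamiltonian) (act (pauli l.1 l.2) ψ) =
      (-(β : ℂ) * C.energy l) • act (pauli l.1 l.2) ψ := by
    rw [act_smul_op, act_hamiltonian hψ, smul_smul]
  rw [gibbsState_eq, act_smul_op, act_exp_of_eigenvector h, smul_smul]
  congr 1
  rw [gibbsWeight, boltz, boltz, ← Real.exp_add, CSSCode.energy]
  push_cast
  congr 2
  ring

theorem pauli_conjTranspose_mul_self (x z : Fin n → ZMod 2) :
    (pauli x z).conjTranspose * pauli x z = 1 := by
  rw [pauli_conjTranspose, smul_mul_assoc, pauli_mul, smul_smul, csgn_mul_self, one_smul,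
    add_self_vec, add_self_vec, pauli_zero]

theorem norm_act_of_conjTranspose_mul_self {U : Op n} (hU : U.conjTranspose * U = 1)
    (ψ : QState n) : ‖act U ψ‖ = ‖ψ‖ := by
  have h : inner ℂ (act U ψ) (act U ψ) = inner ℂ ψ ψ := by
    rw [inner_act_left, ← act_mul, hU, act_one]
  rw [inner_self_eq_ofReal, inner_self_eq_ofReal] at h
  have h2 : ‖act U ψ‖ ^ 2 = ‖ψ‖ ^ 2 := by exact_mod_cast h
  exact (sq_eq_sq₀ (norm_nonneg _) (norm_nonneg _)).1 h2

end Gibbs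

/-! ### Components as bottlenecks -/

section Bottleneck

variable {n : ℕ}

/-- For a subspace spanned by a set, Pauli operators suffice to generate the neighbourhood. -/
theorem hilbertNeighborhood_span (r : ℝ) (S : Set (QState n)) :
    hilbertNeighborhood r (Submodule.span ℂ S) =
      Submodule.span ℂ {φ | ∃ (A : Finset (Fin n)) (a b : Fin n → ZMod 2) (s : QState n),
        (A.card : ℝ) ≤ r ∧ supp a ⊆ A ∧ supp b ⊆ A ∧ s ∈ S ∧ φ = act (pauli a b) s} := by
  apply le_antisymm
  · refine Submodule.span_le.2 ?_
    rintro _ ⟨A, O, ψ, hA, hO, hψ, rfl⟩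
    replace hO := hO.mem_pauliSpan
    rw [SetLike.mem_coe]
    induction hO using Submodule.span_induction with
    | mem O hO =>
      obtain ⟨a, b, ha, hb, rfl⟩ := hO
      induction hψ using Submodule.span_induction with
      | mem s hs => exact Submodule.subset_span ⟨A, a, b, s, hA, ha, hb, hs, rfl⟩
      | zero => rw [act, map_zero]; exact Submodule.zero_mem _
      | add x y _ _ hx hy => rw [act_add]; exact Submodule.add_mem _ hx hy
      | smul c x _ hx => rw [act_smul]; exact Submodule.smul_mem _ _ hx
    | zero =>
      have : act (0 : Op n) ψ = 0 := by simp [act]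
      rw [this]; exact Submodule.zero_mem _
    | add x y _ _ hx hy => rw [act_add_op]; exact Submodule.add_mem _ hx hy
    | smul c x _ hx => rw [act_smul_op]; exact Submodule.smul_mem _ _ hx
  · refine Submodule.span_mono ?_
    rintro _ ⟨A, a, b, s, hA, ha, hb, hs, rfl⟩
    exact ⟨A, _, s, hA, actsOn_pauli ha hb, Submodule.subset_span hs, rfl⟩

theorem act_mem_span_of_eigenvectors {A : Op n} {S : Set (QState n)}
    (hS : ∀ s ∈ S, ∃ c : ℂ, act A s = c • s) {ψ : QState n} (hψ : ψ ∈ Submodule.span ℂ S) :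
    act A ψ ∈ Submodule.span ℂ S := by
  induction hψ using Submodule.span_induction with
  | mem s hs =>
    obtain ⟨c, hc⟩ := hS s hs
    rw [hc]; exact Submodule.smul_mem _ _ (Submodule.subset_span hs)
  | zero => rw [act, map_zero]; exact Submodule.zero_mem _
  | add x y _ _ hx hy => rw [act_add]; exact Submodule.add_mem _ hx hy
  | smul c x _ hx => rw [act_smul]; exact Submodule.smul_mem _ _ hx

theorem act_mem_orthogonal {A : Op n} (hA : A.IsHermitian) {V : Submodule ℂ (QState n)}
    (hV : ∀ ψ ∈ V, act A ψ ∈ V) {ψ : QState n} (hψ : ψ ∈ Vᗮ) : act A ψ ∈ Vᗮ := by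
  rw [Submodule.mem_orthogonal] at hψ ⊢
  intro φ hφ
  rw [inner_act_right, hA.eq]
  exact hψ _ (hV φ hφ)

theorem act_starProjection_orthogonal {A : Op n} (hA : A.IsHermitian)
    {V : Submodule ℂ (QState n)} (hV : ∀ ψ ∈ V, act A ψ ∈ V) (ψ : QState n) :
    act A (Vᗮ.starProjection ψ) = Vᗮ.starProjection (act A ψ) := by
  have h1 := proj_commute_of_invariant hA fun ψ hψ => act_mem_orthogonal hA hV hψ
  have h2 := congrArg Matrix.conjTranspose h1
  simp only [Matrix.conjTranspose_mul, proj_isHermitian, hA.eq, ← mul_assoc] at h2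
  rw [← act_proj, ← act_proj, ← act_mul, ← act_mul, h2, ← h1]

/-- If `V` is spanned by some of the eigenvectors `v i` and `N` is contained in the span of more
of them, then only the eigenvectors in the difference contribute to `N ⊓ Vᗮ`. -/
theorem trace_proj_inf_orthogonal_le {ι : Type*} [DecidableEq ι] {A : Op n} (hA : A.PosSemidef)
    {v : ι → QState n} {c : ι → ℝ} (hc : ∀ i, 0 ≤ c i)
    (hv : ∀ i, act A (v i) = (c i : ℂ) • v i) {I J : Finset ι} {V N : Submodule ℂ (QState n)}
    (hV : V = Submodule.span ℂ (v '' I)) (hN : N ≤ Submodule.span ℂ (v '' J)) :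
    (proj (N ⊓ Vᗮ) * A).trace.re ≤ ∑ i ∈ J \ I, c i := by
  have hVinv : ∀ ψ ∈ V, act A ψ ∈ V := by
    intro ψ hψ
    rw [hV] at hψ ⊢
    refine act_mem_span_of_eigenvectors ?_ hψ
    rintro _ ⟨i, _, rfl⟩
    exact ⟨_, hv i⟩
  rw [← Finset.sum_coe_sort]
  refine trace_proj_le_sum hA (v := fun i : (J \ I : Finset ι) => Vᗮ.starProjection (v i))
    (fun i => hc i) (fun i => ?_) ?_
  · rw [act_starProjection_orthogonal hA.isHermitian hVinv, hv, map_smul]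
  · rintro ψ ⟨hψN, hψV⟩
    have h1 : Vᗮ.starProjection ψ = ψ := Submodule.starProjection_eq_self_iff.2 hψV
    rw [← h1]
    have hψ := hN hψN
    clear h1 hψN hψV
    induction hψ using Submodule.span_induction with
    | mem s hs =>
      obtain ⟨i, hi, rfl⟩ := hs
      by_cases hiI : i ∈ I
      · have : v i ∈ V := by rw [hV]; exact Submodule.subset_span ⟨i, hiI, rfl⟩
        rw [Submodule.starProjection_orthogonal_apply_eq_zero this]
        exact Submodule.zero_mem _
      · exact Submodule.subset_span ⟨⟨i, Finset.mem_sdiff.2 ⟨hi, hiI⟩⟩, rfl⟩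
    | zero => rw [map_zero]; exact Submodule.zero_mem _
    | add x y _ _ hx hy => rw [map_add]; exact Submodule.add_mem _ hx hy
    | smul c x _ hx => rw [map_smul]; exact Submodule.smul_mem _ _ hx

/-- Every bottleneck subspace contains an extremal one: splitting it repeatedly must end, as the
dimension drops. -/
theorem IsBottleneck.exists_isExtremal_le {ρ : Op n} {r ε : ℝ} {V : Submodule ℂ (QState n)}
    (hV : IsBottleneck ρ r ε V) : ∃ W ≤ V, IsExtremal ρ r ε W := by
  induction hk : Module.finrank ℂ V using Nat.strong_induction_on generalizing V with
  | _ k ih =>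
    by_cases hext : IsExtremal ρ r ε V
    · exact ⟨V, le_rfl, hext⟩
    · have : ∃ W₁ W₂ : Submodule ℂ (QState n), W₁ ⟂ W₂ ∧ W₁ ⊔ W₂ = V ∧
          IsBottleneck ρ r ε W₁ ∧ IsBottleneck ρ r ε W₂ := by
        by_contra h
        exact hext ⟨hV, h⟩
      obtain ⟨W₁, W₂, horth, hsup, h₁, h₂⟩ := this
      have hle : W₁ ≤ V := hsup ▸ le_sup_left
      have hlt : W₁ < V := by
        refine lt_of_le_of_ne hle fun h => h₂.1 ?_
        have h3 : W₂ ≤ W₁ := by rw [h, ← hsup]; exact le_sup_right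
        have h4 := horth.symm.disjoint
        exact disjoint_self.1 (h4.mono_right h3)
      obtain ⟨W, hW, hWe⟩ := ih _ (hk ▸ Submodule.finrank_lt_finrank_of_lt hlt) h₁ rfl
      exact ⟨W, hW.trans hle, hWe⟩

end Bottleneck

section Component

variable {n : ℕ}

theorem good_zero {m : ℕ} {H : Matrix (Fin m) (Fin n) (ZMod 2)} {G : SimpleGraph (Fin n)} {e : ℝ}
    (he : 0 ≤ e) : Good H G e 0 := by
  have h0 : (supp (reduced H 0)).card = 0 := by
    have := reducedWeight_le_hammingNorm H 0
    rw [hammingNorm_zero] at this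
    exact Nat.le_zero.1 this
  refine smallHalfClusters_of_card_le ?_
  rw [h0]; simpa using he

/-- The eigenstate with error label `p + q`, where `p` labels the centre of a component. -/
def shifted (ψ : QState n) (p q : (Fin n → ZMod 2) × (Fin n → ZMod 2)) : QState n :=
  act (pauli (p + q).1 (p + q).2) ψ

theorem norm_shifted (ψ : QState n) (p q : (Fin n → ZMod 2) × (Fin n → ZMod 2)) :
    ‖shifted ψ p q‖ = ‖ψ‖ :=
  norm_act_of_conjTranspose_mul_self (pauli_conjTranspose_mul_self _ _) ψ

theorem add_add_add_cancel (p x y : Fin n → ZMod 2) : p + x + (p + y) = x + y := by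
  rw [add_add_add_comm, add_self_vec, zero_add]

theorem inner_shifted_eq_zero {C : CSSCode n} {ψ : QState n} (hψ : ψ ∈ C.codeSpace)
    (p : (Fin n → ZMod 2) × (Fin n → ZMod 2)) {q q' : (Fin n → ZMod 2) × (Fin n → ZMod 2)}
    (h : C.HZ.mulVec (q.1 + q'.1) ≠ 0 ∨ C.HX.mulVec (q.2 + q'.2) ≠ 0) :
    inner ℂ (shifted ψ p q) (shifted ψ p q') = 0 := by
  unfold shifted
  rw [inner_act_left, ← act_mul, pauli_conjTranspose, smul_mul_assoc, pauli_mul, smul_smul,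
    act_smul_op, inner_smul_right]
  simp only [Prod.fst_add, Prod.snd_add, add_add_add_cancel]
  rw [inner_act_pauli_eq_zero hψ hψ h, mul_zero]

/-- The labels of an eigenbasis of a component. -/
def goodLabels (C : CSSCode n) (e : ℝ) : Finset ((Fin n → ZMod 2) × (Fin n → ZMod 2)) :=
  goodReps C.HX C.interactionGraph e ×ˢ goodReps C.HZ C.interactionGraph e

/-- The labels of eigenstates spanning a neighbourhood of a component. -/
def admissibleLabels (C : CSSCode n) (e : ℝ) : Finset ((Fin n → ZMod 2) × (Fin n → ZMod 2)) :=
  admissibleReps C.HX C.interactionGraph e ×ˢ admissibleReps C.HZ C.interactionGraph e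

/-- Replacing an error label by its reduced representative only multiplies the state by a scalar. -/
theorem act_pauli_eq_shifted_reduced {C : CSSCode n} {ψ : QState n} (hψ : ψ ∈ C.codeSpace)
    (p : (Fin n → ZMod 2) × (Fin n → ZMod 2)) (x z : Fin n → ZMod 2) :
    ∃ c : ℂ, act (pauli (p.1 + x) (p.2 + z)) ψ =
      c • shifted ψ p (reduced C.HX x, reduced C.HZ z) :=
  ⟨_, act_pauli_congr hψ (by rw [Prod.fst_add, add_add_add_cancel]; exact add_reduced_mem _ _)
    (by rw [Prod.snd_add, add_add_add_cancel]; exact add_reduced_mem _ _)⟩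

theorem span_goodOps {C : CSSCode n} {ψ : QState n} (hψ : ψ ∈ C.codeSpace) (e : ℝ)
    (p : (Fin n → ZMod 2) × (Fin n → ZMod 2)) :
    Submodule.span ℂ (applyTo ψ '' goodOps C e p) =
      Submodule.span ℂ (shifted ψ p '' goodLabels C e) := by
  apply le_antisymm <;> refine Submodule.span_le.2 ?_
  · rintro _ ⟨_, ⟨x, z, hx, hz, rfl⟩, rfl⟩
    obtain ⟨c, hc⟩ := act_pauli_eq_shifted_reduced hψ p x z
    rw [applyTo_apply, hc]
    refine Submodule.smul_mem _ _ (Submodule.subset_span ⟨_, ?_, rfl⟩)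
    exact Finset.mem_coe.2 (Finset.mem_product.2 ⟨hx.reduced_mem, hz.reduced_mem⟩)
  · rintro _ ⟨q, hq, rfl⟩
    obtain ⟨h1, h2⟩ := Finset.mem_product.1 (Finset.mem_coe.1 hq)
    exact Submodule.subset_span ⟨_, ⟨q.1, q.2, (mem_goodReps.1 h1).2, (mem_goodReps.1 h2).2, rfl⟩,
      rfl⟩

theorem act_pauli_goodOps (ψ : QState n) (p : (Fin n → ZMod 2) × (Fin n → ZMod 2))
    (a b x z : Fin n → ZMod 2) : act (pauli a b) (act (pauli (p.1 + x) (p.2 + z)) ψ) =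
      csgn (dotProduct b (p.1 + x)) • act (pauli (p.1 + (x + a)) (p.2 + (z + b))) ψ := by
  rw [← act_mul, pauli_mul, act_smul_op, add_comm a, add_comm b, add_assoc, add_assoc]

/-- Eigenstates reached by few-qubit operators are spanned by those with admissible labels. -/
theorem neighborhood_le {C : CSSCode n} {ψ : QState n} (hψ : ψ ∈ C.codeSpace) (e : ℝ)
    (p : (Fin n → ZMod 2) × (Fin n → ZMod 2)) :
    hilbertNeighborhood (e / 2) (Submodule.span ℂ (applyTo ψ '' goodOps C e p)) ≤
      Submodule.span ℂ (shifted ψ p '' admissibleLabels C e) := by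
  rw [hilbertNeighborhood_span]
  refine Submodule.span_le.2 ?_
  rintro _ ⟨A, a, b, _, hA, ha, hb, ⟨_, ⟨x, z, hx, hz, rfl⟩, rfl⟩, rfl⟩
  have hw : ∀ c : Fin n → ZMod 2, supp c ⊆ A → 2 * (hammingNorm c : ℝ) ≤ e := by
    intro c hc
    have h1 : (hammingNorm c : ℝ) ≤ A.card := by exact_mod_cast Finset.card_le_card hc
    linarith
  obtain ⟨c, hc⟩ := act_pauli_eq_shifted_reduced hψ p (x + a) (z + b)
  rw [applyTo_apply, act_pauli_goodOps, hc]
  refine Submodule.smul_mem _ _ (Submodule.smul_mem _ _ (Submodule.subset_span ⟨_, ?_, rfl⟩))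
  exact Finset.mem_coe.2 (Finset.mem_product.2
    ⟨(hx.admissible_add (hw a ha)).reduced_mem, (hz.admissible_add (hw b hb)).reduced_mem⟩)

theorem act_gibbsState_mem_neighborhood {C : CSSCode n} {ψ : QState n} (hψ : ψ ∈ C.codeSpace)
    (β e : ℝ) (p : (Fin n → ZMod 2) × (Fin n → ZMod 2)) {φ : QState n}
    (hφ : φ ∈ hilbertNeighborhood (e / 2) (Submodule.span ℂ (applyTo ψ '' goodOps C e p))) :
    act (C.gibbsState β) φ ∈
      hilbertNeighborhood (e / 2) (Submodule.span ℂ (applyTo ψ '' goodOps C e p)) := by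
  rw [hilbertNeighborhood_span] at hφ ⊢
  refine act_mem_span_of_eigenvectors ?_ hφ
  rintro _ ⟨A, a, b, _, hA, ha, hb, ⟨_, ⟨x, z, hx, hz, rfl⟩, rfl⟩, rfl⟩
  refine ⟨gibbsWeight C β (p.1 + (x + a), p.2 + (z + b)), ?_⟩
  rw [applyTo_apply, act_pauli_goodOps, act_smul,
    act_gibbsState hψ β (p.1 + (x + a), p.2 + (z + b)), smul_comm]

theorem act_gibbsState_mem_component {C : CSSCode n} {ψ : QState n} (hψ : ψ ∈ C.codeSpace)
    (β e : ℝ) (p : (Fin n → ZMod 2) × (Fin n → ZMod 2)) {φ : QState n}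
    (hφ : φ ∈ Submodule.span ℂ (applyTo ψ '' goodOps C e p)) :
    act (C.gibbsState β) φ ∈ Submodule.span ℂ (applyTo ψ '' goodOps C e p) := by
  refine act_mem_span_of_eigenvectors ?_ hφ
  rintro _ ⟨_, ⟨x, z, hx, hz, rfl⟩, rfl⟩
  exact ⟨_, act_gibbsState hψ β (p.1 + x, p.2 + z)⟩

/-- Distinct good labels have distinct syndromes by confinement, so the eigenstates they label are
orthogonal and their weights add up. -/
theorem IsConfinedCode.trace_component {C : CSSCode n} {e γ : ℝ} {w : ℕ}
    (h : IsConfinedCode C e γ w) {ψ : QState n} (hψ : ψ ∈ C.codeSpace) (hψ1 : ‖ψ‖ = 1) (β : ℝ)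
    (p : (Fin n → ZMod 2) × (Fin n → ZMod 2)) :
    (proj (Submodule.span ℂ (applyTo ψ '' goodOps C e p)) * C.gibbsState β).trace.re =
      ∑ q ∈ goodLabels C e, gibbsWeight C β (p + q) := by
  have hli : LinearIndependent ℂ (fun q : goodLabels C e => shifted ψ p q) := by
    refine linearIndependent_of_ne_zero_of_inner_eq_zero (fun q hq => ?_) fun q q' hne => ?_
    · have := norm_shifted ψ p q
      rw [hq, hψ1, norm_zero] at this
      exact zero_ne_one this
    · refine inner_shifted_eq_zero hψ p ?_
      by_contra! hcon
      obtain ⟨h1, h2⟩ := Finset.mem_product.1 q.2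
      obtain ⟨h1', h2'⟩ := Finset.mem_product.1 q'.2
      rw [mem_goodReps] at h1 h2 h1' h2'
      have hX := (IsSector.of_code_X C).mem_stab_of_local h.confX h.e_nonneg h.gamma_pos h.degZ
        (a := 0) h1.2 h1'.2 (by simpa using h.e_nonneg) (by rw [add_zero]; exact hcon.1)
      have hZ := (IsSector.of_code_Z C).mem_stab_of_local h.confZ h.e_nonneg h.gamma_pos h.degX
        (a := 0) h2.2 h2'.2 (by simpa using h.e_nonneg) (by rw [add_zero]; exact hcon.2)
      rw [add_zero] at hX hZ
      refine hne (Subtype.ext (Prod.ext ?_ ?_))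
      · rw [← h1.1, ← h1'.1]; exact reduced_congr hX
      · rw [← h2.1, ← h2'.1]; exact reduced_congr hZ
  have hspan : Submodule.span ℂ (applyTo ψ '' goodOps C e p) =
      Submodule.span ℂ (Set.range fun q : goodLabels C e => shifted ψ p q) := by
    rw [span_goodOps hψ, Set.image_eq_range]; rfl
  rw [hspan, trace_proj_span_eq (v := fun q : goodLabels C e => shifted ψ p q)
    (c := fun q : goodLabels C e => (gibbsWeight C β (p + q) : ℂ))
    (fun q => act_gibbsState hψ β (p + q.1)) hli, Complex.re_sum]
  simp only [Complex.ofReal_re]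
  exact Finset.sum_coe_sort (goodLabels C e) fun q => gibbsWeight C β (p + q)

/-- The neighbourhood and the component are both spanned by eigenstates of the Gibbs state, so the
boundary is invariant under it and the trace norm is a trace. -/
theorem traceNorm_boundary_le {C : CSSCode n} {ψ : QState n} (hψ : ψ ∈ C.codeSpace) (β e : ℝ)
    (p : (Fin n → ZMod 2) × (Fin n → ZMod 2)) :
    traceNorm (proj (hilbertBoundary (e / 2) (Submodule.span ℂ (applyTo ψ '' goodOps C e p))) *
      C.gibbsState β) ≤ ∑ q ∈ admissibleLabels C e \ goodLabels C e, gibbsWeight C β (p + q) := by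
  have hρ := posDef_gibbsState C β
  have hinv : ∀ φ ∈ hilbertBoundary (e / 2) (Submodule.span ℂ (applyTo ψ '' goodOps C e p)),
      act (C.gibbsState β) φ ∈
        hilbertBoundary (e / 2) (Submodule.span ℂ (applyTo ψ '' goodOps C e p)) := by
    rintro φ ⟨h1, h2⟩
    exact ⟨act_gibbsState_mem_neighborhood hψ β e p h1, act_mem_orthogonal hρ.isHermitian
      (fun φ hφ => act_gibbsState_mem_component hψ β e p hφ) h2⟩
  rw [traceNorm_of_posSemidef (posSemidef_proj_mul_of_invariant hρ.posSemidef hinv)]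
  exact trace_proj_inf_orthogonal_le hρ.posSemidef (fun q => (gibbsWeight_pos C β (p + q)).le)
    (fun q => act_gibbsState hψ β (p + q)) (span_goodOps hψ e p) (neighborhood_le hψ e p)

/-- If `G` and `G'` carry all but a fraction `q` of two product weights, then `G ×ˢ G'` carries all but
a fraction of order `q`. -/
theorem sum_product_sdiff_le {ι κ : Type*} [DecidableEq ι] [DecidableEq κ] {G A : Finset ι}
    {G' A' : Finset κ} (hG : G ⊆ A) (hG' : G' ⊆ A') {f : ι → ℝ} {g : κ → ℝ} (hf : ∀ i, 0 ≤ f i)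
    (hg : ∀ i, 0 ≤ g i) {q : ℝ} (hq0 : 0 ≤ q) (hq : q ≤ 1 / 2)
    (h : ∑ i ∈ A \ G, f i ≤ q * ∑ i ∈ A, f i) (h' : ∑ i ∈ A' \ G', g i ≤ q * ∑ i ∈ A', g i) :
    ∑ p ∈ (A ×ˢ A') \ (G ×ˢ G'), f p.1 * g p.2 ≤
      6 * q * ∑ p ∈ G ×ˢ G', f p.1 * g p.2 := by
  have key : ∀ {a b : ℝ}, 0 ≤ a → a ≤ q * (a + b) → a ≤ 2 * q * b := by
    intro a b ha hab
    have := mul_le_mul_of_nonneg_right hq ha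
    linarith
  rw [← Finset.sum_sdiff hG] at h
  rw [← Finset.sum_sdiff hG'] at h'
  have hx := key (Finset.sum_nonneg fun i _ => hf i) h
  have hy := key (Finset.sum_nonneg fun i _ => hg i) h'
  have h1 := Finset.sum_sdiff (f := fun p => f p.1 * g p.2) (Finset.product_subset_product hG hG')
  rw [Finset.sum_product' A A' fun i j => f i * g j, Finset.sum_product' G G' fun i j => f i * g j,
    ← Finset.sum_mul_sum, ← Finset.sum_mul_sum, ← Finset.sum_sdiff hG, ← Finset.sum_sdiff hG'] at h1
  rw [Finset.sum_product' G G' fun i j => f i * g j, ← Finset.sum_mul_sum]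
  have hx0 : 0 ≤ ∑ i ∈ A \ G, f i := Finset.sum_nonneg fun i _ => hf i
  have hy0 : 0 ≤ ∑ i ∈ A' \ G', g i := Finset.sum_nonneg fun i _ => hg i
  have hX : 0 ≤ ∑ i ∈ G, f i := Finset.sum_nonneg fun i _ => hf i
  have hY : 0 ≤ ∑ i ∈ G', g i := Finset.sum_nonneg fun i _ => hg i
  set x := ∑ i ∈ A \ G, f i
  set y := ∑ i ∈ A' \ G', g i
  set X := ∑ i ∈ G, f i
  set Y := ∑ i ∈ G', g i
  have e1 : x * Y ≤ 2 * q * X * Y := mul_le_mul_of_nonneg_right hx hY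
  have e2 : X * y ≤ X * (2 * q * Y) := mul_le_mul_of_nonneg_left hy hX
  have e3 : x * y ≤ (2 * q * X) * (2 * q * Y) := mul_le_mul hx hy hy0 (by positivity)
  have e4 : q * (q * (X * Y)) ≤ 1 / 2 * (q * (X * Y)) :=
    mul_le_mul_of_nonneg_right hq (by positivity)
  linarith

/-- At low temperature the component of a typical eigenstate is a bottleneck: its boundary
consists of eigenstates with a large excited cluster, which are thermally suppressed. -/
theorem IsConfinedCode.isBottleneck {C : CSSCode n} {e γ : ℝ} {w : ℕ}
    (h : IsConfinedCode C e γ w) {ψ : QState n} (hψ : ψ ∈ C.codeSpace) (hψ1 : ‖ψ‖ = 1) {β : ℝ}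
    (hβ : 0 ≤ β) {p : (Fin n → ZMod 2) × (Fin n → ZMod 2)} {D : ℕ}
    (hD : ∀ k : ℕ, k < D ↔ (k : ℝ) ≤ e)
    (hp₁ : Typical C.HZ C.interactionGraph D (γ / 24) p.1)
    (hp₂ : Typical C.HX C.interactionGraph D (γ / 24) p.2) {q : ℝ} (hq : q ≤ 1 / 2)
    (hsum : ∑ Λ ∈ rootedSets C.interactionGraph D, (2 * Real.exp (-β * (γ / 12))) ^ Λ.card ≤ q) :
    IsBottleneck (C.gibbsState β) (e / 2) (6 * q)
      (Submodule.span ℂ (applyTo ψ '' goodOps C e p)) := by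
  classical
  have hne : Submodule.span ℂ (applyTo ψ '' goodOps C e p) ≠ ⊥ := by
    refine (Submodule.ne_bot_iff _).2 ⟨act (pauli (p.1 + 0) (p.2 + 0)) ψ,
      Submodule.subset_span ⟨_, ⟨0, 0, good_zero h.e_nonneg, good_zero h.e_nonneg, rfl⟩, rfl⟩,
      fun h0 => ?_⟩
    have h1 := norm_act_of_conjTranspose_mul_self
      (pauli_conjTranspose_mul_self (p.1 + 0) (p.2 + 0)) ψ
    rw [h0, hψ1, norm_zero] at h1
    exact zero_ne_one h1
  refine ⟨hne, ?_⟩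
  have hpos := trace_proj_mul_pos hne (posDef_gibbsState C β)
  rw [Complex.lt_def] at hpos
  rw [div_le_iff₀ hpos.1, h.trace_component hψ hψ1]
  refine (traceNorm_boundary_le hψ β e p).trans ?_
  have hq0 : 0 ≤ q := le_trans (Finset.sum_nonneg fun _ _ => by positivity) hsum
  have hAX : 0 ≤ ∑ x ∈ admissibleReps C.HX C.interactionGraph e, boltz C.HZ β (p.1 + x) :=
    Finset.sum_nonneg fun _ _ => (boltz_pos _ _ _).le
  have hAZ : 0 ≤ ∑ x ∈ admissibleReps C.HZ C.interactionGraph e, boltz C.HX β (p.2 + x) :=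
    Finset.sum_nonneg fun _ _ => (boltz_pos _ _ _).le
  have h1 := sum_product_sdiff_le (goodReps_subset h.e_nonneg) (goodReps_subset h.e_nonneg)
    (f := fun x => boltz C.HZ β (p.1 + x)) (g := fun z => boltz C.HX β (p.2 + z))
    (fun _ => (boltz_pos _ _ _).le) (fun _ => (boltz_pos _ _ _).le) hq0 hq
    ((sum_admissible_sdiff_le (IsSector.of_code_X C) h.confX h.e_nonneg h.gamma_pos hD hβ hp₁).trans
      (mul_le_mul_of_nonneg_right hsum hAX))
    ((sum_admissible_sdiff_le (IsSector.of_code_Z C) h.confZ h.e_nonneg h.gamma_pos hD hβ hp₂).trans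
      (mul_le_mul_of_nonneg_right hsum hAZ))
  unfold gibbsWeight
  rw [← Finset.mul_sum, ← Finset.mul_sum, mul_left_comm]
  refine mul_le_mul_of_nonneg_left ?_ (inv_pos.2 (partition_pos C β)).le
  simp only [goodLabels, admissibleLabels, Prod.fst_add, Prod.snd_add]
  convert h1

end Component

/-! ### Mixtures of shallow states -/

section Mixtures

variable {n : ℕ}

theorem isDensity_stateComponent {ρ : Op n} (hρ : ρ.PosDef) {W : Submodule ℂ (QState n)}
    (hW : W ≠ ⊥) : IsDensity (stateComponent ρ W) := by
  have hpos := trace_proj_mul_pos hW hρ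
  refine ⟨?_, ?_⟩
  · refine (posSemidef_proj_mul_mul_proj W hρ.posSemidef).smul ?_
    exact (inv_pos_of_pos hpos).le
  · rw [stateComponent, Matrix.trace_smul, ← trace_proj_mul_eq, smul_eq_mul,
      inv_mul_cancel₀ hpos.ne']

theorem supportedOn_stateComponent (ρ : Op n) {W V : Submodule ℂ (QState n)} (h : W ≤ V) :
    SupportedOn (stateComponent ρ W) V := by
  unfold SupportedOn stateComponent
  rw [mul_smul_comm, smul_mul_assoc]
  congr 1
  calc proj V * (proj W * ρ * proj W) * proj V
      = (proj V * proj W) * ρ * (proj W * proj V) := by simp only [mul_assoc]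
    _ = _ := by rw [proj_mul_proj_of_le h, proj_mul_proj_of_le' h]

theorem IsPreparable.norm_eq_one {K D : ℕ} {φ : QState n} (h : IsPreparable K D φ) : ‖φ‖ = 1 := by
  obtain ⟨U, c, hU, hc, rfl⟩ := h
  rw [norm_smul, hc, norm_act_of_conjTranspose_mul_self
    (Matrix.mem_unitaryGroup_iff'.1 hU.mem_unitaryGroup)]
  simp

/-- If shallow states have small overlap with `V`, then so do their mixtures, which are therefore
almost perfectly distinguished from states on `V` by the projector onto `V`. -/
theorem not_isApproxPreparable {K D : ℕ} {V : Submodule ℂ (QState n)} {q : ℝ}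
    (hV : ∀ φ, IsPreparable K D φ → ‖V.starProjection φ‖ ^ 2 ≤ q) {τ : Op n} (hτ : IsDensity τ)
    (hs : SupportedOn τ V) : ¬ IsApproxPreparable K D (2 - 2 * q) τ := by
  rintro ⟨σ, ⟨m, a, φ, hφ, ha, rfl⟩, hlt⟩
  have h1 := re_trace_mul_le_traceNorm
    (τ - ∑ j, (a j : ℂ) • Matrix.vecMulVec (fun b => φ j b) (fun b => star (φ j b)))
    ((2 : ℂ) • proj V - 1) fun ψ => (norm_two_proj_sub V ψ).le
  have hPτ : (proj V * τ).trace = 1 := by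
    rw [SupportedOn] at hs
    rw [trace_proj_mul_eq, hs, hτ.2]
  have hσ : ∀ A : Op n, (A * ∑ j, (a j : ℂ) • Matrix.vecMulVec (fun b => φ j b)
      (fun b => star (φ j b))).trace = ∑ j, (a j : ℂ) * inner ℂ (φ j) (act A (φ j)) := by
    intro A
    rw [Matrix.mul_sum, Matrix.trace_sum]
    refine Finset.sum_congr rfl fun j _ => ?_
    rw [mul_smul_comm, Matrix.trace_smul, trace_mul_vecMulVec, smul_eq_mul]
  have hσ1 : (1 * ∑ j, (a j : ℂ) • Matrix.vecMulVec (fun b => φ j b)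
      (fun b => star (φ j b))).trace.re = 1 := by
    rw [hσ, ← ha, Complex.re_sum]
    refine Finset.sum_congr rfl fun j _ => ?_
    rw [act_one, inner_self_eq_ofReal, (hφ j).2.norm_eq_one]
    simp
  have hσV : (proj V * ∑ j, (a j : ℂ) • Matrix.vecMulVec (fun b => φ j b)
      (fun b => star (φ j b))).trace.re ≤ q := by
    rw [hσ, Complex.re_sum]
    calc ∑ j, ((a j : ℂ) * inner ℂ (φ j) (act (proj V) (φ j))).re
        = ∑ j, a j * ‖V.starProjection (φ j)‖ ^ 2 := by
          refine Finset.sum_congr rfl fun j _ => ?_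
          rw [inner_act_proj_self, ← Complex.ofReal_mul, Complex.ofReal_re]
      _ ≤ ∑ j, a j * q :=
          Finset.sum_le_sum fun j _ => mul_le_mul_of_nonneg_left (hV _ (hφ j).2) (hφ j).1
      _ = q := by rw [← Finset.sum_mul, ha, one_mul]
  rw [mul_sub, Matrix.trace_sub, sub_mul, sub_mul, smul_mul_assoc, smul_mul_assoc,
    Matrix.trace_sub, Matrix.trace_sub, Matrix.trace_smul, Matrix.trace_smul, hPτ, one_mul, hτ.2]
    at h1
  simp only [Complex.sub_re, smul_eq_mul, Complex.mul_re, Complex.re_ofNat, Complex.im_ofNat,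
    zero_mul, sub_zero, Complex.one_re, hσ1] at h1
  linarith

/-- A bound on the overlap of a component with shallow states, from the dimension of the code
space. -/
theorem IsConfinedCode.overlap_le {C : CSSCode n} {e γ : ℝ} {w : ℕ}
    (h : IsConfinedCode C e γ w) (hn : 0 < n) {ψ : QState n} (hψ : ψ ∈ C.codeSpace)
    (hψ1 : ‖ψ‖ = 1) (p : (Fin n → ZMod 2) × (Fin n → ZMod 2)) {K D : ℕ} {q ε : ℝ} (hq : 0 ≤ q)
    (hε0 : 0 < ε) (hε1 : ε ≤ 1) {s : ℕ} (hs : (1 - ε) ^ (s + 1) < q)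
    (he : (w / γ + 1) * ((K + 1) ^ D * (s + 1)) ≤ e)
    (hdim : ((lightStrings n (2 * ε * n)).card : ℝ) < Module.finrank ℂ (codeSubmodule C) * (q / 2))
    {φ : QState n} (hφ : IsPreparable K D φ) :
    ‖(Submodule.span ℂ (applyTo ψ '' goodOps C e p)).starProjection φ‖ ^ 2 ≤ q := by
  by_contra! hcon
  set V := Submodule.span ℂ (applyTo ψ '' goodOps C e p) with hVdef
  obtain ⟨U, c, hU, hc, rfl⟩ := hφ
  set u := act U (EuclideanSpace.single (0 : Fin n → ZMod 2) (1 : ℂ)) with hu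
  rw [map_smul, norm_smul, hc, one_mul] at hcon
  set v := V.starProjection u with hv
  have hv0 : 0 < ‖v‖ := by
    by_contra! h0
    have : ‖v‖ = 0 := le_antisymm h0 (norm_nonneg _)
    rw [this] at hcon
    norm_num at hcon
    linarith
  have hvV : (((‖v‖⁻¹ : ℝ) : ℂ) • v) ∈ V :=
    Submodule.smul_mem _ _ (Submodule.starProjection_apply_mem _ _)
  have hvmap : (((‖v‖⁻¹ : ℝ) : ℂ) • v) ∈ (Submodule.span ℂ (goodOps C e p)).map (applyTo ψ) := by
    rwa [Submodule.map_span]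
  obtain ⟨M, hM, hMv⟩ := hvmap
  rw [applyTo_apply] at hMv
  have hM1 : ‖act M ψ‖ = 1 := by
    rw [hMv, norm_smul, Complex.norm_real, norm_inv, norm_norm, inv_mul_cancel₀ hv0.ne']
  have hin : ‖inner ℂ u (act M ψ)‖ = ‖v‖ := by
    have h1 : inner ℂ u v = ((‖v‖ ^ 2 : ℝ) : ℂ) := by
      rw [hv, ← inner_act_proj_self, act_proj]
    rw [hMv, inner_smul_right, h1, ← Complex.ofReal_mul, Complex.norm_real, Real.norm_eq_abs,
      abs_of_nonneg (by positivity)]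
    field_simp
  have h2 := h.finrank_mul_le hn hM hψ hψ1 hM1 hU (q := q) (by rw [hin]; exact hcon.le) hε0 hε1 hs he
  linarith

end Mixtures

/-! ### Low temperature estimates -/

section Thermal

variable {n : ℕ}

/-- An inverse temperature above which the sums over large clusters converge. The term `6` makes each
site of a cluster count with weight at most `exp (-6)` after entropy is accounted for. -/
def criticalBeta (γ : ℝ) (w Δ : ℕ) : ℝ := 24 / γ * (6 + (Δ + 2 + w) * Real.log 2)

theorem criticalBeta_pos {γ : ℝ} (hγ : 0 < γ) (w Δ : ℕ) : 0 < criticalBeta γ w Δ := by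
  have := Real.log_pos one_lt_two
  unfold criticalBeta; positivity

/-- The weights per site in the boundary estimate (gain `γ / 12`, entropy `log 2`) and in the estimate
for atypical configurations (threshold `γ / 24`, entropy `w * log 2`). -/
theorem fugacity_le {γ β : ℝ} (hγ : 0 < γ) {w Δ : ℕ} (hβ : criticalBeta γ w Δ < β) :
    2 * Real.exp (-β * (γ / 12)) ≤ Real.exp (-6) * (1 / 2) ^ (Δ + 1) ∧
      2 ^ w * Real.exp (-β * (γ / 24)) ≤ Real.exp (-6) * (1 / 2) ^ (Δ + 1) := by
  have hl := Real.log_pos one_lt_two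
  have hpow : ∀ k : ℕ, (2 : ℝ) ^ k = Real.exp (k * Real.log 2) := by
    intro k; rw [Real.exp_nat_mul, Real.exp_log two_pos]
  have hhalf : (1 / 2 : ℝ) ^ (Δ + 1) = Real.exp (-((Δ + 1) * Real.log 2)) := by
    rw [one_div, inv_pow, hpow, Real.exp_neg]; push_cast; rfl
  have hb : 6 + (Δ + 2 + w) * Real.log 2 < β * (γ / 24) := by
    unfold criticalBeta at hβ
    have := mul_lt_mul_of_pos_right hβ (show 0 < γ / 24 by positivity)
    calc 6 + (Δ + 2 + w) * Real.log 2
        = 24 / γ * (6 + (Δ + 2 + w) * Real.log 2) * (γ / 24) := by field_simp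
      _ < _ := this
  have hw : 0 ≤ (w : ℝ) * Real.log 2 := by positivity
  have hΔ : 0 ≤ (Δ : ℝ) * Real.log 2 := by positivity
  have h2 : (2 : ℝ) = Real.exp (Real.log 2) := (Real.exp_log two_pos).symm
  rw [hhalf, hpow, ← Real.exp_add, ← Real.exp_add]
  refine ⟨?_, ?_⟩
  · calc 2 * Real.exp (-β * (γ / 12))
        = Real.exp (Real.log 2) * Real.exp (-β * (γ / 12)) := by rw [← h2]
      _ ≤ _ := by rw [← Real.exp_add, Real.exp_le_exp]; linarith
  · rw [Real.exp_le_exp]; linarith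

/-- If the number of qubits is at most `exp d`, then rooted sets of scale `d / 2` are
exponentially rare in `d`. -/
theorem sum_rootedSets_le_exp {G : SimpleGraph (Fin n)} {Δ D : ℕ} (hG : DegreeLE G Δ) {l d : ℝ}
    (hl : 0 ≤ l) (hlΔ : l ≤ Real.exp (-6) * (1 / 2) ^ (Δ + 1)) (hd : 0 ≤ d) (hD : d / 2 ≤ D)
    (hn : (n : ℝ) ≤ Real.exp d) :
    ∑ Λ ∈ rootedSets G D, l ^ Λ.card ≤ 2 * Real.exp (-2 * d) := by
  have h6 : Real.exp (-6) ≤ 1 := Real.exp_le_one_iff.2 (by norm_num)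
  refine (sum_rootedSets_le hG (Real.exp_pos _).le h6 hl hlΔ).trans ?_
  set y := (n : ℝ) * Real.exp (-6) ^ D with hy
  have hy0 : 0 ≤ y := by positivity
  have hy1 : y ≤ Real.exp (-2 * d) := by
    calc y ≤ Real.exp d * Real.exp (-3 * d) := by
          refine mul_le_mul hn ?_ (by positivity) (by positivity)
          rw [← Real.exp_nat_mul, Real.exp_le_exp]
          linarith
      _ = _ := by rw [← Real.exp_add]; congr 1; ring
  have hy2 : y ≤ 1 := hy1.trans (Real.exp_le_one_iff.2 (by linarith))
  have h1 : (1 + Real.exp (-6) ^ D) ^ n ≤ Real.exp y := by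
    rw [hy, Real.exp_nat_mul]
    refine pow_le_pow_left₀ (by positivity) ?_ _
    rw [add_comm]; exact Real.add_one_le_exp _
  have h2 := Real.abs_exp_sub_one_le (x := y) (by rwa [abs_of_nonneg hy0])
  rw [abs_of_nonneg hy0] at h2
  have h3 := (le_abs_self _).trans h2
  linarith

theorem exp_neg_energy (C : CSSCode n) (β : ℝ) (p : (Fin n → ZMod 2) × (Fin n → ZMod 2)) :
    Real.exp (-β * C.energy p) = boltz C.HZ β p.1 * boltz C.HX β p.2 := by
  rw [CSSCode.energy, mul_add, Real.exp_add]; rfl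

open Classical in
/-- The two labels of a Gibbs sample are independent, so unlikely events in the two sectors are
estimated separately. -/
theorem one_sub_le_gibbsProb (C : CSSCode n) (β : ℝ) {T₁ T₂ : (Fin n → ZMod 2) → Prop} {a : ℝ}
    (h₁ : ∑ x ∈ Finset.univ.filter (fun x => ¬ T₁ x), boltz C.HZ β x ≤ a * ∑ x, boltz C.HZ β x)
    (h₂ : ∑ x ∈ Finset.univ.filter (fun x => ¬ T₂ x), boltz C.HX β x ≤ a * ∑ x, boltz C.HX β x)
    {S : Set ((Fin n → ZMod 2) × (Fin n → ZMod 2))} (hS : ∀ p, T₁ p.1 → T₂ p.2 → p ∈ S) :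
    1 - 2 * a ≤ C.gibbsProb β S := by
  unfold CSSCode.gibbsProb
  simp only [exp_neg_energy]
  set f := boltz C.HZ β with hf
  set g := boltz C.HX β with hg
  have hf0 : ∀ x, 0 < f x := boltz_pos _ _
  have hg0 : ∀ x, 0 < g x := boltz_pos _ _
  have hF : 0 < ∑ x, f x := Finset.sum_pos (fun x _ => hf0 x) Finset.univ_nonempty
  have hG : 0 < ∑ x, g x := Finset.sum_pos (fun x _ => hg0 x) Finset.univ_nonempty
  have hprod : ∑ p : (Fin n → ZMod 2) × (Fin n → ZMod 2), f p.1 * g p.2 =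
      (∑ x, f x) * ∑ x, g x := by
    rw [Fintype.sum_prod_type, Finset.sum_mul_sum]
  rw [le_div_iff₀ (by rw [hprod]; positivity)]
  have hcover : ∑ p : (Fin n → ZMod 2) × (Fin n → ZMod 2), f p.1 * g p.2 ≤
      ∑ p ∈ Finset.univ.filter (fun p => p ∈ S), f p.1 * g p.2 +
        ((∑ x ∈ Finset.univ.filter (fun x => ¬ T₁ x), f x) * ∑ x, g x +
          (∑ x, f x) * ∑ x ∈ Finset.univ.filter (fun x => ¬ T₂ x), g x) := by
    rw [Finset.sum_mul_sum, Finset.sum_mul_sum, ← Finset.sum_product', ← Finset.sum_product']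
    rw [Finset.sum_filter]
    have e1 : ∑ p ∈ (Finset.univ.filter fun x => ¬ T₁ x) ×ˢ Finset.univ, f p.1 * g p.2 =
        ∑ p : (Fin n → ZMod 2) × (Fin n → ZMod 2), if ¬ T₁ p.1 then f p.1 * g p.2 else 0 := by
      rw [← Finset.sum_filter]
      congr 1; ext p; simp
    have e2 : ∑ p ∈ Finset.univ ×ˢ (Finset.univ.filter fun x => ¬ T₂ x), f p.1 * g p.2 =
        ∑ p : (Fin n → ZMod 2) × (Fin n → ZMod 2), if ¬ T₂ p.2 then f p.1 * g p.2 else 0 := by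
      rw [← Finset.sum_filter]
      congr 1; ext p; simp
    rw [e1, e2, ← Finset.sum_add_distrib, ← Finset.sum_add_distrib]
    refine Finset.sum_le_sum fun p _ => ?_
    have h0 : 0 < f p.1 * g p.2 := mul_pos (hf0 _) (hg0 _)
    by_cases hT₁ : T₁ p.1
    · by_cases hT₂ : T₂ p.2
      · rw [if_pos (hS p hT₁ hT₂)]; simp [hT₁, hT₂]
      · simp only [hT₁, hT₂, not_true_eq_false, not_false_eq_true, if_true, if_false]
        split_ifs <;> linarith
    · simp only [hT₁, not_false_eq_true, if_true]
      split_ifs <;> linarith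
  rw [hprod] at hcover ⊢
  have b1 := mul_le_mul_of_nonneg_right h₁ hG.le
  have b2 := mul_le_mul_of_nonneg_left h₂ hF.le
  linarith

end Thermal

/-! ### Properties of the component of a typical eigenstate -/

section Main

variable {n : ℕ}

/-- The prefactor of the logarithmic depth bound for gates on `K` qubits. -/
def depthConstant (K : ℕ) : ℝ := 1 / (2 * Real.log (K + 2))

theorem log_add_two_pos (K : ℕ) : 0 < Real.log ((K : ℝ) + 2) := by
  refine Real.log_pos ?_
  have : (0 : ℝ) ≤ K := Nat.cast_nonneg K
  linarith

theorem depthConstant_pos (K : ℕ) : 0 < depthConstant K := by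
  have := log_add_two_pos K
  unfold depthConstant; positivity

/-- Below the depth bound, light cones have size at most `√d`. -/
theorem lightCone_le {K D : ℕ} {d : ℝ} (hd : 0 < d) (hD : (D : ℝ) < depthConstant K * Real.log d) :
    ((K : ℝ) + 1) ^ D ≤ √d := by
  have hl := log_add_two_pos K
  have hK : (0 : ℝ) ≤ K := Nat.cast_nonneg K
  calc ((K : ℝ) + 1) ^ D ≤ ((K : ℝ) + 2) ^ D :=
        pow_le_pow_left₀ (by positivity) (by linarith) _
    _ = Real.exp (D * Real.log (K + 2)) := by
        rw [Real.exp_nat_mul, Real.exp_log (by positivity)]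
    _ ≤ Real.exp (Real.log d * (1 / 2)) := by
        rw [Real.exp_le_exp]
        have := mul_le_mul_of_nonneg_right hD.le hl.le
        unfold depthConstant at this
        calc (D : ℝ) * Real.log (K + 2) ≤ _ := this
          _ = _ := by field_simp
    _ = √d := by rw [Real.sqrt_eq_rpow, Real.rpow_def_of_pos hd]

/-- Shallow states have overlap at most `1 / d + 1 / n` with a component. -/
theorem IsConfinedCode.overlap_le_inv_add_inv {C : CSSCode n} {d γ : ℝ} {w : ℕ}
    (h : IsConfinedCode C (d / 2) γ w) (hn : 0 < n) (hd : 1 ≤ d) {ε : ℝ} (hε0 : 0 < ε)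
    (hε1 : ε ≤ 1) (hs : (w / γ + 1) * (√d * (Real.log d / ε + 1)) ≤ d / 2)
    (hdim : ((lightStrings n (2 * ε * n)).card : ℝ) < 2 ^ C.numLogical * ((1 / d + 1 / n) / 2))
    {ψ : QState n} (hψ : ψ ∈ C.codeSpace) (hψ1 : ‖ψ‖ = 1)
    (p : (Fin n → ZMod 2) × (Fin n → ZMod 2)) {K D : ℕ}
    (hD : (D : ℝ) < depthConstant K * Real.log d) {φ : QState n} (hφ : IsPreparable K D φ) :
    ‖(C.component d ψ p).starProjection φ‖ ^ 2 ≤ 1 / d + 1 / n := by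
  have hd0 : 0 < d := by linarith
  have hn' : (0 : ℝ) < n := by exact_mod_cast hn
  have hlog : 0 ≤ Real.log d := Real.log_nonneg hd
  have hγ := h.gamma_pos
  have hsp := component_eq_span C hd0.le ψ p
  have hq : 0 ≤ 1 / d + 1 / (n : ℝ) := by positivity
  -- `log d / ε` conditioning steps suffice to push a probability below `1 / d`
  have h1 : (1 - ε) ^ (⌊Real.log d / ε⌋₊ + 1) < 1 / d + 1 / (n : ℝ) := by
    have h2 : Real.log d < ε * ((⌊Real.log d / ε⌋₊ + 1 : ℕ) : ℝ) := by
      have := Nat.lt_floor_add_one (Real.log d / ε)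
      rw [div_lt_iff₀ hε0] at this
      push_cast; linarith
    calc (1 - ε) ^ (⌊Real.log d / ε⌋₊ + 1)
        ≤ Real.exp (-ε) ^ (⌊Real.log d / ε⌋₊ + 1) := by
          refine pow_le_pow_left₀ (by linarith) ?_ _
          have := Real.add_one_le_exp (-ε); linarith
      _ = Real.exp (-(ε * ((⌊Real.log d / ε⌋₊ + 1 : ℕ) : ℝ))) := by
          rw [← Real.exp_nat_mul]; congr 1; ring
      _ < Real.exp (-Real.log d) := by rw [Real.exp_lt_exp]; linarith
      _ = 1 / d := by rw [Real.exp_neg, Real.exp_log hd0, one_div]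
      _ ≤ _ := le_add_of_nonneg_right (by positivity)
  have h2 : (w / γ + 1) * (((K : ℝ) + 1) ^ D * ((⌊Real.log d / ε⌋₊ : ℝ) + 1)) ≤ d / 2 := by
    refine le_trans ?_ hs
    refine mul_le_mul_of_nonneg_left ?_ (by positivity)
    refine mul_le_mul (lightCone_le hd0 hD) ?_ (by positivity) (Real.sqrt_nonneg _)
    have := Nat.floor_le (show 0 ≤ Real.log d / ε by positivity)
    linarith
  have h3 : (2 : ℝ) ^ C.numLogical ≤ Module.finrank ℂ (codeSubmodule C) := by
    exact_mod_cast two_pow_numLogical_le C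
  have h4 := h.overlap_le hn hψ hψ1 p hq hε0 hε1 h1 h2
    (hdim.trans_le (mul_le_mul_of_nonneg_right h3 (by positivity))) hφ
  simpa only [hsp] using h4

/-- The light cones of all conditioned qubits together stay below the confinement scale. -/
theorem eventually_sqrt_mul_log_le (A ε : ℝ) :
    ∀ᶠ x : ℝ in atTop, A * (√x * (Real.log x / ε + 1)) ≤ x / 2 := by
  have h1 : (fun x : ℝ => A * (Real.log x / ε + 1)) =o[atTop] fun x : ℝ => x ^ (1 / 2 : ℝ) := by
    refine Asymptotics.IsLittleO.const_mul_left ?_ A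
    refine Asymptotics.IsLittleO.add ?_ ?_
    · simp only [div_eq_inv_mul]
      exact (isLittleO_log_rpow_atTop (by norm_num)).const_mul_left _
    · exact Asymptotics.isLittleO_const_left.2 (Or.inr
        (tendsto_norm_atTop_atTop.comp (tendsto_rpow_atTop (by norm_num))))
  filter_upwards [h1.bound (show (0 : ℝ) < 1 / 2 by norm_num), eventually_ge_atTop 0] with x hx hx0
  rw [← Real.sqrt_eq_rpow, Real.norm_eq_abs, Real.norm_of_nonneg (Real.sqrt_nonneg x)] at hx
  have h2 := mul_le_mul_of_nonneg_left ((le_abs_self _).trans hx) (Real.sqrt_nonneg x)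
  have h3 := Real.mul_self_sqrt hx0
  calc A * (√x * (Real.log x / ε + 1)) = √x * (A * (Real.log x / ε + 1)) := by ring
    _ ≤ √x * (1 / 2 * √x) := h2
    _ = (√x * √x) / 2 := by ring
    _ = x / 2 := by rw [h3]

/-- At constant rate, the dimension of the code space exceeds the number of strings of small
relative weight by more than any polynomial factor. -/
theorem exists_lightStrings_lt {r : ℝ} (hr : 0 < r) : ∃ ε : ℝ, 0 < ε ∧ ε ≤ 1 ∧
    ∀ᶠ N : ℕ in atTop, ∀ k : ℕ, r * N ≤ k →
      ((lightStrings N (2 * ε * N)).card : ℝ) < 2 ^ k * (1 / N / 2) := by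
  have hl := Real.log_pos one_lt_two
  set c := r * Real.log 2 with hc
  have hc0 : 0 < c := by positivity
  set a := |Real.log (c / 4)| with ha
  have ha0 : 0 ≤ a := abs_nonneg _
  have hexpa : Real.exp (-a) ≤ c / 4 := by
    have h4 : 0 < c / 4 := by positivity
    rw [← Real.le_log_iff_exp_le h4]
    exact neg_abs_le _
  refine ⟨min 1 (c / (8 * (a + 1))), lt_min one_pos (by positivity), min_le_left _ _, ?_⟩
  set ε := min 1 (c / (8 * (a + 1))) with hε
  have hε0 : 0 < ε := lt_min one_pos (by positivity)
  have haε : a * (2 * ε) ≤ c / 4 := by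
    have h1 : ε ≤ c / (8 * (a + 1)) := min_le_right _ _
    rw [le_div_iff₀ (by positivity)] at h1
    nlinarith
  have hgrow := (tendsto_exp_mul_div_rpow_atTop 1 (c / 2) (by positivity)).comp
    tendsto_natCast_atTop_atTop
  filter_upwards [hgrow.eventually_gt_atTop 2, eventually_gt_atTop 0] with N hN hN0 k hk
  have hN0' : (0 : ℝ) < N := by exact_mod_cast hN0
  simp only [Function.comp, Real.rpow_one] at hN
  rw [lt_div_iff₀ hN0'] at hN
  have h1 : ((lightStrings N (2 * ε * N)).card : ℝ) ≤ Real.exp (c / 2 * N) := by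
    refine (card_lightStrings_le N _ ha0).trans (Real.exp_le_exp.2 ?_)
    have h2 := mul_le_mul_of_nonneg_right haε hN0'.le
    have h3 := mul_le_mul_of_nonneg_right hexpa hN0'.le
    linarith
  have h2 : Real.exp (c * N) ≤ 2 ^ k := by
    calc Real.exp (c * N) ≤ Real.exp (k * Real.log 2) := by
          rw [Real.exp_le_exp, hc]
          have := mul_le_mul_of_nonneg_right hk hl.le
          linarith
      _ = 2 ^ k := by rw [Real.exp_nat_mul, Real.exp_log two_pos]
  have h3 : Real.exp (c / 2 * N) * Real.exp (c / 2 * N) = Real.exp (c * N) := by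
    rw [← Real.exp_add]; congr 1; ring
  have h4 : 0 < Real.exp (c / 2 * N) := Real.exp_pos _
  calc ((lightStrings N (2 * ε * N)).card : ℝ) ≤ Real.exp (c / 2 * N) := h1
    _ < Real.exp (c / 2 * N) * (Real.exp (c / 2 * N) * (1 / N / 2)) := by
        refine lt_mul_of_one_lt_right h4 ?_
        rw [div_div, mul_one_div, one_lt_div (by positivity)]
        linarith
    _ = Real.exp (c * N) * (1 / N / 2) := by rw [← mul_assoc, h3]
    _ ≤ _ := mul_le_mul_of_nonneg_right h2 (by positivity)

/-- Gibbs samples are typical in both sectors, and the component of a typical eigenstate is a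
bottleneck. -/
theorem IsConfinedCode.one_sub_le_gibbsProb {C : CSSCode n} {d γ : ℝ} {w Δ : ℕ}
    (h : IsConfinedCode C (d / 2) γ w) (hΔ : DegreeLE C.interactionGraph Δ) (hd : 3 ≤ d)
    (hn : (n : ℝ) ≤ Real.exp d) {β : ℝ} (hβ : criticalBeta γ w Δ < β) {ψ : QState n}
    (hψ : ψ ∈ C.codeSpace) (hψ1 : ‖ψ‖ = 1) {S : Set ((Fin n → ZMod 2) × (Fin n → ZMod 2))}
    (hS : ∀ p, IsBottleneck (C.gibbsState β) (d / 4) (Real.exp (-1 * d)) (C.component d ψ p) →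
      p ∈ S) :
    1 - 2 * Real.exp (-1 * d) ≤ C.gibbsProb β S := by
  classical
  have hγ := h.gamma_pos
  have hβ0 : 0 ≤ β := (criticalBeta_pos hγ w Δ).le.trans hβ.le
  obtain ⟨hf₁, hf₂⟩ := fugacity_le hγ hβ
  have hd0 : 0 ≤ d := by linarith
  set D := ⌊d / 2⌋₊ + 1 with hDdef
  have hD : ∀ k : ℕ, k < D ↔ (k : ℝ) ≤ d / 2 := by
    intro k
    rw [hDdef, Nat.lt_succ_iff, Nat.le_floor_iff (by positivity)]
  have hD2 : d / 2 ≤ D := by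
    rw [hDdef]; push_cast; exact (Nat.lt_floor_add_one _).le
  have hq := sum_rootedSets_le_exp hΔ (by positivity) hf₁ hd0 hD2 hn
  have hq' := sum_rootedSets_le_exp hΔ (by positivity) hf₂ hd0 hD2 hn
  -- `exp (-3) ≤ 1 / 12`
  have hexp : Real.exp (-1 * d) ≤ 1 / 12 := by
    have h1 : (12 : ℝ) ≤ Real.exp d := by
      have h2 : Real.exp 1 ^ 3 ≤ Real.exp d := by
        rw [← Real.exp_nat_mul, Real.exp_le_exp]; push_cast; linarith
      have h3 := Real.exp_one_gt_d9
      have h4 : (2.7 : ℝ) ^ 3 ≤ Real.exp 1 ^ 3 := pow_le_pow_left₀ (by norm_num) (by linarith) _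
      have h5 : (12 : ℝ) ≤ 2.7 ^ 3 := by norm_num
      exact h5.trans (h4.trans h2)
    rw [neg_one_mul, Real.exp_neg, ← one_div]
    exact one_div_le_one_div_of_le (by norm_num) h1
  have hsq : Real.exp (-2 * d) = Real.exp (-1 * d) * Real.exp (-1 * d) := by
    rw [← Real.exp_add]; congr 1; ring
  have hpos := Real.exp_pos (-1 * d)
  have hq6 : 6 * (2 * Real.exp (-2 * d)) ≤ Real.exp (-1 * d) := by rw [hsq]; nlinarith
  have hmain := QSpinGlass.one_sub_le_gibbsProb C β (a := 2 * Real.exp (-2 * d))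
    (T₁ := Typical C.HZ C.interactionGraph D (γ / 24))
    (T₂ := Typical C.HX C.interactionGraph D (γ / 24)) ?_ ?_ (S := S) ?_
  · linarith
  · exact (sum_not_typical_le h.degZ hβ0).trans (mul_le_mul_of_nonneg_right hq'
      (Finset.sum_nonneg fun x _ => (boltz_pos _ _ x).le))
  · exact (sum_not_typical_le h.degX hβ0).trans (mul_le_mul_of_nonneg_right hq'
      (Finset.sum_nonneg fun x _ => (boltz_pos _ _ x).le))
  · intro p hp₁ hp₂
    refine hS p ?_
    have hb := h.isBottleneck hψ hψ1 hβ0 hD hp₁ hp₂ (by linarith) hq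
    rw [← component_eq_span C hd0, show d / 2 / 2 = d / 4 by ring] at hb
    exact ⟨hb.1, hb.2.trans hq6⟩

end Main
end

end QSpinGlass

theorem mainTheorem6 (n : ℕ → ℕ) (hn : Filter.Tendsto n Filter.atTop Filter.atTop)
    (C : ∀ t, QSpinGlass.CSSCode (n t)) (δ : ℕ → ℝ) (γ : ℝ)
    (hLDPC : QSpinGlass.IsLDPC C)
    (hrate : QSpinGlass.HasConstantRate C)
    (hconf : QSpinGlass.HasLinearConfinement C δ γ) :
    ∃ (βstar c₁ c₂ C₀ : ℝ) (c₃ : ℕ → ℝ) (η : ℕ → ℝ),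
      0 < βstar ∧ 0 < c₁ ∧ 0 < c₂ ∧ 0 < C₀ ∧ (∀ K, 0 < c₃ K) ∧
      Filter.Tendsto η Filter.atTop (nhds 0) ∧
      ∀ᶠ t in Filter.atTop, ∀ β : ℝ, βstar < β →
        ∀ ψ : QSpinGlass.QState (n t), ψ ∈ (C t).codeSpace → ‖ψ‖ = 1 →
          1 - C₀ * Real.exp (-c₁ * δ (n t)) ≤
            (C t).gibbsProb β {p |
              let ρ := (C t).gibbsState β
              let V := (C t).component (δ (n t)) ψ p
              let r := δ (n t) / 4
              let ε := Real.exp (-c₂ * δ (n t))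
              -- `V` satisfies the bottleneck condition and hosts an extremal Gibbs state
              QSpinGlass.IsBottleneck ρ r ε V ∧
              (∃ W ≤ V, QSpinGlass.IsExtremal ρ r ε W) ∧
              -- every extremal Gibbs state hosted by `V` is long-range entangled
              (∀ W ≤ V, QSpinGlass.IsExtremal ρ r ε W →
                QSpinGlass.IsDensity (QSpinGlass.stateComponent ρ W) ∧
                QSpinGlass.SupportedOn (QSpinGlass.stateComponent ρ W) V ∧
                ∀ K D : ℕ, (D : ℝ) < c₃ K * Real.log (δ (n t)) →
                  ¬ QSpinGlass.IsApproxPreparable K D (2 - η t)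
                    (QSpinGlass.stateComponent ρ W)) ∧
              -- so is every mixed state supported on `V`
              (∀ τ : QSpinGlass.Op (n t), QSpinGlass.IsDensity τ →
                QSpinGlass.SupportedOn τ V →
                ∀ K D : ℕ, (D : ℝ) < c₃ K * Real.log (δ (n t)) →
                  ¬ QSpinGlass.IsApproxPreparable K D (2 - η t) τ) ∧
              -- `V` contains no pure state of trivial circuit complexity
              (∀ φ ∈ V, ‖φ‖ = 1 →
                ∀ K D : ℕ, (D : ℝ) < c₃ K * Real.log (δ (n t)) →
                  ¬ QSpinGlass.IsPreparable K D φ)} := by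
  obtain ⟨wc, wb, hw⟩ := hLDPC
  obtain ⟨r, hr, hrate⟩ := hrate
  obtain ⟨ε, hε0, hε1, hlight⟩ := QSpinGlass.exists_lightStrings_lt hr
  have hγ := hconf.gamma_pos
  have hδ : Tendsto (fun t => δ (n t)) atTop atTop := hconf.diverges.comp hn
  have hncast : Tendsto (fun t => (n t : ℝ)) atTop atTop := tendsto_natCast_atTop_atTop.comp hn
  refine ⟨QSpinGlass.criticalBeta γ wb (2 * (wb * wc)), 1, 1, 2, QSpinGlass.depthConstant,
    fun t => 2 * (1 / δ (n t) + 1 / n t), QSpinGlass.criticalBeta_pos hγ _ _, one_pos, one_pos,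
    two_pos, QSpinGlass.depthConstant_pos, ?_, ?_⟩
  · have h := ((tendsto_inv_atTop_zero.comp hδ).add (tendsto_inv_atTop_zero.comp hncast)).const_mul 2
    simpa [Function.comp_def] using h
  filter_upwards [hδ.eventually_ge_atTop 3, hn.eventually_ge_atTop 2, hrate, hn.eventually hlight,
    hδ.eventually (QSpinGlass.eventually_sqrt_mul_log_le (wb / γ + 1) ε),
    (hconf.superlog.comp hn).eventually_lt_const one_pos] with t hd hn2 hk hlight hs hlog β hβ ψ hψ hψ1
  have hd0 : 0 < δ (n t) := by linarith
  have hn0 : 0 < n t := by lia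
  have hn0' : (0 : ℝ) < n t := by exact_mod_cast hn0
  have hnexp : (n t : ℝ) ≤ Real.exp (δ (n t)) := by
    rw [Function.comp, div_lt_one hd0] at hlog
    rw [← Real.log_le_iff_le_exp hn0']
    exact hlog.le
  obtain ⟨hX, hZ⟩ := hw t
  have hcode : QSpinGlass.IsConfinedCode (C t) (δ (n t) / 2) γ wb :=
    { e_nonneg := by positivity
      gamma_pos := hγ
      confX := fun x hx => hconf.boundary t x (by linarith)
      confZ := fun z hz => hconf.coboundary t z (by linarith)
      degX := hX.2
      degZ := hZ.2 }
  have hdim : ((QSpinGlass.lightStrings (n t) (2 * ε * n t)).card : ℝ) <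
      2 ^ (C t).numLogical * ((1 / δ (n t) + 1 / n t) / 2) := by
    refine (hlight _ hk).trans_le (mul_le_mul_of_nonneg_left ?_ (by positivity))
    have : 0 < 1 / δ (n t) := by positivity
    linarith
  have hover : ∀ (p : (Fin (n t) → ZMod 2) × (Fin (n t) → ZMod 2)) (K D : ℕ),
      (D : ℝ) < QSpinGlass.depthConstant K * Real.log (δ (n t)) →
      ∀ φ, QSpinGlass.IsPreparable K D φ →
        ‖((C t).component (δ (n t)) ψ p).starProjection φ‖ ^ 2 ≤ 1 / δ (n t) + 1 / n t :=
    fun p K D hD φ hφ => hcode.overlap_le_inv_add_inv hn0 (by linarith) hε0 hε1 hs hdim hψ hψ1 p hD hφ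
  refine hcode.one_sub_le_gibbsProb (QSpinGlass.degreeLE_interactionGraph (C t) hX hZ) hd hnexp hβ
    hψ hψ1 fun p hb => ?_
  have hmixed : ∀ τ : QSpinGlass.Op (n t), QSpinGlass.IsDensity τ →
      QSpinGlass.SupportedOn τ ((C t).component (δ (n t)) ψ p) →
      ∀ K D : ℕ, (D : ℝ) < QSpinGlass.depthConstant K * Real.log (δ (n t)) →
        ¬ QSpinGlass.IsApproxPreparable K D (2 - 2 * (1 / δ (n t) + 1 / n t)) τ :=
    fun τ hτ hsupp K D hD => QSpinGlass.not_isApproxPreparable (hover p K D hD) hτ hsupp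
  refine ⟨hb, hb.exists_isExtremal_le, fun W hW hext => ?_, hmixed, ?_⟩
  · have hdens := QSpinGlass.isDensity_stateComponent (QSpinGlass.posDef_gibbsState (C t) β) hext.1.1
    have hsupp := QSpinGlass.supportedOn_stateComponent ((C t).gibbsState β) hW
    exact ⟨hdens, hsupp, hmixed _ hdens hsupp⟩
  · intro φ hφ hφ1 K D hD hprep
    have h1 := hover p K D hD φ hprep
    rw [Submodule.starProjection_eq_self_iff.2 hφ, hφ1] at h1
    have h2 : 1 / δ (n t) ≤ 1 / 3 := one_div_le_one_div_of_le (by norm_num) hd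
    have h3 : 1 / (n t : ℝ) ≤ 1 / 2 := one_div_le_one_div_of_le (by norm_num) (by exact_mod_cast hn2)
    linarith
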